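/- **Setting.** Let $n\ge 0$ and let $\mathcal H_n=L^2(\mathbb R^n)$ be the Hilbert space of $n$ bosonic modes, with quadrature operators $\hat{\mathbf R}=(\hat x_1,\dots,\hat x_n,\hat p_1,\dots,\hat p_n)$, where $\hat x_a$ is multiplication by $x_a$ and $\hat p_a=-i\,\partial_{x_a}$. Let $\Omega=\begin{pmatrix}0&1_n\\-1_n&0\end{pmatrix}$. A *state* is a positive operator $\rho$ on $\mathcal H_n$ with $\operatorname{Tr}\rho=1$; a *pure state* is a unit vector $\psi\in\mathcal H_n$, with associated state $|\psi\rangle\langle\psi|$. A state has *finite second moments* if $\operatorname{Tr}[\hat R_j^2\rho]<\infty$ for all $j$, and its *mean* is $\mathbf m(\rho)=(\operatorname{Tr}[\hat R_j\rho])_j\in\mathbb R^{2n}$. Its characteristic function is $\chi_\rho(\mathbf r)=\operatorname{Tr}[D_{\mathbf r}\rho]$, $\mathbf r\in\mathbb R^{2n}$, with $D_{\mathbf r}=\exp(i\,\mathbf r^{\top}\Omega\hat{\mathbf R})$. The state $\rho$ is *Gaussian* if there are $\mathbf m\in\mathbb R^{2n}$ and a real symmetric positive semidefinite $2n\times 2n$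 matrix $V$ such that $\chi_\rho(\mathbf r)=\exp\bigl(-\tfrac14(\Omega\mathbf r)^{\top}V\,\Omega\mathbf r+i\,\mathbf r^{\top}\Omega\mathbf m\bigr)$ for all $\mathbf r$; a pure state $\psi$ is Gaussian, or has zero mean, if $|\psi\rangle\langle\psi|$ does. For $k\ge 1$ identify $\mathcal H_n^{\otimes k}$ with $L^2(\mathbb R^{n\times k})$, the $j$-th column of the matrix being the coordinate of the $j$-th copy. An orthogonal matrix $o\in O(k)$ acts by the unitary $(U_o\Psi)(\mathbf x)=\Psi(\mathbf x o)$. Let $O_s(k)$ be the group of *stochastic* orthogonal matrices, i.e. those $o\in O(k)$ fixing $(1,\dots,1)^{\top}$ (rows summing to $1$). A matrix $o\in O(k)$ is *nontrivial* if some entry is not in $\{0,1,-1\}$. (No element of $O_s(2)$ is nontrivial.) **Theorem.** (A) Let $\rho$ be a state on $\mathcal H_n$ with finite second moments. * For every $k\ge 2$ the following are equivalent: (1) $U_o\rho^{\otimes k}U_o^\dagger=\rho^{\otimes k}$ for all $o\in O(k)$; (2) $U_o\rho^{\otimes k}U_o^\dagger=\rho^{\otimes k}$ for some nontrivial $o\in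 O(k)$ with $o\notin O_s(k)$; (3) $\rho$ is Gaussian with zero mean. * For every $k\ge 3$ the following are equivalent: (1) $U_o\rho^{\otimes k}U_o^\dagger=\rho^{\otimes k}$ for all $o\in O_s(k)$; (2) $U_o\rho^{\otimes k}U_o^\dagger=\rho^{\otimes k}$ for some nontrivial $o\in O_s(k)$; (3) $\rho$ is Gaussian (with arbitrary mean). (B) Let $\psi\in\mathcal H_n$ be a pure state (no assumption on moments). * For every $k\ge 2$ the following are equivalent: (1) $U_o|\psi\rangle^{\otimes k}=|\psi\rangle^{\otimes k}$ for all $o\in O(k)$; (2) $U_o|\psi\rangle^{\otimes k}=|\psi\rangle^{\otimes k}$ for some nontrivial $o\in O(k)$ with $o\notin O_s(k)$; (3) $\psi$ is a pure Gaussian state with zero mean. * For every $k\ge 3$ the following are equivalent: (1) $U_o|\psi\rangle^{\otimes k}=|\psi\rangle^{\otimes k}$ for all $o\in O_s(k)$; (2) $U_o|\psi\rangle^{\otimes k}=|\psi\rangle^{\otimes k}$ for some nontrivial $o\in O_s(k)$; (3) $\psi$ is a pure Gaussian state. -/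

import Mathlib

open MeasureTheory Filter Topology InnerProductSpace
open scoped ENNReal Matrix

noncomputable section

namespace Bosonic

/-! ### Hilbert spaces -/

/-- The Hilbert space `L²(ℝⁿ)` of `n` bosonic modes. -/
abbrev Modes (n : ℕ) : Type :=
  Lp ℂ 2 (volume : Measure (Fin n → ℝ))

/-- The Hilbert space `L²(ℝ^{n × k})` of `k` copies of `n` modes. A point `x : Fin k → Fin n → ℝ`
is the `n × k` matrix whose `j`-th column is `x j`, the coordinate of the `j`-th copy. -/
abbrev Copies (n k : ℕ) : Type :=
  Lp ℂ 2 (volume : Measure (Fin k → Fin n → ℝ))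

/-! ### Tensor products of vectors -/

theorem memLp_tensor {n k : ℕ} (ψ : Fin k → Modes n) :
    MemLp (fun x : Fin k → Fin n → ℝ => ∏ j, ψ j (x j)) 2 volume := by
  have hm : AEStronglyMeasurable (fun x : Fin k → Fin n → ℝ => ∏ j, ψ j (x j)) volume := by
    refine StronglyMeasurable.aestronglyMeasurable ?_
    refine Finset.stronglyMeasurable_fun_prod _ fun j _ => ?_
    exact (Lp.stronglyMeasurable (ψ j)).comp_measurable (measurable_pi_apply j)
  rw [memLp_two_iff_integrable_sq_norm hm]
  have h := Integrable.fintype_prod (𝕜 := ℝ) (ι := Fin k) (E := Fin n → ℝ)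
    (μ := fun _ => volume) (f := fun j x => ‖ψ j x‖ ^ 2)
    (fun j => (memLp_two_iff_integrable_sq_norm (Lp.aestronglyMeasurable (ψ j))).1
      (Lp.memLp (ψ j)))
  refine h.congr (Eventually.of_forall fun x => ?_)
  simp [norm_prod, Finset.prod_pow]

/-- The product vector `ψ₁ ⊗ ⋯ ⊗ ψₖ`, i.e. the function `x ↦ ∏ⱼ ψⱼ(xⱼ)` on `ℝ^{n × k}`. -/
def tensor {n k : ℕ} (ψ : Fin k → Modes n) : Copies n k :=
  (memLp_tensor ψ).toLp _

/-- The tensor power `ψ^{⊗k}` of a vector. -/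
def vecTensorPow {n : ℕ} (k : ℕ) (ψ : Modes n) : Copies n k :=
  tensor fun _ => ψ

theorem coeFn_tensor {n k : ℕ} (ψ : Fin k → Modes n) :
    tensor ψ =ᵐ[volume] fun x : Fin k → Fin n → ℝ => ∏ j, ψ j (x j) :=
  (memLp_tensor ψ).coeFn_toLp

theorem inner_tensor {n k : ℕ} (φ ψ : Fin k → Modes n) :
    ⟪tensor φ, tensor ψ⟫_ℂ = ∏ j, ⟪φ j, ψ j⟫_ℂ := by
  simp only [L2.inner_def]
  rw [← integral_fintype_prod_volume_eq_prod (fun j x => ⟪φ j x, ψ j x⟫_ℂ)]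
  refine integral_congr_ae ?_
  filter_upwards [coeFn_tensor φ, coeFn_tensor ψ] with x h1 h2
  simp only [h1, h2, RCLike.inner_apply, map_prod, Finset.prod_mul_distrib]

theorem norm_tensor {n k : ℕ} (ψ : Fin k → Modes n) : ‖tensor ψ‖ = ∏ j, ‖ψ j‖ := by
  have h := inner_tensor ψ ψ
  simp only [inner_self_eq_norm_sq_to_K, Finset.prod_pow] at h
  have h' : ‖tensor ψ‖ ^ 2 = (∏ j, ‖ψ j‖) ^ 2 := by
    exact_mod_cast h
  exact (pow_left_inj₀ (norm_nonneg _) (Finset.prod_nonneg fun _ _ => norm_nonneg _)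
    two_ne_zero).1 h'

/-- The product vector as a continuous multilinear function of its factors. -/
def tensorCMM (n k : ℕ) : ContinuousMultilinearMap ℂ (fun _ : Fin k => Modes n) (Copies n k) :=
  MultilinearMap.mkContinuous
    { toFun := tensor
      map_update_add' := fun {inst} m i x y => by
        rw [tensor, tensor, tensor, ← MemLp.toLp_add]
        refine MemLp.toLp_congr _ _ ?_
        have h : ∀ᵐ z : Fin k → Fin n → ℝ ∂volume, (x + y : Modes n) (z i) = x (z i) + y (z i) :=
          (Measure.quasiMeasurePreserving_eval (fun _ : Fin k => (volume : Measure (Fin n → ℝ)))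
            i).ae (Lp.coeFn_add x y)
        filter_upwards [h] with z hz
        have hu : ∀ v : Modes n, ∏ j, (Function.update m i v j) (z j)
            = v (z i) * ∏ j ∈ Finset.univ.erase i, m j (z j) := fun v => by
          rw [← Finset.mul_prod_erase Finset.univ _ (Finset.mem_univ i), Function.update_self]
          refine congrArg _ (Finset.prod_congr rfl fun j hj => ?_)
          rw [Function.update_of_ne (Finset.ne_of_mem_erase hj)]
        rw [Pi.add_apply, hu, hu, hu, hz, add_mul]
      map_update_smul' := fun {inst} m i c x => by
        rw [tensor, tensor, ← MemLp.toLp_const_smul]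
        refine MemLp.toLp_congr _ _ ?_
        have h : ∀ᵐ z : Fin k → Fin n → ℝ ∂volume, (c • x : Modes n) (z i) = c * x (z i) :=
          (Measure.quasiMeasurePreserving_eval (fun _ : Fin k => (volume : Measure (Fin n → ℝ)))
            i).ae (Lp.coeFn_smul c x)
        filter_upwards [h] with z hz
        have hu : ∀ v : Modes n, ∏ j, (Function.update m i v j) (z j)
            = v (z i) * ∏ j ∈ Finset.univ.erase i, m j (z j) := fun v => by
          rw [← Finset.mul_prod_erase Finset.univ _ (Finset.mem_univ i), Function.update_self]
          refine congrArg _ (Finset.prod_congr rfl fun j hj => ?_)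
          rw [Function.update_of_ne (Finset.ne_of_mem_erase hj)]
        rw [Pi.smul_apply, hu, hu, hz, smul_eq_mul, mul_assoc] }
    1 (fun m => by
      change ‖tensor m‖ ≤ _
      rw [norm_tensor, one_mul])

/-! ### The action of the orthogonal group on the copies -/

/-- Right multiplication `x ↦ x o` of an `n × k` matrix `x` by a `k × k` matrix `o`: the `b`-th
column of `x o` is `∑ c, o c b • x c`. -/
def rightMul (n : ℕ) {k : ℕ} (o : Matrix (Fin k) (Fin k) ℝ) :
    (Fin k → Fin n → ℝ) →ₗ[ℝ] (Fin k → Fin n → ℝ) where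
  toFun x := fun b => ∑ c, o c b • x c
  map_add' x y := by
    funext b
    simp [Finset.sum_add_distrib]
  map_smul' t x := by
    funext b
    simp [Finset.smul_sum, smul_smul, mul_comm]

theorem rightMul_comp_transpose (n : ℕ) {k : ℕ} {o : Matrix (Fin k) (Fin k) ℝ}
    (ho : o * oᵀ = 1) (x : Fin k → Fin n → ℝ) :
    rightMul n oᵀ (rightMul n o x) = x := by
  funext b
  simp only [rightMul, LinearMap.coe_mk, AddHom.coe_mk, Finset.smul_sum, smul_smul]
  rw [Finset.sum_comm]
  simp only [← Finset.sum_smul]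
  have h : ∀ c, ∑ d, oᵀ d b * o c d = (1 : Matrix (Fin k) (Fin k) ℝ) b c := fun c => by
    rw [← Matrix.transpose_one, ← ho, Matrix.transpose_apply, Matrix.mul_apply]
    exact Finset.sum_congr rfl fun d _ => mul_comm _ _
  simp only [h, Matrix.one_apply, ite_smul, one_smul, zero_smul]
  simp

theorem rightMul_sum_sq (n : ℕ) {k : ℕ} {o : Matrix (Fin k) (Fin k) ℝ}
    (ho : o * oᵀ = 1) (x : Fin k → Fin n → ℝ) :
    ∑ b, ∑ a, (rightMul n o x b a) ^ 2 = ∑ b, ∑ a, (x b a) ^ 2 := by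
  rw [Finset.sum_comm, Finset.sum_comm (f := fun b a => (x b a) ^ 2)]
  refine Finset.sum_congr rfl fun a _ => ?_
  have h1 : ∀ b, rightMul n o x b a = ((fun c => x c a) ᵥ* o) b := fun b => by
    simp [rightMul, Matrix.vecMul, dotProduct, mul_comm]
  have h2 : ((fun c => x c a) ᵥ* o) ⬝ᵥ ((fun c => x c a) ᵥ* o)
      = (fun c => x c a) ⬝ᵥ (fun c => x c a) := by
    rw [← Matrix.dotProduct_mulVec, ← Matrix.mulVec_transpose, Matrix.mulVec_mulVec, ho,
      Matrix.one_mulVec]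
  simpa [dotProduct, h1, sq] using h2

/-- Right multiplication by an orthogonal matrix preserves Lebesgue measure on `ℝ^{n × k}`. -/
theorem measurePreserving_rightMul (n : ℕ) {k : ℕ} {o : Matrix (Fin k) (Fin k) ℝ}
    (ho : o * oᵀ = 1) :
    MeasurePreserving (rightMul n o) volume volume := by
  have hinj : Function.Injective (rightMul n o) :=
    Function.LeftInverse.injective (rightMul_comp_transpose n ho)
  have hdet : LinearMap.det (rightMul n o) ≠ 0 := by
    exact ((LinearMap.isUnit_iff_isUnit_det _).1
      ((LinearMap.isUnit_iff_ker_eq_bot _).2 (LinearMap.ker_eq_bot.2 hinj))).ne_zero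
  set s : Set (Fin k → Fin n → ℝ) := {x | ∑ b, ∑ a, (x b a) ^ 2 < 1} with hs
  have hpre : rightMul n o ⁻¹' s = s := by
    ext x
    simp [hs, rightMul_sum_sq n ho x]
  have hopen : IsOpen s := isOpen_lt (by fun_prop) continuous_const
  have h0 : volume s ≠ 0 := (hopen.measure_pos volume ⟨0, by simp [hs]⟩).ne'
  have htop : volume s ≠ ∞ := by
    refine ((measure_mono ?_).trans_lt
      (isCompact_closedBall (0 : Fin k → Fin n → ℝ) 1).measure_lt_top).ne
    intro x hx
    rw [mem_closedBall_zero_iff, pi_norm_le_iff_of_nonneg zero_le_one]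
    intro b
    rw [pi_norm_le_iff_of_nonneg zero_le_one]
    intro a
    have h1 : (x b a) ^ 2 ≤ ∑ a, (x b a) ^ 2 :=
      Finset.single_le_sum (f := fun a => (x b a) ^ 2) (fun _ _ => sq_nonneg _) (Finset.mem_univ a)
    have h2 : ∑ a, (x b a) ^ 2 ≤ ∑ b, ∑ a, (x b a) ^ 2 :=
      Finset.single_le_sum (f := fun b => ∑ a, (x b a) ^ 2)
        (fun _ _ => Finset.sum_nonneg fun _ _ => sq_nonneg _) (Finset.mem_univ b)
    have h3 : ∑ b, ∑ a, (x b a) ^ 2 < 1 := hx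
    rw [Real.norm_eq_abs, ← sq_le_one_iff_abs_le_one]
    linarith
  have hmul := Measure.addHaar_preimage_linearMap volume hdet s
  rw [hpre] at hmul
  have hone : ENNReal.ofReal |(LinearMap.det (rightMul n o))⁻¹| = 1 :=
    ((ENNReal.mul_eq_right h0 htop).1 hmul.symm)
  refine ⟨(LinearMap.continuous_of_finiteDimensional _).measurable, ?_⟩
  rw [Measure.map_linearMap_addHaar_eq_smul_addHaar _ hdet, hone, one_smul]

theorem mul_transpose_of_orthogonal {k : ℕ} (o : Matrix.orthogonalGroup (Fin k) ℝ) :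
    (o : Matrix (Fin k) (Fin k) ℝ) * (o : Matrix (Fin k) (Fin k) ℝ)ᵀ = 1 :=
  (Matrix.mem_orthogonalGroup_iff (Fin k) ℝ).1 o.2

/-- The unitary `U_o` on `L²(ℝ^{n × k})`, `(U_o ψ)(x) = ψ(x o)`. -/
def rotation (n : ℕ) {k : ℕ} (o : Matrix.orthogonalGroup (Fin k) ℝ) :
    Copies n k →L[ℂ] Copies n k :=
  (Lp.compMeasurePreservingₗᵢ ℂ (rightMul n (o : Matrix (Fin k) (Fin k) ℝ))
    (measurePreserving_rightMul n (mul_transpose_of_orthogonal o))).toContinuousLinearMap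

/-- An orthogonal matrix is nontrivial if not all of its entries lie in `{0, 1, -1}`. -/
def IsNontrivial {k : ℕ} (o : Matrix.orthogonalGroup (Fin k) ℝ) : Prop :=
  ∃ i j, (o : Matrix (Fin k) (Fin k) ℝ) i j ∉ ({0, 1, -1} : Set ℝ)

/-- An orthogonal matrix is stochastic if it fixes the vector `(1, …, 1)`, i.e. if all of its rows
sum to `1`. -/
def IsStochastic {k : ℕ} (o : Matrix.orthogonalGroup (Fin k) ℝ) : Prop :=
  (o : Matrix (Fin k) (Fin k) ℝ) *ᵥ 1 = 1

/-! ### Density operators and their tensor powers -/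

/-- The index set of a fixed Hilbert basis of `L²(ℝⁿ)`. -/
def basisIndex (n : ℕ) : Set (Modes n) :=
  (exists_hilbertBasis ℂ (Modes n)).choose

/-- A fixed Hilbert basis of `L²(ℝⁿ)`, used to write traces as sums. -/
def basis (n : ℕ) : HilbertBasis (basisIndex n) ℂ (Modes n) :=
  (exists_hilbertBasis ℂ (Modes n)).choose_spec.choose

/-- Density operators: positive operators of trace one. (For a positive operator the sum of the
diagonal elements does not depend on the Hilbert basis.) -/
structure IsDensityOperator {n : ℕ} (ρ : Modes n →L[ℂ] Modes n) : Prop where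
  isPositive : ρ.IsPositive
  trace_eq_one : HasSum (fun i => ⟪basis n i, ρ (basis n i)⟫_ℂ) 1

/-- The density operator `|ψ⟩⟨ψ|` of a pure state. -/
def pureState {n : ℕ} (ψ : Modes n) : Modes n →L[ℂ] Modes n :=
  rankOne ℂ ψ ψ

/-- The positive square root of a positive bounded operator on a Hilbert space. -/
def opSqrt {H : Type*} [NormedAddCommGroup H] [InnerProductSpace ℂ H] [CompleteSpace H]
    (A : H →L[ℂ] H) : H →L[ℂ] H :=
  CFC.sqrt A

theorem inner_opSqrt {H : Type*} [NormedAddCommGroup H] [InnerProductSpace ℂ H] [CompleteSpace H]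
    (A : H →L[ℂ] H) (x y : H) : ⟪opSqrt A x, y⟫_ℂ = ⟪x, opSqrt A y⟫_ℂ :=
  ((ContinuousLinearMap.nonneg_iff_isPositive _).1 (CFC.sqrt_nonneg A)).isSymmetric x y

theorem opSqrt_opSqrt {H : Type*} [NormedAddCommGroup H] [InnerProductSpace ℂ H] [CompleteSpace H]
    {A : H →L[ℂ] H} (hA : A.IsPositive) (x : H) : opSqrt A (opSqrt A x) = A x := by
  have h : CFC.sqrt A * CFC.sqrt A = A :=
    CFC.sqrt_mul_sqrt_self A ((ContinuousLinearMap.nonneg_iff_isPositive _).2 hA)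
  exact congrArg (fun B : H →L[ℂ] H => B x) h

/-- The vectors `√ρ eᵢ`, for the fixed Hilbert basis `e`. They satisfy `ρ = ∑ i, |√ρ eᵢ⟩⟨√ρ eᵢ|` and
`∑ i, ‖√ρ eᵢ‖² = Tr ρ`. -/
def sqrtVec {n : ℕ} (ρ : Modes n →L[ℂ] Modes n) (i : basisIndex n) : Modes n :=
  opSqrt ρ (basis n i)

/-- The operator `∑ i, |vᵢ⟩⟨vᵢ|`, a sum which converges in operator norm if `∑ i, ‖vᵢ‖²` is finite. -/
def sumRankOne {ι H : Type*} [NormedAddCommGroup H] [InnerProductSpace ℂ H] (v : ι → H) :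
    H →L[ℂ] H :=
  ∑' i, rankOne ℂ (v i) (v i)

theorem hasSum_sumRankOne {ι H : Type*} [NormedAddCommGroup H] [InnerProductSpace ℂ H]
    [CompleteSpace H] {v : ι → H} (hv : Summable fun i => ‖v i‖ ^ 2) (x : H) :
    HasSum (fun i => ⟪v i, x⟫_ℂ • v i) (sumRankOne v x) := by
  have h : Summable fun i => rankOne ℂ (v i) (v i) :=
    Summable.of_norm (hv.congr fun i => by rw [norm_rankOne, sq])
  exact h.hasSum.mapL (ContinuousLinearMap.apply ℂ H x)

/-- The tensor power `ρ^{⊗k}` on `L²(ℝ^{n × k})` of a density operator `ρ = ∑ i, |φᵢ⟩⟨φᵢ|`, where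
`φᵢ = √ρ eᵢ`: the sum `∑ I, |φ_{I₁} ⊗ ⋯ ⊗ φ_{Iₖ}⟩⟨φ_{I₁} ⊗ ⋯ ⊗ φ_{Iₖ}|`. See `tensorPow_tensor` for its
action on product vectors, which determines it. -/
def tensorPow {n : ℕ} (k : ℕ) (ρ : Modes n →L[ℂ] Modes n) : Copies n k →L[ℂ] Copies n k :=
  sumRankOne fun I : Fin k → basisIndex n => tensor fun j => sqrtVec ρ (I j)

theorem hasSum_sqrtVec {n : ℕ} {ρ : Modes n →L[ℂ] Modes n} (hρ : ρ.IsPositive) (ψ : Modes n) :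
    HasSum (fun i => ⟪sqrtVec ρ i, ψ⟫_ℂ • sqrtVec ρ i) (ρ ψ) := by
  have h := ((basis n).hasSum_repr (opSqrt ρ ψ)).mapL (opSqrt ρ)
  rw [opSqrt_opSqrt hρ] at h
  refine h.congr_fun fun i => ?_
  rw [map_smul, HilbertBasis.repr_apply_apply, sqrtVec, inner_opSqrt]

theorem summable_sqrtVec {n : ℕ} {ρ : Modes n →L[ℂ] Modes n} (hρ : IsDensityOperator ρ) :
    Summable fun i => ‖sqrtVec ρ i‖ ^ 2 := by
  have h := (Complex.hasSum_re hρ.trace_eq_one).summable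
  refine h.congr fun i => ?_
  rw [← opSqrt_opSqrt hρ.isPositive, ← inner_opSqrt, ← sqrtVec, ← inner_self_eq_norm_sq (𝕜 := ℂ)]
  rfl

theorem summable_prod_pi {ι : Type*} {f : ι → ℝ} (k : ℕ) (hf : Summable f) (h0 : ∀ i, 0 ≤ f i) :
    Summable fun I : Fin k → ι => ∏ j, f (I j) := by
  classical
  refine summable_of_sum_le (c := ∏ _j : Fin k, ∑' i, f i)
    (fun I => Finset.prod_nonneg fun j _ => h0 (I j)) fun s => ?_
  calc ∑ I ∈ s, ∏ j, f (I j)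
      ≤ ∑ I ∈ Fintype.piFinset fun j => s.image fun I => I j, ∏ j, f (I j) := by
        refine Finset.sum_le_sum_of_subset_of_nonneg (fun I hI => ?_)
          fun I _ _ => Finset.prod_nonneg fun j _ => h0 (I j)
        exact Fintype.mem_piFinset.2 fun j => Finset.mem_image_of_mem (fun I => I j) hI
    _ = ∏ j : Fin k, ∑ i ∈ s.image fun I => I j, f i := by
        rw [Finset.prod_univ_sum]
    _ ≤ ∏ _j : Fin k, ∑' i, f i :=
        Finset.prod_le_prod (fun _ _ => Finset.sum_nonneg fun i _ => h0 i)
          fun _ _ => hf.sum_le_tsum _ fun i _ => h0 i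

theorem summable_tensor_sqrtVec {n : ℕ} (k : ℕ) {ρ : Modes n →L[ℂ] Modes n}
    (hρ : IsDensityOperator ρ) :
    Summable fun I : Fin k → basisIndex n => ‖tensor fun j => sqrtVec ρ (I j)‖ ^ 2 := by
  have h := summable_prod_pi (f := fun i => ‖sqrtVec ρ i‖ ^ 2) k (summable_sqrtVec hρ)
    fun _ => sq_nonneg _
  refine h.congr fun I => ?_
  rw [norm_tensor, Finset.prod_pow]

/-- `ρ^{⊗k}` maps `ψ₁ ⊗ ⋯ ⊗ ψₖ` to `ρ ψ₁ ⊗ ⋯ ⊗ ρ ψₖ`. -/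
theorem tensorPow_tensor {n k : ℕ} {ρ : Modes n →L[ℂ] Modes n} (hρ : IsDensityOperator ρ)
    (ψ : Fin k → Modes n) : tensorPow k ρ (tensor ψ) = tensor fun j => ρ (ψ j) := by
  classical
  have h1 := hasSum_sumRankOne (summable_tensor_sqrtVec k hρ) (tensor ψ)
  have hbox : Tendsto (fun s : Finset (basisIndex n) => Fintype.piFinset fun _ : Fin k => s)
      atTop atTop := by
    refine tendsto_atTop_finset_of_monotone (fun s t hst => Fintype.piFinset_subset _ _ fun _ => hst)
      fun I => ⟨Finset.univ.image I, ?_⟩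
    exact Fintype.mem_piFinset.2 fun j => Finset.mem_image_of_mem _ (Finset.mem_univ j)
  have h2 := h1.comp hbox
  have h3 : Tendsto (fun s : Finset (basisIndex n) =>
      tensorCMM n k fun j => ∑ i ∈ s, ⟪sqrtVec ρ i, ψ j⟫_ℂ • sqrtVec ρ i) atTop
      (𝓝 (tensorCMM n k fun j => ρ (ψ j))) :=
    ((tensorCMM n k).cont.tendsto _).comp
      (tendsto_pi_nhds.2 fun j => hasSum_sqrtVec hρ.isPositive (ψ j))
  refine tendsto_nhds_unique h2 (h3.congr fun s => ?_)
  rw [ContinuousMultilinearMap.map_sum_finset]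
  refine Finset.sum_congr rfl fun I _ => ?_
  rw [ContinuousMultilinearMap.map_smul_univ]
  change _ = ⟪tensor fun j => sqrtVec ρ (I j), tensor ψ⟫_ℂ • tensor fun j => sqrtVec ρ (I j)
  rw [inner_tensor]
  rfl

/-! ### Displacement operators, quadratures and moments -/

/-- Translation `(T_h ψ)(x) = ψ(x + h)`. -/
def translate {n : ℕ} (h : Fin n → ℝ) : Modes n →ₗᵢ[ℂ] Modes n :=
  Lp.compMeasurePreservingₗᵢ ℂ (fun x => x + h) (measurePreserving_add_right volume h)

theorem memLp_phase {n : ℕ} {θ : (Fin n → ℝ) → ℝ} (hθ : Continuous θ) (ψ : Modes n) :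
    MemLp (fun x => Complex.exp (Complex.I * θ x) * ψ x) 2 volume := by
  refine (Lp.memLp ψ).of_le ?_ (Eventually.of_forall fun x => ?_)
  · exact (Continuous.aestronglyMeasurable (by fun_prop)).mul (Lp.aestronglyMeasurable ψ)
  · rw [norm_mul, mul_comm Complex.I, Complex.norm_exp_ofReal_mul_I, one_mul]

/-- Multiplication by the phase `exp (i θ(x))`. -/
def phase {n : ℕ} (θ : (Fin n → ℝ) → ℝ) (hθ : Continuous θ) : Modes n →ₗᵢ[ℂ] Modes n where
  toFun ψ := (memLp_phase hθ ψ).toLp _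
  map_add' ψ φ := by
    rw [← MemLp.toLp_add]
    refine MemLp.toLp_congr _ _ ?_
    filter_upwards [Lp.coeFn_add ψ φ] with x hx
    rw [hx, Pi.add_apply, Pi.add_apply, mul_add]
  map_smul' c ψ := by
    rw [RingHom.id_apply, ← MemLp.toLp_const_smul]
    refine MemLp.toLp_congr _ _ ?_
    filter_upwards [Lp.coeFn_smul c ψ] with x hx
    simp only [hx, Pi.smul_apply, smul_eq_mul]
    ring
  norm_map' ψ := by
    change ‖(memLp_phase hθ ψ).toLp _‖ = _
    rw [Lp.norm_toLp, Lp.norm_def]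
    congr 1
    refine eLpNorm_congr_norm_ae (Eventually.of_forall fun x => ?_)
    rw [norm_mul, mul_comm Complex.I, Complex.norm_exp_ofReal_mul_I, one_mul]

/-- The symplectic form `Ω = [[0, 1], [-1, 0]]` on the phase space `ℝ²ⁿ`, whose points are
`r = (x₁, …, xₙ, p₁, …, pₙ)`, with `Sum.inl` indexing positions and `Sum.inr` momenta. -/
def Omega (n : ℕ) : Matrix (Fin n ⊕ Fin n) (Fin n ⊕ Fin n) ℝ :=
  Matrix.fromBlocks 0 1 (-1) 0

/-- The displacement (Weyl) operator `D_r = exp (i rᵀ Ω R) = exp (i (q · p̂ - p · x̂))` at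
`r = (q, p)`, where `R = (x̂₁, …, x̂ₙ, p̂₁, …, p̂ₙ)`. Concretely, since `[x̂, p̂] = i`,
`(D_r ψ)(x) = exp (-i p · (x + q / 2)) ψ(x + q)`. -/
def displacement {n : ℕ} (r : Fin n ⊕ Fin n → ℝ) : Modes n →L[ℂ] Modes n :=
  ((phase (fun x => -((r ∘ Sum.inr) ⬝ᵥ (x + (1 / 2 : ℝ) • (r ∘ Sum.inl))))
    (by unfold dotProduct; fun_prop)).comp (translate (r ∘ Sum.inl))).toContinuousLinearMap

/-- The characteristic function `χ_ρ(r) = Tr[D_r ρ]`. -/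
def charFn {n : ℕ} (ρ : Modes n →L[ℂ] Modes n) (r : Fin n ⊕ Fin n → ℝ) : ℂ :=
  ∑' i, ⟪basis n i, displacement r (ρ (basis n i))⟫_ℂ

theorem memLp_position_add {n : ℕ} {a : Fin n} {ψ φ : Modes n}
    (hψ : MemLp (fun x => (x a : ℂ) * ψ x) 2 volume)
    (hφ : MemLp (fun x => (x a : ℂ) * φ x) 2 volume) :
    MemLp (fun x => (x a : ℂ) * (ψ + φ : Modes n) x) 2 volume := by
  refine (hψ.add hφ).ae_eq ?_
  filter_upwards [Lp.coeFn_add ψ φ] with x hx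
  rw [hx, Pi.add_apply, Pi.add_apply, mul_add]

theorem memLp_position_smul {n : ℕ} {a : Fin n} {ψ : Modes n} (c : ℂ)
    (hψ : MemLp (fun x => (x a : ℂ) * ψ x) 2 volume) :
    MemLp (fun x => (x a : ℂ) * (c • ψ : Modes n) x) 2 volume := by
  refine (hψ.const_smul c).ae_eq ?_
  filter_upwards [Lp.coeFn_smul c ψ] with x hx
  simp only [hx, Pi.smul_apply, smul_eq_mul]
  ring

/-- The position operator `x̂ₐ` of the `a`-th mode: multiplication by `xₐ`, on the domain of those `ψ`
with `xₐ ψ ∈ L²`. -/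
def position {n : ℕ} (a : Fin n) : Modes n →ₗ.[ℂ] Modes n where
  domain :=
    { carrier := {ψ | MemLp (fun x => (x a : ℂ) * ψ x) 2 volume}
      add_mem' := fun hψ hφ => memLp_position_add hψ hφ
      zero_mem' := by
        refine (MemLp.zero (ε := ℂ)).ae_eq ?_
        filter_upwards [Lp.coeFn_zero ℂ 2 (volume : Measure (Fin n → ℝ))] with x hx
        simp
      smul_mem' := fun c _ hψ => memLp_position_smul c hψ }
  toFun :=
    { toFun := fun ψ => MemLp.toLp _ ψ.2
      map_add' := fun ψ φ => by
        rw [← MemLp.toLp_add]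
        refine MemLp.toLp_congr _ _ ?_
        filter_upwards [Lp.coeFn_add (ψ : Modes n) φ] with x hx
        rw [Submodule.coe_add, hx, Pi.add_apply, Pi.add_apply, mul_add]
      map_smul' := fun c ψ => by
        rw [RingHom.id_apply, ← MemLp.toLp_const_smul]
        refine MemLp.toLp_congr _ _ ?_
        filter_upwards [Lp.coeFn_smul c (ψ : Modes n)] with x hx
        simp only [Submodule.coe_smul, hx, Pi.smul_apply, smul_eq_mul]
        ring }

/-- The momentum operator `p̂ₐ = -i ∂ₐ` of the `a`-th mode, where `∂ₐ ψ` is the limit in `L²` of the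
difference quotients `(ψ(· + t eₐ) - ψ) / t` as `t → 0`, on the domain of those `ψ` for which this
limit exists. -/
def momentum {n : ℕ} (a : Fin n) : Modes n →ₗ.[ℂ] Modes n where
  domain :=
    { carrier := {ψ | DifferentiableAt ℝ (fun t : ℝ => translate (Pi.single a t) ψ) 0}
      add_mem' := fun {ψ φ} hψ hφ => by
        simpa only [Set.mem_ofPred_eq, map_add] using DifferentiableAt.fun_add hψ hφ
      zero_mem' := by simp
      smul_mem' := fun c ψ hψ => by
        simpa only [Set.mem_ofPred_eq, map_smul] using DifferentiableAt.fun_const_smul hψ c }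
  toFun :=
    { toFun := fun ψ => -Complex.I • deriv (fun t : ℝ => translate (Pi.single a t) (ψ : Modes n)) 0
      map_add' := fun ψ φ => by
        simp only [Submodule.coe_add, map_add]
        rw [deriv_fun_add ψ.2 φ.2, smul_add]
      map_smul' := fun c ψ => by
        simp only [Submodule.coe_smul, map_smul, RingHom.id_apply]
        rw [deriv_fun_const_smul c ψ.2, smul_comm] }

/-- The vector `R = (x̂₁, …, x̂ₙ, p̂₁, …, p̂ₙ)` of quadrature operators. -/
def quadrature {n : ℕ} : Fin n ⊕ Fin n → (Modes n →ₗ.[ℂ] Modes n) :=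
  Sum.elim position momentum

/-- `ρ` has finite second moments: `Tr[R_j² ρ] = Tr[√ρ R_j² √ρ] = ∑ i, ‖R_j √ρ eᵢ‖²` is finite for all
`j`. -/
def HasFiniteSecondMoments {n : ℕ} (ρ : Modes n →L[ℂ] Modes n) : Prop :=
  ∀ j, ∃ h : ∀ i, sqrtVec ρ i ∈ (quadrature j).domain,
    Summable fun i => ‖quadrature j ⟨sqrtVec ρ i, h i⟩‖ ^ 2

/-- `ρ` has the first moment `m ∈ ℝ²ⁿ`: the traces
`Tr[R_j ρ] = Tr[√ρ R_j √ρ] = ∑ i, ⟨√ρ eᵢ, R_j √ρ eᵢ⟩` exist and are equal to `m j`. -/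
def HasMean {n : ℕ} (ρ : Modes n →L[ℂ] Modes n) (m : Fin n ⊕ Fin n → ℝ) : Prop :=
  ∀ j, ∃ h : ∀ i, sqrtVec ρ i ∈ (quadrature j).domain,
    HasSum (fun i => ⟪sqrtVec ρ i, quadrature j ⟨sqrtVec ρ i, h i⟩⟫_ℂ) (m j : ℂ)

/-- `ρ` is Gaussian: its characteristic function is the Gaussian
`χ_ρ(r) = exp (-¼ (Ω r)ᵀ V (Ω r) + i rᵀ Ω m)`, for a real vector `m` and a real symmetric positive
semidefinite matrix `V`. -/
def IsGaussian {n : ℕ} (ρ : Modes n →L[ℂ] Modes n) : Prop :=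
  ∃ (m : Fin n ⊕ Fin n → ℝ) (V : Matrix (Fin n ⊕ Fin n) (Fin n ⊕ Fin n) ℝ), V.PosSemidef ∧
    ∀ r, charFn ρ r = Complex.exp
      (((-(1 / 4) * ((Omega n *ᵥ r) ⬝ᵥ (V *ᵥ (Omega n *ᵥ r))) : ℝ) : ℂ)
        + Complex.I * ((r ⬝ᵥ (Omega n *ᵥ m) : ℝ) : ℂ))

/-- `U_o ρ^{⊗k} U_o† = ρ^{⊗k}`. -/
def IsRotationInvariant {n k : ℕ} (ρ : Modes n →L[ℂ] Modes n) (o : Matrix.orthogonalGroup (Fin k) ℝ) :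
    Prop :=
  rotation n o ∘L tensorPow k ρ ∘L ContinuousLinearMap.adjoint (rotation n o) = tensorPow k ρ

end Bosonic

end

open Bosonic

/-!
Let `χ` be the characteristic function of `ρ`. The Weyl operators on the `k` copies are products of
displacement operators, the rotation `U_o` permutes them, and a trace class operator on `L²` is
determined by its Weyl transform (`sumRankOne_eq_iff`: the Fourier transform recovers the integral
kernel along every translate of the diagonal). Hence `ρ^{⊗k}` is invariant under `U_o` if and only if
`∏ b, χ(∑ c, o c b • R c) = ∏ j, χ(R j)` for all `R` (`isRotationInvariant_iff`).

Suppose this holds for a nontrivial `o`. A row `a` of `o` with an entry outside `{0, 1, -1}` has all its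
entries of modulus less than one, and taking `R` supported at that row gives the scaling equation
`χ(r) = ∏ b, χ(a_b r)`, where `∑ a_b² = 1`. Finite second moments make `χ` twice differentiable along
every line. Since `∑ a_b² = 1`, the quotient of `χ` by the Gaussian with the same second-order
expansion at `0` solves the same equation and is `1 + o(t²)`; iterating the equation, which shrinks the
arguments, shows that the quotient is `1` (`eq_exp_of_scaling`). So `χ` is the Gaussian with the moments of `ρ`. The
first-order part of the scaling equation of any row `a` of `o` is `μ = μ ∑ a_b`, so the mean vanishes if
some row sum differs from `1`. Conversely the quadratic part of a Gaussian is preserved by every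
orthogonal `o`, and the linear part by the stochastic ones.

For a pure state `ψ` no moments are assumed, but `χ` is continuous. Near `0` the logarithm of `χ` along
a line solves an additive equation in two variables, and integrating one of them shows that it is
twice differentiable (`exists_hasDerivAt_of_rotation_invariant`); so again `χ` is Gaussian along lines.
The inner products of difference quotients of `t ↦ D_{t r} ψ` are second differences of `χ`, so these
quotients converge, `ψ` lies in the domains of the quadratures, and the previous case applies.
In the other direction, invariance of `|ψ⟩⟨ψ|^{⊗k}` gives the invariance of `ψ^{⊗k}` up to a phase. The
stabilizer of a vector in the orthogonal group is generated by reflections (`mem_of_householder_mem`),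
and the relevant reflections are conjugate, within the stabilizer, to the exchange of two copies, which
fixes `ψ^{⊗k}`; so all phases are `1` (`rotation_eq_of_forall_smul`).
-/

noncomputable section

namespace Bosonic

/-! ### Functional equations -/

/-- Second-order Taylor expansion at `0` with the Peano remainder. -/
theorem isLittleO_taylor_two {φ φ' : ℝ → ℂ} {κ : ℂ}
    (h1 : ∀ᶠ t in 𝓝 (0 : ℝ), HasDerivAt φ (φ' t) t) (h2 : HasDerivAt φ' κ 0) :
    (fun t : ℝ => φ t - (φ 0 + φ' 0 * t + κ / 2 * t ^ 2)) =o[𝓝 0] fun t : ℝ => t ^ 2 := by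
  rw [Asymptotics.isLittleO_iff]
  intro ε hε
  have h2' := (hasDerivAt_iff_isLittleO.1 h2)
  have h3 := Asymptotics.isLittleO_iff.1 h2' hε
  obtain ⟨δ, hδ, hball⟩ := Metric.eventually_nhds_iff_ball.1 (h1.and h3)
  refine Metric.eventually_nhds_iff_ball.2 ⟨δ, hδ, fun t ht => ?_⟩
  have hsub : ∀ s ∈ Set.uIcc 0 t, s ∈ Metric.ball (0 : ℝ) δ ∧ |s| ≤ |t| := fun s hs => by
    have h := Set.abs_sub_left_of_mem_uIcc hs
    simp only [sub_zero] at h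
    refine ⟨?_, h⟩
    simp only [Metric.mem_ball, dist_zero_right, Real.norm_eq_abs] at ht ⊢
    exact h.trans_lt ht
  have hd : ∀ s ∈ Set.uIcc 0 t, HasDerivWithinAt
      (fun t : ℝ => φ t - (φ 0 + φ' 0 * t + κ / 2 * t ^ 2)) (φ' s - (φ' 0 + κ * s))
      (Set.uIcc 0 t) s := fun s hs => by
    have hid : HasDerivAt (fun t : ℝ => (t : ℂ)) 1 s := Complex.ofRealCLM.hasDerivAt
    have h4 := (hball s (hsub s hs).1).1.sub
      (((hid.const_mul (φ' 0)).const_add (φ 0)).add ((hid.pow 2).const_mul (κ / 2)))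
    refine HasDerivAt.hasDerivWithinAt ?_
    convert! h4 using 1
    push_cast; ring
  have hb : ∀ s ∈ Set.uIcc 0 t, ‖φ' s - (φ' 0 + κ * s)‖ ≤ ε * |t| := fun s hs => by
    have h5 := (hball s (hsub s hs).1).2
    simp only [sub_zero, Complex.real_smul, Real.norm_eq_abs] at h5
    calc ‖φ' s - (φ' 0 + κ * s)‖ = ‖φ' s - φ' 0 - s * κ‖ := by congr 1; ring
      _ ≤ ε * |s| := h5
      _ ≤ ε * |t| := mul_le_mul_of_nonneg_left (hsub s hs).2 hε.le
  have h6 := (convex_uIcc (0 : ℝ) t).norm_image_sub_le_of_norm_hasDerivWithin_le hd hb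
    Set.left_mem_uIcc Set.right_mem_uIcc
  simp only [Complex.ofReal_zero, mul_zero, add_zero, ne_eq, OfNat.ofNat_ne_zero,
    not_false_eq_true, zero_pow, sub_self, sub_zero, Real.norm_eq_abs] at h6
  simpa [sq, mul_assoc] using h6

theorem norm_prod_sub_one_le {ι : Type*} (s : Finset ι) (z : ι → ℂ) (c : ι → ℝ)
    (h : ∀ i ∈ s, ‖z i - 1‖ ≤ Real.exp (c i) - 1) :
    ‖∏ i ∈ s, z i - 1‖ ≤ Real.exp (∑ i ∈ s, c i) - 1 := by
  classical
  induction s using Finset.induction_on with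
  | empty => simp
  | insert a s ha ih =>
    rw [Finset.prod_insert ha, Finset.sum_insert ha, Real.exp_add]
    have h1 := h a (Finset.mem_insert_self a s)
    have h2 := ih fun i hi => h i (Finset.mem_insert_of_mem hi)
    set P := ∏ i ∈ s, z i
    have h3 : ‖z a‖ ≤ Real.exp (c a) := by
      calc ‖z a‖ = ‖(z a - 1) + 1‖ := by ring_nf
        _ ≤ ‖z a - 1‖ + 1 := by simpa using norm_add_le (z a - 1) 1
        _ ≤ _ := by linarith
    calc ‖z a * P - 1‖ = ‖z a * (P - 1) + (z a - 1)‖ := by ring_nf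
      _ ≤ ‖z a‖ * ‖P - 1‖ + ‖z a - 1‖ := by
        rw [← norm_mul]; exact norm_add_le _ _
      _ ≤ Real.exp (c a) * (Real.exp (∑ i ∈ s, c i) - 1) + (Real.exp (c a) - 1) := by
        gcongr
      _ = _ := by ring

/-- A function which solves `φ(t) = ∏ φ(a_b t)`, where `∑ a_b² = 1` and `|a_b| < 1`, and which agrees
with `1` to second order at `0` is identically `1`: the bound `|φ(t) - 1| ≤ exp (ε t²) - 1` spreads
from a neighbourhood of `0` to larger and larger ones. -/
theorem eq_one_of_scaling {ι : Type*} [Fintype ι] {a : ι → ℝ} (ha : ∑ b, a b ^ 2 = 1)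
    (ha1 : ∀ b, |a b| < 1) {φ : ℝ → ℂ} (hφ : ∀ t, φ t = ∏ b, φ (a b * t))
    (ho : (fun t : ℝ => φ t - 1) =o[𝓝 0] fun t : ℝ => t ^ 2) (t : ℝ) : φ t = 1 := by
  have hne : Nonempty ι := by
    by_contra h
    rw [not_nonempty_iff] at h
    simp at ha
  obtain ⟨q, hq0, hq1, hq⟩ : ∃ q : ℝ, 0 < q ∧ q < 1 ∧ ∀ b, |a b| ≤ q := by
    obtain ⟨b0, hb0⟩ := Finite.exists_max fun b => |a b|
    refine ⟨max |a b0| (1 / 2), by positivity, max_lt (ha1 b0) (by norm_num),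
      fun b => (hb0 b).trans (le_max_left _ _)⟩
  have key : ∀ ε : ℝ, 0 < ε → ‖φ t - 1‖ ≤ Real.exp (ε * t ^ 2) - 1 := by
    intro ε hε
    obtain ⟨δ, hδ, hball⟩ := Metric.eventually_nhds_iff_ball.1 (Asymptotics.isLittleO_iff.1 ho hε)
    have hstep : ∀ N : ℕ, ∀ s : ℝ, q ^ N * |s| < δ → ‖φ s - 1‖ ≤ Real.exp (ε * s ^ 2) - 1 := by
      intro N
      induction N with
      | zero =>
        intro s hs
        have h := hball s (by simpa using hs)
        have h' := Real.add_one_le_exp (ε * s ^ 2)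
        simp only [norm_pow, Real.norm_eq_abs, sq_abs] at h
        linarith
      | succ N ih =>
        intro s hs
        have h := norm_prod_sub_one_le Finset.univ (fun b => φ (a b * s))
          (fun b => ε * (a b * s) ^ 2) fun b _ => ih _ (by
            refine lt_of_le_of_lt ?_ hs
            rw [abs_mul, pow_succ, mul_assoc]
            gcongr
            exact hq b)
        have e : ∑ b, ε * (a b * s) ^ 2 = ε * s ^ 2 := by
          calc ∑ b, ε * (a b * s) ^ 2 = ∑ b, a b ^ 2 * (ε * s ^ 2) := by
                refine Finset.sum_congr rfl fun b _ => by ring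
            _ = _ := by rw [← Finset.sum_mul, ha, one_mul]
        rwa [← hφ s, e] at h
    obtain ⟨N, hN⟩ := ((tendsto_pow_atTop_nhds_zero_of_lt_one hq0.le hq1).mul_const |t|
      |>.eventually_lt_const (by simpa using hδ)).exists
    exact hstep N t hN
  have hlim : Tendsto (fun ε : ℝ => Real.exp (ε * t ^ 2) - 1) (𝓝[>] 0) (𝓝 0) := by
    have : ContinuousAt (fun ε : ℝ => Real.exp (ε * t ^ 2) - 1) 0 := by fun_prop
    have h := this.tendsto
    simp only [zero_mul, Real.exp_zero, sub_self] at h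
    exact h.mono_left nhdsWithin_le_nhds
  have h0 : ‖φ t - 1‖ ≤ 0 := ge_of_tendsto hlim (by
    filter_upwards [self_mem_nhdsWithin] with ε hε using key ε hε)
  exact sub_eq_zero.1 (norm_le_zero_iff.1 h0)

/-- The functional equation `φ(t) = ∏ φ(a_b t)`, differentiated at `0`. -/
theorem deriv_eq_of_scaling {ι : Type*} [Fintype ι] {a : ι → ℝ} {φ : ℝ → ℂ} {μ : ℂ}
    (h0 : φ 0 = 1) (hφ : ∀ t, φ t = ∏ b, φ (a b * t)) (hd0 : HasDerivAt φ μ 0) :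
    μ = ∑ b, μ * a b := by
  classical
  have h3 : HasDerivAt (fun t => ∏ b, φ (a b * t)) (∑ b, μ * a b) 0 := by
    have h4 := HasDerivAt.fun_finsetProd (u := Finset.univ) (f := fun b t => φ (a b * t))
      (f' := fun b => μ * a b) (x := (0 : ℝ)) fun b _ => by
        have h5 : HasDerivAt (fun t : ℝ => a b * t) (a b) 0 := by
          simpa using (hasDerivAt_id (0 : ℝ)).const_mul (a b)
        have h6 : HasDerivAt φ μ (a b * 0) := by simpa using hd0
        have h7 := h6.scomp (0 : ℝ) h5
        simpa [Function.comp_def, mul_comm] using h7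
    simpa [h0] using h4
  exact hd0.unique (h3.congr_of_eventuallyEq (Eventually.of_forall hφ))

/-- A solution of `φ(t) = ∏ φ(a_b t)`, where `∑ a_b² = 1` and `|a_b| < 1`, which is twice
differentiable at `0` is the exponential of a quadratic polynomial. -/
theorem eq_exp_of_scaling {ι : Type*} [Fintype ι] {a : ι → ℝ} (ha : ∑ b, a b ^ 2 = 1)
    (ha1 : ∀ b, |a b| < 1) {φ φ' : ℝ → ℂ} {κ : ℂ} (h0 : φ 0 = 1)
    (hφ : ∀ t, φ t = ∏ b, φ (a b * t))
    (h1 : ∀ᶠ t in 𝓝 (0 : ℝ), HasDerivAt φ (φ' t) t) (h2 : HasDerivAt φ' κ 0) (t : ℝ) :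
    φ t = Complex.exp (φ' 0 * t + (κ - φ' 0 ^ 2) / 2 * t ^ 2) := by
  set μ := φ' 0 with hμ
  have hd0 : HasDerivAt φ μ 0 := h1.self_of_nhds
  have hmean : μ = ∑ b, μ * a b := deriv_eq_of_scaling h0 hφ hd0
  -- `φ g` solves the same equation and is `1 + o(t²)`
  set ν := (κ - μ ^ 2) / 2 with hν
  set g : ℝ → ℂ := fun t => Complex.exp (-(μ * t + ν * t ^ 2)) with hg
  have hgd : ∀ t : ℝ, HasDerivAt g (g t * -(μ + 2 * ν * t)) t := fun t => by
    have hid : HasDerivAt (fun t : ℝ => (t : ℂ)) 1 t := Complex.ofRealCLM.hasDerivAt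
    have h := ((hid.const_mul μ).add ((hid.pow 2).const_mul ν)).neg.cexp
    convert! h using 1
    simp only [hg]
    push_cast
    simp
    ring_nf
  have hprod : ∀ t, φ t * g t = ∏ b, φ (a b * t) * g (a b * t) := fun t => by
    rw [Finset.prod_mul_distrib, ← hφ, hg]
    simp only [← Complex.exp_sum]
    congr 2
    rw [Finset.sum_neg_distrib, Finset.sum_add_distrib]
    congr 2
    · conv_lhs => rw [hmean]
      rw [Finset.sum_mul]
      exact Finset.sum_congr rfl fun b _ => by push_cast; ring
    · have h : (1 : ℂ) = ∑ b, (a b : ℂ) ^ 2 := by rw [← Complex.ofReal_one, ← ha]; push_cast; rfl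
      calc ν * (t : ℂ) ^ 2 = (∑ b, (a b : ℂ) ^ 2) * (ν * (t : ℂ) ^ 2) := by rw [← h, one_mul]
        _ = _ := by
          rw [Finset.sum_mul]
          exact Finset.sum_congr rfl fun b _ => by push_cast; ring
  have hL := isLittleO_taylor_two (φ := fun t => φ t * g t)
    (φ' := fun t => φ' t * g t + φ t * (g t * -(μ + 2 * ν * t))) (κ := 0)
    (h1.mono fun t ht => ht.mul (hgd t)) (by
      have hid : HasDerivAt (fun t : ℝ => (t : ℂ)) 1 0 := Complex.ofRealCLM.hasDerivAt
      have h3 := (h2.mul (hgd 0)).add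
        (hd0.mul ((hgd 0).mul ((hid.const_mul (2 * ν)).const_add μ).neg))
      convert! h3 using 1
      simp [hg, h0, ← hμ, hν]
      ring)
  have hg0 : g 0 = 1 := by simp [hg]
  have hone := eq_one_of_scaling ha ha1 (φ := fun t => φ t * g t) hprod (by
    simpa [h0, hg0, ← hμ] using hL) t
  rw [hg] at hone
  simp only [Complex.exp_neg] at hone
  exact eq_of_mul_inv_eq_one hone

/-- A continuous solution of `F(s) + C(u) = ∑ F(a_b s + y_b u)` near `0`, where `a_b = 0` whenever
`y_b = 0`, is twice differentiable at `0`: integrating in `u` expresses `F` through its own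
primitive, so that `F` has one more derivative than it is known to have. -/
theorem exists_hasDerivAt_of_additive {ι : Type*} [Fintype ι] {a y : ι → ℝ}
    (hay : ∀ b, y b = 0 → a b = 0) {F C : ℝ → ℂ} (hF : Continuous F) (hF0 : F 0 = 0) {δ : ℝ}
    (hδ : 0 < δ)
    (h : ∀ s u, |s| < δ → |u| < δ → F s + C u = ∑ b, F (a b * s + u * y b)) :
    ∃ (F' : ℝ → ℂ) (κ : ℂ), (∀ᶠ t in 𝓝 (0 : ℝ), HasDerivAt F (F' t) t) ∧ HasDerivAt F' κ 0 := by
  set P : ℝ → ℂ := fun x => ∫ t in (0 : ℝ)..x, F t with hP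
  have hPd : ∀ x, HasDerivAt P (F x) x := fun x => hF.integral_hasStrictDerivAt 0 x |>.hasDerivAt
  obtain ⟨η, hη0, hηδ, hη⟩ : ∃ η : ℝ, 0 < η ∧ η < δ ∧ ∀ b, |η * y b| < δ := by
    have h1 : ∀ᶠ η in 𝓝[>] (0 : ℝ), η < δ := nhdsWithin_le_nhds (gt_mem_nhds hδ)
    have h2 : ∀ᶠ η in 𝓝[>] (0 : ℝ), ∀ b, |η * y b| < δ := by
      refine eventually_all.2 fun b => nhdsWithin_le_nhds ?_
      have hc : ContinuousAt (fun η : ℝ => |η * y b|) 0 := by fun_prop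
      exact hc.tendsto.eventually_lt_const (by simpa using hδ)
    obtain ⟨η, h3, h4, h5⟩ := (h1.and (h2.and self_mem_nhdsWithin)).exists
    exact ⟨η, h5, h3, h4⟩
  have hint : ∀ s b, ∫ u in (0 : ℝ)..η, F (a b * s + u * y b)
      = (P (a b * s + η * y b) - P (a b * s)) / y b := fun s b => by
    rcases eq_or_ne (y b) 0 with hy | hy
    · simp [hy, hay b hy, hF0]
    · have hd : ∀ u ∈ Set.uIcc 0 η, HasDerivAt (fun u : ℝ => P (a b * s + u * y b) / y b)
          (F (a b * s + u * y b)) u := fun u _ => by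
        have h1 : HasDerivAt (fun u : ℝ => a b * s + u * y b) (y b) u := by
          simpa using ((hasDerivAt_id u).mul_const (y b)).const_add (a b * s)
        have h2 := ((hPd (a b * s + u * y b)).scomp u h1).div_const (y b : ℂ)
        have hy' : (y b : ℂ) ≠ 0 := by exact_mod_cast hy
        convert! h2 using 1
        rw [Complex.real_smul, mul_div_cancel_left₀ _ hy']
      rw [intervalIntegral.integral_eq_sub_of_hasDerivAt hd
        (Continuous.intervalIntegrable (by fun_prop) _ _)]
      simp [sub_div]
  set K : ℂ := ∫ u in (0 : ℝ)..η, C u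
  -- integrating the functional equation in `u` over `[0, η]`
  have hFeq : ∀ s, |s| < δ →
      F s = (η : ℂ)⁻¹ * (∑ b, (P (a b * s + η * y b) - P (a b * s)) / y b - K) := fun s hs => by
    have hη' : (η : ℂ) ≠ 0 := by exact_mod_cast hη0.ne'
    have hu : ∀ u ∈ Set.uIcc 0 η, |u| < δ := fun u hu => by
      rw [Set.uIcc_of_le hη0.le] at hu
      rw [abs_of_nonneg hu.1]
      exact hu.2.trans_lt hηδ
    have hCc : IntervalIntegrable C volume 0 η := by
      have h1 : IntervalIntegrable (fun u : ℝ => ∑ b, F (a b * 0 + u * y b) - F 0) volume 0 η :=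
        Continuous.intervalIntegrable (by fun_prop) _ _
      refine h1.congr fun u hu' => ?_
      have := h 0 u (by simpa using hδ) (hu u (Set.uIoc_subset_uIcc hu'))
      simp only [← this]
      ring
    have h1 : ∫ u in (0 : ℝ)..η, (F s + C u) = ∫ u in (0 : ℝ)..η, ∑ b, F (a b * s + u * y b) :=
      intervalIntegral.integral_congr fun u hu' => h s u hs (hu u hu')
    rw [intervalIntegral.integral_add (by simp) hCc,
      intervalIntegral.integral_finsetSum fun b _ =>
        Continuous.intervalIntegrable (by fun_prop) _ _] at h1
    simp only [intervalIntegral.integral_const, sub_zero, Complex.real_smul, hint] at h1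
    rw [← h1]
    field_simp
    ring
  -- the right-hand side of `hFeq` is differentiable, and its derivative involves `F` only
  have hFd : ∀ s, |s| < δ → HasDerivAt F ((η : ℂ)⁻¹ *
      ∑ b, (a b * F (a b * s + η * y b) - a b * F (a b * s)) / y b) s := fun s hs => by
    have hev : F =ᶠ[𝓝 s] fun s => (η : ℂ)⁻¹ *
        (∑ b, (P (a b * s + η * y b) - P (a b * s)) / y b - K) := by
      filter_upwards [(isOpen_lt continuous_abs continuous_const).mem_nhds hs] with x hx
        using hFeq x hx
    refine HasDerivAt.congr_of_eventuallyEq ?_ hev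
    refine ((HasDerivAt.fun_sum fun b _ => ?_).sub_const K).const_mul _
    have h1 : HasDerivAt (fun s : ℝ => a b * s) (a b) s := by
      simpa using (hasDerivAt_id s).const_mul (a b)
    have h2 := ((hPd (a b * s + η * y b)).scomp s (h1.add_const (η * y b)))
    have h3 := (hPd (a b * s)).scomp s h1
    simpa [Complex.real_smul] using (h2.sub h3).div_const (y b : ℂ)
  refine ⟨fun s => (η : ℂ)⁻¹ * ∑ b, (a b * F (a b * s + η * y b) - a b * F (a b * s)) / y b,
    (η : ℂ)⁻¹ * ∑ b, (a b * (a b * deriv F (a b * 0 + η * y b))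
    - a b * (a b * deriv F (a b * 0))) / y b, ?_, ?_⟩
  · filter_upwards [(isOpen_lt continuous_abs continuous_const).mem_nhds
      (show |(0 : ℝ)| < δ by simpa using hδ)] with x hx using hFd x hx
  · refine (HasDerivAt.fun_sum fun b _ => ?_).const_mul _
    have h1 : HasDerivAt (fun s : ℝ => a b * s) (a b) 0 := by
      simpa using (hasDerivAt_id (0 : ℝ)).const_mul (a b)
    have hdF : ∀ x, |x| < δ → HasDerivAt F (deriv F x) x := fun x hx =>
      (hFd x hx).differentiableAt.hasDerivAt
    have h2 := ((hdF (a b * 0 + η * y b) (by simpa using hη b)).scomp (0 : ℝ)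
      (h1.add_const (η * y b))).const_mul (a b : ℂ)
    have h3 := ((hdF (a b * 0) (by simpa using hδ)).scomp (0 : ℝ) h1).const_mul (a b : ℂ)
    simpa [Complex.real_smul] using (h2.sub h3).div_const (y b : ℂ)

/-- A unit vector whose entries have modulus less than one is orthogonal to a vector with the same
support. -/
theorem exists_orthogonal_same_support {ι : Type*} [Fintype ι] {a : ι → ℝ}
    (ha : ∑ b, a b ^ 2 = 1) (ha1 : ∀ b, |a b| < 1) :
    ∃ y : ι → ℝ, (∀ b, y b = 0 → a b = 0) ∧ ∑ b, y b * a b = 0 := by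
  classical
  obtain ⟨b0, hb0⟩ : ∃ b, a b ≠ 0 := by
    by_contra! h
    simp [h] at ha
  have hlt : a b0 ^ 2 < 1 := by
    rw [sq_lt_one_iff_abs_lt_one]
    exact ha1 b0
  have hpos : 0 < a b0 ^ 2 := by positivity
  refine ⟨fun b => if b = b0 then a b0 ^ 2 - 1 else a b0 * a b, fun b hb => ?_, ?_⟩
  · by_cases h : b = b0
    · simp only [h, if_true] at hb
      linarith
    · simp only [h, if_false] at hb
      exact (mul_eq_zero.1 hb).resolve_left hb0
  · have h1 : ∀ b, (if b = b0 then a b0 ^ 2 - 1 else a b0 * a b) * a b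
        = a b0 * a b ^ 2 - if b = b0 then a b0 else 0 := fun b => by
      split_ifs with h
      · rw [h]; ring
      · ring
    simp only [h1, Finset.sum_sub_distrib, ← Finset.mul_sum, ha]
    simp

/-- A continuous `φ` with `φ(0) = 1` whose `k`-fold tensor power is invariant under an orthogonal
matrix with a row without entries `±1` is twice differentiable at `0`. -/
theorem exists_hasDerivAt_of_rotation_invariant {k : ℕ} {o : Matrix (Fin k) (Fin k) ℝ}
    (ho : o * oᵀ = 1) {c : Fin k} (hc : ∀ b, |o c b| < 1) {φ : ℝ → ℂ} (hφ : Continuous φ)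
    (h0 : φ 0 = 1) (h : ∀ t : Fin k → ℝ, ∏ j, φ (t j) = ∏ b, φ (∑ j, o j b * t j)) :
    ∃ (φ' : ℝ → ℂ) (κ : ℂ), (∀ᶠ t in 𝓝 (0 : ℝ), HasDerivAt φ (φ' t) t) ∧ HasDerivAt φ' κ 0 := by
  have hrow : ∀ i j, ∑ b, o i b * o j b = (1 : Matrix (Fin k) (Fin k) ℝ) i j := fun i j => by
    rw [← ho, Matrix.mul_apply]
    rfl
  have hcol : ∀ b d, ∑ j, o j b * o j d = (1 : Matrix (Fin k) (Fin k) ℝ) b d := fun b d => by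
    rw [← mul_eq_one_comm.1 ho, Matrix.mul_apply]
    rfl
  obtain ⟨y, hy, hya⟩ := exists_orthogonal_same_support (a := o c)
    (by simpa [sq] using hrow c c) hc
  -- the direction `v = y oᵀ` satisfies `v_c = 0` and `v o = y`
  set v : Fin k → ℝ := fun j => ∑ b, y b * o j b with hv
  have hvc : v c = 0 := hya
  have hvo : ∀ b, ∑ j, o j b * v j = y b := fun b => by
    simp only [hv, Finset.mul_sum]
    rw [Finset.sum_comm]
    have : ∀ d, ∑ j, o j b * (y d * o j d) = y d * (1 : Matrix (Fin k) (Fin k) ℝ) b d := fun d => by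
      rw [← hcol, Finset.mul_sum]
      exact Finset.sum_congr rfl fun j _ => by ring
    simp [this, Matrix.one_apply]
  -- a continuous logarithm of `φ` near `0`
  have hlog : ContinuousAt (fun t => Complex.log (φ t)) 0 :=
    (hφ.continuousAt).clog (by simp [h0])
  have hsmall : ∀ᶠ t in 𝓝 (0 : ℝ), φ t ∈ Complex.slitPlane ∧
      ‖Complex.log (φ t)‖ < 1 / (k + 1) := by
    refine Filter.Eventually.and ?_ ?_
    · exact hφ.continuousAt.eventually_mem (Complex.isOpen_slitPlane.mem_nhds (by simp [h0]))
    · exact hlog.norm.tendsto.eventually_lt_const (by simp [h0]; positivity)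
  obtain ⟨r, hr, hball⟩ := Metric.eventually_nhds_iff_ball.1 hsmall
  -- clamping the argument to `[-r/2, r/2]` makes the logarithm continuous everywhere
  set cl : ℝ → ℝ := fun t => max (-(r / 2)) (min (r / 2) t) with hcl
  have hclc : Continuous cl := by fun_prop
  have hclmem : ∀ t, cl t ∈ Metric.ball (0 : ℝ) r := fun t => by
    have h1 : -(r / 2) ≤ cl t := le_max_left _ _
    have h2 : cl t ≤ r / 2 := max_le (by linarith) (min_le_left _ _)
    rw [mem_ball_zero_iff, Real.norm_eq_abs]
    exact (abs_le.2 ⟨h1, h2⟩).trans_lt (by linarith)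
  have hcleq : ∀ t, |t| ≤ r / 2 → cl t = t := fun t ht => by
    rw [abs_le] at ht
    simp only [hcl]
    rw [min_eq_right ht.2, max_eq_right ht.1]
  set F : ℝ → ℂ := fun t => Complex.log (φ (cl t)) with hF
  have hFc : Continuous F := (hφ.comp hclc).clog fun t => (hball _ (hclmem t)).1
  have hFexp : ∀ t, |t| ≤ r / 2 → Complex.exp (F t) = φ t := fun t ht => by
    simp only [hF, hcleq t ht]
    exact Complex.exp_log (Complex.slitPlane_ne_zero (hball t (by
      rw [mem_ball_zero_iff, Real.norm_eq_abs]; linarith)).1)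
  have hF0 : F 0 = 0 := by simp [hF, hcleq 0 (by simp; positivity), h0]
  have hFn : ∀ t, ‖F t‖ < 1 / (k + 1) := fun t => (hball _ (hclmem t)).2
  obtain ⟨δ, hδ, hδr⟩ : ∃ δ > 0, ∀ s u : ℝ, |s| < δ → |u| < δ → |s| ≤ r / 2 ∧
      (∀ j, |u * v j| ≤ r / 2) ∧ ∀ b, |o c b * s + u * y b| ≤ r / 2 := by
    have hev : ∀ᶠ p : ℝ × ℝ in 𝓝 0, |p.1| < r / 2 ∧ (∀ j, |p.2 * v j| < r / 2) ∧
        ∀ b, |o c b * p.1 + p.2 * y b| < r / 2 := by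
      have aux : ∀ f : ℝ × ℝ → ℝ, Continuous f → f 0 = 0 → ∀ᶠ p in 𝓝 0, |f p| < r / 2 :=
        fun f hf hf0 => hf.abs.continuousAt.tendsto.eventually_lt_const (by simp [hf0]; positivity)
      refine (aux _ (by fun_prop) (by simp)).and ((eventually_all.2 fun j => ?_).and
        (eventually_all.2 fun b => ?_))
      · exact aux (fun p => p.2 * v j) (by fun_prop) (by simp)
      · exact aux (fun p => o c b * p.1 + p.2 * y b) (by fun_prop) (by simp)
    obtain ⟨δ, hδ, hb⟩ := Metric.eventually_nhds_iff_ball.1 hev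
    refine ⟨δ, hδ, fun s u hs hu => ?_⟩
    have := hb (s, u) (by
      rw [mem_ball_zero_iff, Prod.norm_def]
      exact max_lt hs hu)
    exact ⟨this.1.le, fun j => (this.2.1 j).le, fun b => (this.2.2 b).le⟩
  have hadd : ∀ s u, |s| < δ → |u| < δ →
      F s + ∑ j ∈ Finset.univ.erase c, F (u * v j) = ∑ b, F (o c b * s + u * y b) := by
    intro s u hs hu
    obtain ⟨h1, h2, h3⟩ := hδr s u hs hu
    have hk : (0 : ℝ) < k + 1 := by positivity
    -- evaluate the invariance at `s e_c + u v`
    set T : Fin k → ℝ := fun j => s * Pi.single (M := fun _ => ℝ) c 1 j + u * v j with hT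
    have hTc : T c = s := by simp [hT, hvc]
    have hTj : ∀ j ∈ Finset.univ.erase c, T j = u * v j := fun j hj => by
      simp [hT, Finset.ne_of_mem_erase hj]
    have hTb : ∀ j, |T j| ≤ r / 2 := fun j => by
      by_cases hj : j = c
      · rw [hj, hTc]; exact h1
      · rw [hTj j (Finset.mem_erase.2 ⟨hj, Finset.mem_univ j⟩)]; exact h2 j
    have hTo : ∀ b, ∑ j, o j b * T j = o c b * s + u * y b := fun b => by
      simp only [hT, mul_add, Finset.sum_add_distrib]
      congr 1
      · rw [Finset.sum_eq_single c] <;> simp +contextual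
      · rw [← hvo b, Finset.mul_sum]
        exact Finset.sum_congr rfl fun j _ => by ring
    have hsum : F s + ∑ j ∈ Finset.univ.erase c, F (u * v j) = ∑ j, F (T j) := by
      rw [← Finset.add_sum_erase _ _ (Finset.mem_univ c), hTc]
      congr 1
      exact Finset.sum_congr rfl fun j hj => by rw [hTj j hj]
    rw [hsum]
    have hexp : Complex.exp (∑ j, F (T j)) = Complex.exp (∑ b, F (o c b * s + u * y b)) := by
      rw [Complex.exp_sum, Complex.exp_sum, Finset.prod_congr rfl fun j _ => hFexp _ (hTb j),
        Finset.prod_congr rfl fun b _ => hFexp _ (h3 b), h T]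
      simp only [hTo]
    -- the two sums differ by a multiple of `2πi`, and both are at most `1` in modulus
    obtain ⟨N, hN⟩ := Complex.exp_eq_exp_iff_exists_int.1 hexp
    have hnorm : ∀ G : Fin k → ℝ, ‖∑ j, F (G j)‖ ≤ 1 := fun G => by
      calc ‖∑ j, F (G j)‖ ≤ ∑ j : Fin k, (1 / (k + 1) : ℝ) :=
            norm_sum_le_of_le _ fun j _ => (hFn _).le
        _ ≤ 1 := by
          simp only [Finset.sum_const, Finset.card_univ, Fintype.card_fin, nsmul_eq_mul]
          rw [mul_one_div, div_le_one hk]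
          linarith
    have hN' : ‖(N : ℂ) * (2 * Real.pi * Complex.I)‖ ≤ 2 := by
      calc ‖(N : ℂ) * (2 * Real.pi * Complex.I)‖
          = ‖∑ j, F (T j) - ∑ b, F (o c b * s + u * y b)‖ := by rw [hN, add_sub_cancel_left]
        _ ≤ 1 + 1 := (norm_sub_le _ _).trans (add_le_add (hnorm _) (hnorm _))
        _ = 2 := by norm_num
    have hN0 : N = 0 := by
      by_contra hne
      have h4 : (1 : ℝ) ≤ |(N : ℝ)| := by exact_mod_cast Int.one_le_abs hne
      simp only [norm_mul, Complex.norm_intCast, Complex.norm_ofNat, Complex.norm_real,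
        Real.norm_eq_abs, Complex.norm_I, mul_one, abs_of_pos Real.pi_pos] at hN'
      nlinarith [Real.pi_gt_three]
    rw [hN, hN0]
    simp
  obtain ⟨F', κ, hF1, hF2⟩ := exists_hasDerivAt_of_additive
    (C := fun u => ∑ j ∈ Finset.univ.erase c, F (u * v j)) hy hFc hF0 hδ hadd
  refine ⟨fun t => Complex.exp (F t) * F' t, _, ?_, hF1.self_of_nhds.cexp.mul hF2⟩
  have hnear : ∀ᶠ t in 𝓝 (0 : ℝ), |t| < r / 2 :=
    continuous_abs.continuousAt.tendsto.eventually_lt_const (by simp; positivity)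
  filter_upwards [hF1, hnear] with t ht ht'
  refine ht.cexp.congr_of_eventuallyEq ?_
  filter_upwards [(isOpen_lt continuous_abs continuous_const).mem_nhds ht'] with x hx
    using (hFexp x (le_of_lt hx)).symm

/-! ### Displacement operators as one-parameter groups -/

theorem norm_sq_eq_integral {α : Type*} [MeasurableSpace α] {μ : Measure α} (f : Lp ℂ 2 μ) :
    ‖f‖ ^ 2 = ∫ x, ‖f x‖ ^ 2 ∂μ := by
  rw [← inner_self_eq_norm_sq (𝕜 := ℂ), L2.inner_def]
  simp only [inner_self_eq_norm_sq_to_K]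
  have h : ∀ x, ((‖f x‖ : ℂ) ^ 2) = ((‖f x‖ ^ 2 : ℝ) : ℂ) := fun x => by push_cast; rfl
  simp only [Complex.coe_algebraMap, h]
  exact (congrArg RCLike.re (integral_ofReal (𝕜 := ℂ))).trans (RCLike.ofReal_re _)

/-- Dominated convergence in `L²`. -/
theorem tendsto_Lp_two_of_dominated {α ι : Type*} [MeasurableSpace α] {μ : Measure α}
    {l : Filter ι} [l.IsCountablyGenerated] {f : ι → Lp ℂ 2 μ} {g : Lp ℂ 2 μ} {F : ι → α → ℂ}
    {bound : α → ℝ} (hF : ∀ᶠ i in l, (f i - g : Lp ℂ 2 μ) =ᵐ[μ] F i) (hbm : MemLp bound 2 μ)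
    (hb : ∀ᶠ i in l, ∀ x, ‖F i x‖ ≤ bound x) (hl : ∀ x, Tendsto (fun i => F i x) l (𝓝 0)) :
    Tendsto f l (𝓝 g) := by
  rw [tendsto_iff_norm_sub_tendsto_zero]
  have h1 : Tendsto (fun i => ∫ x, ‖(f i - g : Lp ℂ 2 μ) x‖ ^ 2 ∂μ) l (𝓝 0) := by
    have h2 : Tendsto (fun i => ∫ x, ‖F i x‖ ^ 2 ∂μ) l (𝓝 (∫ _, (0 : ℝ) ∂μ)) := by
      refine tendsto_integral_filter_of_dominated_convergence (fun x => bound x ^ 2) ?_ ?_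
        ((memLp_two_iff_integrable_sq hbm.aestronglyMeasurable).1 hbm) ?_
      · filter_upwards [hF] with i hi
        exact (((Lp.aestronglyMeasurable _).congr hi).norm.pow 2)
      · filter_upwards [hb] with i hi
        refine Eventually.of_forall fun x => ?_
        rw [norm_pow, norm_norm]
        exact pow_le_pow_left₀ (norm_nonneg _) (hi x) 2
      · refine Eventually.of_forall fun x => ?_
        simpa using (hl x).norm.pow 2
    rw [integral_zero] at h2
    refine h2.congr' ?_
    filter_upwards [hF] with i hi
    refine integral_congr_ae ?_
    filter_upwards [hi] with x hx
    rw [hx]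
  simp only [← norm_sq_eq_integral] at h1
  simpa using h1.sqrt

theorem coeFn_translate {n : ℕ} (h : Fin n → ℝ) (ψ : Modes n) :
    translate h ψ =ᵐ[volume] fun x => ψ (x + h) :=
  Lp.coeFn_compMeasurePreserving ψ (measurePreserving_add_right volume h)

theorem coeFn_phase {n : ℕ} {θ : (Fin n → ℝ) → ℝ} (hθ : Continuous θ) (ψ : Modes n) :
    phase θ hθ ψ =ᵐ[volume] fun x => Complex.exp (Complex.I * θ x) * ψ x :=
  (memLp_phase hθ ψ).coeFn_toLp

theorem coeFn_displacement {n : ℕ} (r : Fin n ⊕ Fin n → ℝ) (ψ : Modes n) :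
    displacement r ψ =ᵐ[volume] fun x =>
      Complex.exp (Complex.I *
        ((-((r ∘ Sum.inr) ⬝ᵥ (x + (1 / 2 : ℝ) • (r ∘ Sum.inl))) : ℝ) : ℂ))
          * ψ (x + r ∘ Sum.inl) := by
  refine (coeFn_phase (by unfold dotProduct; fun_prop) _).trans ?_
  filter_upwards [coeFn_translate (r ∘ Sum.inl) ψ] with x hx
  exact congrArg _ hx

theorem norm_displacement {n : ℕ} (r : Fin n ⊕ Fin n → ℝ) (ψ : Modes n) :
    ‖displacement r ψ‖ = ‖ψ‖ :=
  LinearIsometry.norm_map _ ψ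

theorem displacement_add_smul {n : ℕ} (r : Fin n ⊕ Fin n → ℝ) (s t : ℝ) (ψ : Modes n) :
    displacement ((s + t) • r) ψ = displacement (s • r) (displacement (t • r) ψ) := by
  refine Lp.ext ?_
  have h := (measurePreserving_add_right (volume : Measure (Fin n → ℝ))
    ((s • r) ∘ Sum.inl)).quasiMeasurePreserving.ae (coeFn_displacement (t • r) ψ)
  filter_upwards [coeFn_displacement ((s + t) • r) ψ,
    coeFn_displacement (s • r) (displacement (t • r) ψ), h] with x h1 h2 h3
  rw [h1, h2, h3, ← mul_assoc, ← Complex.exp_add]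
  congr 2
  · rw [← mul_add, ← Complex.ofReal_add]
    congr 2
    have e : ∀ c : ℝ, (c • r) ∘ Sum.inr = c • (r ∘ Sum.inr) := fun c => rfl
    have e' : ∀ c : ℝ, (c • r) ∘ Sum.inl = c • (r ∘ Sum.inl) := fun c => rfl
    simp only [e, e', smul_dotProduct, dotProduct_add, dotProduct_smul, smul_eq_mul]
    ring
  · rw [add_assoc]
    congr 1
    ext a
    simp [add_mul]

theorem displacement_zero {n : ℕ} (ψ : Modes n) :
    displacement (0 : Fin n ⊕ Fin n → ℝ) ψ = ψ := by
  refine Lp.ext ?_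
  filter_upwards [coeFn_displacement (0 : Fin n ⊕ Fin n → ℝ) ψ] with x hx
  rw [hx]
  have e : ((0 : Fin n ⊕ Fin n → ℝ) ∘ Sum.inl) = 0 := rfl
  have e' : ((0 : Fin n ⊕ Fin n → ℝ) ∘ Sum.inr) = 0 := rfl
  simp [e, e']

theorem inner_displacement_displacement {n : ℕ} (r : Fin n ⊕ Fin n → ℝ) (φ ψ : Modes n) :
    ⟪displacement r φ, displacement r ψ⟫_ℂ = ⟪φ, ψ⟫_ℂ :=
  LinearIsometry.inner_map_map _ φ ψ

/-- The adjoint of `D_{t r}` is `D_{-t r}`. -/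
theorem inner_displacement_smul {n : ℕ} (r : Fin n ⊕ Fin n → ℝ) (t : ℝ) (φ ψ : Modes n) :
    ⟪displacement (t • r) φ, ψ⟫_ℂ = ⟪φ, displacement ((-t) • r) ψ⟫_ℂ := by
  rw [← inner_displacement_displacement (t • r) φ, ← displacement_add_smul]
  simp [displacement_zero]

theorem continuous_translate {n : ℕ} (ψ : Modes n) :
    Continuous fun h : Fin n → ℝ => translate h ψ := by
  have hg : Continuous fun h : Fin n → ℝ => (⟨fun x => x + h, by fun_prop⟩ :
      C(Fin n → ℝ, Fin n → ℝ)) := by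
    refine ContinuousMap.continuous_of_continuous_uncurry _ ?_
    simp only [Function.uncurry_def, ContinuousMap.coe_mk]
    fun_prop
  exact Continuous.compMeasurePreservingLp (f := fun _ => ψ) continuous_const hg
    (fun h => measurePreserving_add_right volume h) (by norm_num)

/-- Leibniz rule for a product of two families of isometries at a parameter where both are the
identity. -/
theorem hasDerivAt_comp_isometry {H : Type*} [NormedAddCommGroup H] [NormedSpace ℂ H]
    {A : ℝ → H →ₗᵢ[ℂ] H} {B : ℝ → H} {v α β : H} (hA0 : ∀ x, A 0 x = x) (hB0 : B 0 = v)
    (hA : HasDerivAt (fun t => A t v) α 0) (hB : HasDerivAt B β 0)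
    (hc : Tendsto (fun t => A t β) (𝓝 0) (𝓝 β)) :
    HasDerivAt (fun t => A t (B t)) (α + β) 0 := by
  rw [hasDerivAt_iff_tendsto_slope_zero] at *
  simp only [zero_add, hA0, hB0] at *
  have h1 : Tendsto (fun t => A t (t⁻¹ • (B t - v) - β)) (𝓝[≠] 0) (𝓝 0) := by
    rw [tendsto_zero_iff_norm_tendsto_zero]
    simp only [LinearIsometry.norm_map]
    exact tendsto_iff_norm_sub_tendsto_zero.1 hB
  have h2 := (hA.add (hc.mono_left nhdsWithin_le_nhds)).add h1
  rw [add_zero] at h2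
  refine h2.congr fun t => ?_
  have h3 : ∀ (c : ℝ) x, A t (c • x) = c • A t x := fun c x => by
    rw [← Complex.coe_smul, map_smul, Complex.coe_smul]
  simp only [map_sub, h3, smul_sub]
  abel

/-- Directional derivatives at `0` of an orbit of a strongly continuous representation of `ℝⁿ` are
linear combinations of the partial derivatives. -/
theorem hasDerivAt_orbit {H : Type*} [NormedAddCommGroup H] [NormedSpace ℂ H] {n : ℕ}
    {T : (Fin n → ℝ) → H →ₗᵢ[ℂ] H} (hadd : ∀ h h' φ, T (h + h') φ = T h (T h' φ))
    (hzero : ∀ φ, T 0 φ = φ) (hcont : ∀ φ, Continuous fun h => T h φ) {ψ : H} {d : Fin n → H}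
    (hd : ∀ a, HasDerivAt (fun t : ℝ => T (Pi.single a t) ψ) (d a) 0) (q : Fin n → ℝ) :
    HasDerivAt (fun t : ℝ => T (t • q) ψ) (∑ a, q a • d a) 0 := by
  have key : ∀ s : Finset (Fin n), HasDerivAt
      (fun t : ℝ => T (∑ a ∈ s, Pi.single a (t * q a)) ψ) (∑ a ∈ s, q a • d a) 0 := by
    intro s
    induction s using Finset.induction_on with
    | empty => simpa using hasDerivAt_const (0 : ℝ) (T 0 ψ)
    | insert a s ha ih =>
      simp only [Finset.sum_insert ha, hadd]
      refine hasDerivAt_comp_isometry (v := ψ) (A := fun t => T (Pi.single a (t * q a)))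
        (fun x => by simp [hzero]) (by simp [hzero]) ?_ ih ?_
      · have h1 : HasDerivAt (fun t : ℝ => t * q a) (q a) 0 := by
          simpa using (hasDerivAt_id (0 : ℝ)).mul_const (q a)
        have h2 : HasDerivAt (fun t : ℝ => T (Pi.single a t) ψ) (d a) (0 * q a) := by
          simpa using hd a
        exact h2.scomp (0 : ℝ) h1
      · have h1 := ((hcont (∑ a ∈ s, q a • d a)).comp
          (show Continuous fun t : ℝ => (Pi.single a (t * q a) : Fin n → ℝ) from
            (continuous_single a).comp (by fun_prop))).tendsto 0
        simpa [Function.comp_def, hzero] using h1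
  refine (key Finset.univ).congr_of_eventuallyEq (Eventually.of_forall fun t => ?_)
  have h : t • q = ∑ a, Pi.single a (t * q a) := by
    ext a
    simp [Finset.sum_apply, Pi.single_apply]
  simp only [h]

theorem translate_add {n : ℕ} (h h' : Fin n → ℝ) (φ : Modes n) :
    translate (h + h') φ = translate h (translate h' φ) := by
  refine Lp.ext ?_
  have h0 := (measurePreserving_add_right (volume : Measure (Fin n → ℝ))
    h).quasiMeasurePreserving.ae (coeFn_translate h' φ)
  filter_upwards [coeFn_translate (h + h') φ, coeFn_translate h (translate h' φ), h0]
    with x h1 h2 h3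
  rw [h1, h2, h3, add_assoc]

theorem translate_zero {n : ℕ} (φ : Modes n) : translate 0 φ = φ := by
  refine Lp.ext ?_
  filter_upwards [coeFn_translate 0 φ] with x h1
  rw [h1, add_zero]

/-- The phase `exp (-i (t p · x + t² c / 2))`, where `c = p · q`, is the first factor of the
displacement operator `D_{t (q, p)}`; the second one is the translation by `t q`. -/
def rayPhase {n : ℕ} (p : Fin n → ℝ) (c t : ℝ) : Modes n →ₗᵢ[ℂ] Modes n :=
  phase (fun x => -(t * (p ⬝ᵥ x) + t ^ 2 * c / 2)) (by unfold dotProduct; fun_prop)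

theorem coeFn_rayPhase {n : ℕ} (p : Fin n → ℝ) (c t : ℝ) (ψ : Modes n) :
    rayPhase p c t ψ =ᵐ[volume] fun x =>
      Complex.exp (Complex.I * ((-(t * (p ⬝ᵥ x) + t ^ 2 * c / 2) : ℝ) : ℂ)) * ψ x :=
  coeFn_phase _ ψ

theorem rayPhase_zero {n : ℕ} (p : Fin n → ℝ) (c : ℝ) (ψ : Modes n) :
    rayPhase p c 0 ψ = ψ := by
  refine Lp.ext ?_
  filter_upwards [coeFn_rayPhase p c 0 ψ] with x h1
  rw [h1]
  simp

theorem displacement_smul_eq {n : ℕ} (r : Fin n ⊕ Fin n → ℝ) (t : ℝ) (ψ : Modes n) :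
    displacement (t • r) ψ = rayPhase (r ∘ Sum.inr) ((r ∘ Sum.inr) ⬝ᵥ (r ∘ Sum.inl)) t
      (translate (t • (r ∘ Sum.inl)) ψ) := by
  refine Lp.ext ?_
  filter_upwards [coeFn_displacement (t • r) ψ, coeFn_rayPhase (r ∘ Sum.inr)
    ((r ∘ Sum.inr) ⬝ᵥ (r ∘ Sum.inl)) t (translate (t • (r ∘ Sum.inl)) ψ),
    coeFn_translate (t • (r ∘ Sum.inl)) ψ] with x h1 h2 h3
  rw [h1, h2, h3]
  have e : (t • r) ∘ Sum.inr = t • (r ∘ Sum.inr) := rfl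
  have e' : (t • r) ∘ Sum.inl = t • (r ∘ Sum.inl) := rfl
  rw [e, e']
  congr 4
  simp only [smul_dotProduct, dotProduct_add, dotProduct_smul, smul_eq_mul]
  ring

theorem tendsto_rayPhase {n : ℕ} (p : Fin n → ℝ) (c : ℝ) (ψ : Modes n) :
    Tendsto (fun t => rayPhase p c t ψ) (𝓝 0) (𝓝 ψ) := by
  refine tendsto_Lp_two_of_dominated (bound := fun x => 2 * ‖ψ x‖) (F := fun t x =>
    (Complex.exp (Complex.I * ((-(t * (p ⬝ᵥ x) + t ^ 2 * c / 2) : ℝ) : ℂ)) - 1) * ψ x)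
    (Eventually.of_forall fun t => ?_) ((Lp.memLp ψ).norm.const_mul 2)
    (Eventually.of_forall fun t x => ?_) fun x => ?_
  · filter_upwards [Lp.coeFn_sub (rayPhase p c t ψ) ψ, coeFn_rayPhase p c t ψ] with x h1 h2
    rw [h1, Pi.sub_apply, h2]
    ring
  · rw [norm_mul]
    gcongr
    refine (norm_sub_le _ _).trans ?_
    rw [mul_comm Complex.I, Complex.norm_exp_ofReal_mul_I, norm_one]
    norm_num
  · have h : Continuous fun t : ℝ =>
        (Complex.exp (Complex.I * ((-(t * (p ⬝ᵥ x) + t ^ 2 * c / 2) : ℝ) : ℂ)) - 1) * ψ x := by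
      fun_prop
    simpa using h.tendsto 0

theorem hasDerivAt_rayPhase {n : ℕ} (p : Fin n → ℝ) (c : ℝ) {ψ ξ : Modes n}
    (hξ : ξ =ᵐ[volume] fun x => ((p ⬝ᵥ x : ℝ) : ℂ) * ψ x) :
    HasDerivAt (fun t => rayPhase p c t ψ) (-Complex.I • ξ) 0 := by
  rw [hasDerivAt_iff_tendsto_slope_zero]
  simp only [zero_add, rayPhase_zero]
  have hmem : MemLp (fun x => ((p ⬝ᵥ x : ℝ) : ℂ) * ψ x) 2 volume := (Lp.memLp ξ).ae_eq hξ
  refine tendsto_Lp_two_of_dominated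
    (bound := fun x => 2 * ‖((p ⬝ᵥ x : ℝ) : ℂ) * ψ x‖ + |c| * ‖ψ x‖) (F := fun t x =>
    (t⁻¹ * (Complex.exp (Complex.I * ((-(t * (p ⬝ᵥ x) + t ^ 2 * c / 2) : ℝ) : ℂ)) - 1)
      + Complex.I * (p ⬝ᵥ x : ℝ)) * ψ x) (Eventually.of_forall fun t => ?_)
    ((hmem.norm.const_mul 2).add ((Lp.memLp ψ).norm.const_mul |c|)) ?_ fun x => ?_
  · filter_upwards [Lp.coeFn_sub (t⁻¹ • (rayPhase p c t ψ - ψ)) (-Complex.I • ξ),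
      Lp.coeFn_smul t⁻¹ (rayPhase p c t ψ - ψ), Lp.coeFn_smul (-Complex.I) ξ,
      Lp.coeFn_sub (rayPhase p c t ψ) ψ, coeFn_rayPhase p c t ψ, hξ] with x h1 h2 h3 h4 h5 h6
    rw [h1, Pi.sub_apply, h2, h3, Pi.smul_apply, Pi.smul_apply, h4, Pi.sub_apply, h5, h6,
      Complex.real_smul, smul_eq_mul, Complex.ofReal_inv]
    ring
  · have h1 : ∀ᶠ t in 𝓝[≠] (0 : ℝ), |t| < 1 := nhdsWithin_le_nhds
      (continuous_abs.continuousAt.tendsto.eventually_lt_const (by simp))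
    filter_upwards [h1, self_mem_nhdsWithin] with t ht ht0 x
    have ht0' : t ≠ 0 := ht0
    have h2 : ‖((t⁻¹ : ℝ) : ℂ) * (Complex.exp (Complex.I *
        ((-(t * (p ⬝ᵥ x) + t ^ 2 * c / 2) : ℝ) : ℂ)) - 1)‖ ≤ |p ⬝ᵥ x| + |c| := by
      rw [norm_mul, Complex.norm_real, Real.norm_eq_abs, abs_inv]
      have h3 := Real.norm_exp_I_mul_ofReal_sub_one_le (x := -(t * (p ⬝ᵥ x) + t ^ 2 * c / 2))
      calc _ ≤ |t|⁻¹ * ‖-(t * (p ⬝ᵥ x) + t ^ 2 * c / 2)‖ := by gcongr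
        _ = |p ⬝ᵥ x + t * c / 2| := by
          rw [norm_neg, Real.norm_eq_abs, ← abs_inv, ← abs_mul]
          congr 1
          field_simp
        _ ≤ |p ⬝ᵥ x| + |t * c / 2| := abs_add_le _ _
        _ ≤ |p ⬝ᵥ x| + |c| := by
          have h4 : |t * c / 2| ≤ |c| := by
            rw [abs_div, abs_mul, abs_two]
            nlinarith [abs_nonneg c]
          linarith
    rw [norm_mul]
    calc _ ≤ ((|p ⬝ᵥ x| + |c|) + |p ⬝ᵥ x|) * ‖ψ x‖ := by
          gcongr
          refine (norm_add_le _ _).trans (add_le_add h2 ?_)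
          simp
      _ = _ := by
          rw [norm_mul, Complex.norm_real, Real.norm_eq_abs]
          ring
  · have hin : HasDerivAt (fun t : ℝ => -(t * (p ⬝ᵥ x) + t ^ 2 * c / 2)) (-(p ⬝ᵥ x)) 0 := by
      have h1 := (((hasDerivAt_id (0 : ℝ)).mul_const (p ⬝ᵥ x)).add
        ((((hasDerivAt_id (0 : ℝ)).pow 2).mul_const c).div_const 2)).neg
      exact h1.congr_deriv (by simp)
    have hexp := (hin.ofReal_comp.const_mul Complex.I).cexp
    rw [hasDerivAt_iff_tendsto_slope_zero] at hexp
    have h2 := (hexp.add_const (Complex.I * (p ⬝ᵥ x : ℝ))).mul_const (ψ x)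
    simpa using h2

/-- `w j` is the vector `R_j ψ`; in particular `ψ` lies in the domain of every quadrature. -/
def IsQuadratureImage {n : ℕ} (ψ : Modes n) (w : Fin n ⊕ Fin n → Modes n) : Prop :=
  ∀ j, ∃ h : ψ ∈ (quadrature j).domain, quadrature j ⟨ψ, h⟩ = w j

theorem coeFn_position {n : ℕ} {a : Fin n} (ψ : (position a).domain) :
    position a ψ =ᵐ[volume] fun x => (x a : ℂ) * (ψ : Modes n) x :=
  MemLp.coeFn_toLp ψ.2

theorem coeFn_sum_smul {n : ℕ} {ι : Type*} (s : Finset ι) (c : ι → ℂ) (v : ι → Modes n) :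
    (∑ i ∈ s, c i • v i : Modes n) =ᵐ[volume] fun x => ∑ i ∈ s, c i * v i x := by
  classical
  induction s using Finset.induction_on with
  | empty =>
    simp only [Finset.sum_empty]
    exact Lp.coeFn_zero ℂ 2 _
  | insert a s ha ih =>
    rw [Finset.sum_insert ha]
    filter_upwards [Lp.coeFn_add (c a • v a) (∑ i ∈ s, c i • v i), Lp.coeFn_smul (c a) (v a), ih]
      with x h1 h2 h3
    rw [h1, Pi.add_apply, h2, h3, Finset.sum_insert ha, Pi.smul_apply, smul_eq_mul]

theorem Omega_mulVec_inl {n : ℕ} (r : Fin n ⊕ Fin n → ℝ) (a : Fin n) :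
    (Omega n *ᵥ r) (Sum.inl a) = r (Sum.inr a) := by
  simp [Omega, Matrix.fromBlocks_mulVec]

theorem Omega_mulVec_inr {n : ℕ} (r : Fin n ⊕ Fin n → ℝ) (a : Fin n) :
    (Omega n *ᵥ r) (Sum.inr a) = -r (Sum.inl a) := by
  simp [Omega, Matrix.fromBlocks_mulVec, Matrix.neg_mulVec]

/-- The generator of `t ↦ D_{t r}` is `i rᵀ Ω R = -i (Ω r)ᵀ R` on the common domain of the
quadratures. -/
theorem hasDerivAt_displacement_zero {n : ℕ} {ψ : Modes n} {w : Fin n ⊕ Fin n → Modes n}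
    (hw : IsQuadratureImage ψ w) (r : Fin n ⊕ Fin n → ℝ) :
    HasDerivAt (fun t : ℝ => displacement (t • r) ψ)
      (-Complex.I • ∑ j, ((Omega n *ᵥ r) j : ℂ) • w j) 0 := by
  simp only [displacement_smul_eq]
  have hpos : ∀ a, w (Sum.inl a) =ᵐ[volume] fun x => (x a : ℂ) * ψ x := fun a => by
    obtain ⟨h, he⟩ := hw (Sum.inl a)
    rw [← he]
    exact coeFn_position ⟨ψ, h⟩
  have hmom : ∀ a, HasDerivAt (fun t : ℝ => translate (Pi.single a t) ψ)
      (Complex.I • w (Sum.inr a)) 0 := fun a => by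
    obtain ⟨h, he⟩ := hw (Sum.inr a)
    have h1 : DifferentiableAt ℝ (fun t : ℝ => translate (Pi.single a t) ψ) 0 := h
    have h2 : w (Sum.inr a)
        = -Complex.I • deriv (fun t : ℝ => translate (Pi.single a t) ψ) 0 := he.symm
    rw [h2, smul_smul]
    simpa using h1.hasDerivAt
  have hA := hasDerivAt_rayPhase (r ∘ Sum.inr) ((r ∘ Sum.inr) ⬝ᵥ (r ∘ Sum.inl))
    (ψ := ψ) (ξ := ∑ a, (r (Sum.inr a) : ℂ) • w (Sum.inl a)) (by
      refine (coeFn_sum_smul _ _ _).trans ?_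
      filter_upwards [ae_all_iff.2 hpos] with x hx
      simp only [hx, dotProduct, Function.comp_apply, Complex.ofReal_sum, Complex.ofReal_mul,
        Finset.sum_mul, mul_assoc])
  have hB := hasDerivAt_orbit translate_add translate_zero continuous_translate hmom (r ∘ Sum.inl)
  have h := hasDerivAt_comp_isometry (fun x => rayPhase_zero _ _ x) (by simp [translate_zero]) hA hB
    (tendsto_rayPhase _ _ _)
  refine h.congr_deriv ?_
  simp only [Fintype.sum_sum_type, Omega_mulVec_inl, Omega_mulVec_inr, smul_add, Finset.smul_sum,
    Function.comp_apply]
  congr 1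
  refine Finset.sum_congr rfl fun a _ => ?_
  rw [← Complex.coe_smul, smul_smul, smul_smul]
  congr 1
  push_cast
  ring

/-- The orbits `t ↦ D_{t r} ψ` are continuous. -/
theorem continuous_displacement_smul {n : ℕ} (r : Fin n ⊕ Fin n → ℝ) (ψ : Modes n) :
    Continuous fun t : ℝ => displacement (t • r) ψ := by
  have h0 : Tendsto (fun t : ℝ => displacement (t • r) ψ) (𝓝 0) (𝓝 ψ) := by
    simp only [displacement_smul_eq]
    have h1 := tendsto_rayPhase (r ∘ Sum.inr) ((r ∘ Sum.inr) ⬝ᵥ (r ∘ Sum.inl)) ψ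
    have h2 : Tendsto (fun t : ℝ => translate (t • (r ∘ Sum.inl)) ψ) (𝓝 0) (𝓝 ψ) := by
      have h3 := ((continuous_translate ψ).comp
        (show Continuous fun t : ℝ => t • (r ∘ Sum.inl) by fun_prop)).tendsto 0
      simpa [Function.comp_def, translate_zero] using h3
    rw [tendsto_iff_norm_sub_tendsto_zero] at h1 h2 ⊢
    refine squeeze_zero (fun _ => norm_nonneg _) (fun t => ?_) (by simpa using h2.add h1)
    calc _ = ‖rayPhase (r ∘ Sum.inr) ((r ∘ Sum.inr) ⬝ᵥ (r ∘ Sum.inl)) t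
          (translate (t • (r ∘ Sum.inl)) ψ - ψ)
          + (rayPhase (r ∘ Sum.inr) ((r ∘ Sum.inr) ⬝ᵥ (r ∘ Sum.inl)) t ψ - ψ)‖ := by
          rw [map_sub]; congr 1; abel
      _ ≤ _ := by
          refine (norm_add_le _ _).trans ?_
          rw [LinearIsometry.norm_map]
  refine continuous_iff_continuousAt.2 fun t => ?_
  have h1 : Tendsto (fun s : ℝ => displacement (t • r) (displacement ((s - t) • r) ψ)) (𝓝 t)
      (𝓝 (displacement (t • r) ψ)) := by
    refine ((displacement (t • r)).continuous.tendsto ψ).comp (h0.comp ?_)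
    have h2 : Continuous fun s : ℝ => s - t := by fun_prop
    simpa using h2.tendsto t
  refine h1.congr fun s => ?_
  rw [← displacement_add_smul, add_sub_cancel]

theorem hasDerivAt_displacement {n : ℕ} {ψ : Modes n} {w : Fin n ⊕ Fin n → Modes n}
    (hw : IsQuadratureImage ψ w) (r : Fin n ⊕ Fin n → ℝ) (t : ℝ) :
    HasDerivAt (fun t : ℝ => displacement (t • r) ψ)
      (displacement (t • r) (-Complex.I • ∑ j, ((Omega n *ᵥ r) j : ℂ) • w j)) t := by
  have h0 := hasDerivAt_displacement_zero hw r
  have h1 : HasDerivAt (fun s : ℝ => displacement ((s - t) • r) ψ)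
      (-Complex.I • ∑ j, ((Omega n *ᵥ r) j : ℂ) • w j) t := by
    have h2 : HasDerivAt (fun s : ℝ => s - t) 1 t := (hasDerivAt_id t).sub_const t
    rw [← sub_self t] at h0
    simpa [Function.comp_def] using HasDerivAt.scomp (h := fun s : ℝ => s - t) t h0 h2
  have h3 := ((displacement (t • r)).restrictScalars ℝ).hasFDerivAt.comp_hasDerivAt t h1
  refine h3.congr_of_eventuallyEq (Eventually.of_forall fun s => ?_)
  simp only [Function.comp_apply, ContinuousLinearMap.coe_restrictScalars']
  rw [← displacement_add_smul, add_sub_cancel]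

/-! ### Traces against sums of rank-one operators -/

/-- The trace `Tr[D A]` of a sum `A = ∑ |vᵢ⟩⟨vᵢ|` of rank-one operators, computed in any Hilbert
basis, is `∑ ⟨vᵢ, D vᵢ⟩`. -/
theorem hasSum_inner_sumRankOne {ι κ H : Type*} [NormedAddCommGroup H] [InnerProductSpace ℂ H]
    [CompleteSpace H] (e : HilbertBasis κ ℂ H) {v : ι → H} (hv : Summable fun i => ‖v i‖ ^ 2)
    (D : H →L[ℂ] H) :
    HasSum (fun a => ⟪e a, D (sumRankOne v (e a))⟫_ℂ) (∑' i, ⟪v i, D (v i)⟫_ℂ) := by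
  have hparseval : ∀ x : H, HasSum (fun a => ‖⟪e a, x⟫_ℂ‖ ^ 2) (‖x‖ ^ 2) := fun x => by
    have h := Complex.hasSum_re (e.hasSum_inner_mul_inner x x)
    rw [show (⟪x, x⟫_ℂ).re = ‖x‖ ^ 2 from inner_self_eq_norm_sq (𝕜 := ℂ) x] at h
    refine h.congr_fun fun a => ?_
    rw [← inner_conj_symm x (e a), ← Complex.normSq_eq_conj_mul_self, Complex.ofReal_re,
      Complex.normSq_eq_norm_sq]
  set f : ι × κ → ℂ := fun p => ⟪v p.1, e p.2⟫_ℂ * ⟪e p.2, D (v p.1)⟫_ℂ with hf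
  have hrow : ∀ i, HasSum (fun a => f (i, a)) ⟪v i, D (v i)⟫_ℂ := fun i =>
    e.hasSum_inner_mul_inner (v i) (D (v i))
  have hcol : ∀ a, HasSum (fun i => f (i, a)) ⟪e a, D (sumRankOne v (e a))⟫_ℂ := fun a => by
    have h := ((hasSum_sumRankOne hv (e a)).mapL D).mapL (innerSL ℂ (e a))
    refine h.congr_fun fun i => ?_
    simp [hf]
  have hbound : Summable fun p : ι × κ => ‖⟪e p.2, v p.1⟫_ℂ‖ ^ 2 + ‖⟪e p.2, D (v p.1)⟫_ℂ‖ ^ 2 := by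
    rw [summable_prod_of_nonneg fun p => by positivity]
    refine ⟨fun i => ((hparseval (v i)).add (hparseval (D (v i)))).summable, ?_⟩
    have h : ∀ i, ∑' a, (‖⟪e a, v i⟫_ℂ‖ ^ 2 + ‖⟪e a, D (v i)⟫_ℂ‖ ^ 2)
        = ‖v i‖ ^ 2 + ‖D (v i)‖ ^ 2 := fun i =>
      ((hparseval (v i)).add (hparseval (D (v i)))).tsum_eq
    simp only [h]
    refine hv.add (Summable.of_nonneg_of_le (fun i => by positivity) (fun i => ?_)
      (hv.mul_left (‖D‖ ^ 2)))
    rw [← mul_pow]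
    exact pow_le_pow_left₀ (norm_nonneg _) (D.le_opNorm _) 2
  have hfs : Summable f := by
    refine Summable.of_norm_bounded hbound fun p => ?_
    rw [hf, norm_mul, norm_inner_symm]
    nlinarith [sq_nonneg (‖⟪e p.2, v p.1⟫_ℂ‖ - ‖⟪e p.2, D (v p.1)⟫_ℂ‖),
      sq_nonneg ‖⟪e p.2, v p.1⟫_ℂ‖, sq_nonneg ‖⟪e p.2, D (v p.1)⟫_ℂ‖]
  have h1 := hfs.hasSum.prod_fiberwise hrow
  rw [h1.tsum_eq]
  exact ((Equiv.prodComm κ ι).hasSum_iff.2 hfs.hasSum).prod_fiberwise hcol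

/-! ### A sum of rank-one operators is determined by its Weyl transform -/

/-- Injectivity of the Fourier transform on real integrable functions: the positive and the negative
part of `g` are the densities of finite measures with the same characteristic function. -/
theorem ae_eq_zero_of_real_fourier_eq_zero {E : Type*} [NormedAddCommGroup E] [NormedSpace ℝ E]
    [CompleteSpace E] [SecondCountableTopology E] [MeasurableSpace E] [BorelSpace E]
    {μ : Measure E} [SigmaFinite μ] {g : E → ℝ} (hg : Integrable g μ)
    (h : ∀ L : StrongDual ℝ E, ∫ x, Complex.exp (L x * Complex.I) * (g x : ℂ) ∂μ = 0) :
    g =ᵐ[μ] 0 := by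
  have hfin : ∀ g : E → ℝ, Integrable g μ →
      IsFiniteMeasure (μ.withDensity fun x => ENNReal.ofReal (g x)) := fun g hg =>
    isFiniteMeasure_withDensity_ofReal hg.2
  have := hfin g hg
  have := hfin (-g) hg.neg
  have hint : ∀ g : E → ℝ, Integrable g μ → ∀ F : E → ℂ,
      ∫ x, F x ∂(μ.withDensity fun x => ENNReal.ofReal (g x)) = ∫ x, F x * (max (g x) 0 : ℝ) ∂μ := by
    intro g hg F
    rw [integral_withDensity_eq_integral_toReal_smul₀ hg.1.aemeasurable.ennreal_ofReal
      (Eventually.of_forall fun _ => ENNReal.ofReal_lt_top)]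
    refine integral_congr_ae (Eventually.of_forall fun x => ?_)
    simp only [ENNReal.toReal_ofReal', Complex.real_smul]
    ring
  have heq : (μ.withDensity fun x => ENNReal.ofReal (g x))
      = μ.withDensity fun x => ENNReal.ofReal ((-g) x) := by
    refine Measure.ext_of_charFunDual (funext fun L => ?_)
    rw [charFunDual_apply, charFunDual_apply, hint g hg, hint (-g) hg.neg, ← sub_eq_zero]
    have hi : ∀ g : E → ℝ, Integrable g μ →
        Integrable (fun x => Complex.exp (L x * Complex.I) * (max (g x) 0 : ℝ)) μ := fun g hg => by
      refine Integrable.bdd_mul (c := 1) hg.pos_part.ofReal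
        (Continuous.aestronglyMeasurable (by fun_prop)) (Eventually.of_forall fun x => ?_)
      rw [Complex.norm_exp_ofReal_mul_I]
    rw [← integral_sub (hi g hg) (hi (-g) hg.neg), ← h L]
    refine integral_congr_ae (Eventually.of_forall fun x => ?_)
    simp only [Pi.neg_apply]
    rw [← mul_sub, ← Complex.ofReal_sub]
    congr 2
    exact posPart_sub_negPart (g x)
  have hae := (withDensity_eq_iff hg.1.aemeasurable.ennreal_ofReal
    hg.neg.1.aemeasurable.ennreal_ofReal (by
      rw [← lt_top_iff_ne_top]
      exact (lintegral_ofReal_le_lintegral_enorm g).trans_lt hg.2)).1 heq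
  filter_upwards [hae] with x hx
  simp only [Pi.neg_apply, Pi.zero_apply] at hx ⊢
  rcases le_total 0 (g x) with h0 | h0
  · rw [ENNReal.ofReal_of_nonpos (show -g x ≤ 0 by linarith), ENNReal.ofReal_eq_zero] at hx
    linarith
  · rw [ENNReal.ofReal_of_nonpos h0, eq_comm, ENNReal.ofReal_eq_zero] at hx
    linarith

/-- Injectivity of the Fourier transform on integrable functions. -/
theorem ae_eq_zero_of_fourier_eq_zero {E : Type*} [NormedAddCommGroup E] [NormedSpace ℝ E]
    [CompleteSpace E] [SecondCountableTopology E] [MeasurableSpace E] [BorelSpace E]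
    {μ : Measure E} [SigmaFinite μ] {f : E → ℂ} (hf : Integrable f μ)
    (h : ∀ L : StrongDual ℝ E, ∫ x, Complex.exp (L x * Complex.I) * f x ∂μ = 0) :
    f =ᵐ[μ] 0 := by
  have hi : ∀ (L : StrongDual ℝ E) {f : E → ℂ}, Integrable f μ →
      Integrable (fun x => Complex.exp (L x * Complex.I) * f x) μ := fun L f hf => by
    refine Integrable.bdd_mul (c := 1) hf
      (Continuous.aestronglyMeasurable (by fun_prop)) (Eventually.of_forall fun x => ?_)
    rw [Complex.norm_exp_ofReal_mul_I]
  have hfc : Integrable (fun x => (starRingEnd ℂ) (f x)) μ :=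
    (LinearIsometryEquiv.integrable_comp_iff Complex.conjLIE).2 hf
  have hconj : ∀ L : StrongDual ℝ E,
      ∫ x, Complex.exp (L x * Complex.I) * (starRingEnd ℂ) (f x) ∂μ = 0 := fun L => by
    have h1 := congrArg (starRingEnd ℂ) (h (-L))
    rw [← integral_conj, map_zero] at h1
    rw [← h1]
    refine integral_congr_ae (Eventually.of_forall fun x => ?_)
    simp [← Complex.exp_conj]
  have hre := ae_eq_zero_of_real_fourier_eq_zero (g := fun x => (f x).re) hf.re fun L => by
    have e : ∀ x, Complex.exp (L x * Complex.I) * ((f x).re : ℂ)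
        = (1 / 2 : ℂ) * (Complex.exp (L x * Complex.I) * f x
          + Complex.exp (L x * Complex.I) * (starRingEnd ℂ) (f x)) := fun x => by
      rw [Complex.re_eq_add_conj]; ring
    simp only [e]
    rw [integral_const_mul, integral_add (hi L hf) (hi L hfc), h, hconj]
    simp
  have him := ae_eq_zero_of_real_fourier_eq_zero (g := fun x => (f x).im) hf.im fun L => by
    have e : ∀ x, Complex.exp (L x * Complex.I) * ((f x).im : ℂ)
        = (1 / (2 * Complex.I) : ℂ) * (Complex.exp (L x * Complex.I) * f x
          - Complex.exp (L x * Complex.I) * (starRingEnd ℂ) (f x)) := fun x => by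
      rw [Complex.im_eq_sub_conj]; ring
    simp only [e]
    rw [integral_const_mul, integral_sub (hi L hf) (hi L hfc), h, hconj]
    simp
  filter_upwards [hre, him] with x h1 h2
  exact Complex.ext h1 h2

theorem integrable_norm_mul_norm {α : Type*} [MeasurableSpace α] {μ : Measure α}
    (u w : Lp ℂ 2 μ) : Integrable (fun x => ‖u x‖ * ‖w x‖) μ :=
  MemLp.integrable_mul (Lp.memLp u).norm (Lp.memLp w).norm

theorem integral_norm_mul_norm_le {α : Type*} [MeasurableSpace α] {μ : Measure α}
    (u w : Lp ℂ 2 μ) : ∫ x, ‖u x‖ * ‖w x‖ ∂μ ≤ ‖u‖ * ‖w‖ := by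
  have h := real_inner_le_norm ((Lp.memLp w).norm.toLp _) ((Lp.memLp u).norm.toLp _)
  rw [L2.inner_def, Lp.norm_toLp, Lp.norm_toLp, eLpNorm_norm, eLpNorm_norm, ← Lp.norm_def,
    ← Lp.norm_def, mul_comm ‖w‖] at h
  refine le_trans (le_of_eq (integral_congr_ae ?_)) h
  filter_upwards [(Lp.memLp w).norm.coeFn_toLp, (Lp.memLp u).norm.coeFn_toLp] with x h1 h2
  rw [h1, h2]
  simp

theorem integrable_tsum_of_summable_integral_norm {α ι : Type*} [Countable ι] [MeasurableSpace α]
    {μ : Measure α} {F : ι → α → ℂ} (hF : ∀ i, Integrable (F i) μ)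
    (hs : Summable fun i => ∫ x, ‖F i x‖ ∂μ) : Integrable (fun x => ∑' i, F i x) μ := by
  refine ⟨(AEMeasurable.tsum fun i => (hF i).1.aemeasurable).aestronglyMeasurable, ?_⟩
  have h1 : ∫⁻ x, ‖∑' i, F i x‖ₑ ∂μ ≤ ∑' i, ∫⁻ x, ‖F i x‖ₑ ∂μ := by
    rw [← lintegral_tsum fun i => (hF i).1.enorm]
    exact lintegral_mono fun x => enorm_tsum_le_tsum_enorm
  refine h1.trans_lt ?_
  have h2 : ∀ i, ∫⁻ x, ‖F i x‖ₑ ∂μ = ENNReal.ofReal (∫ x, ‖F i x‖ ∂μ) := fun i =>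
    (ofReal_integral_norm_eq_lintegral_enorm (hF i)).symm
  simp only [h2]
  exact hs.tsum_ofReal_lt_top

/-- The integral kernel `K(x, y) = ∑ conj (uᵢ(x)) uᵢ(y)` of (the transpose of) `∑ |uᵢ⟩⟨uᵢ|`. -/
def kernel {E ι : Type*} [MeasurableSpace E] {μ : Measure E} (u : ι → Lp ℂ 2 μ) (x y : E) : ℂ :=
  ∑' i, (starRingEnd ℂ) (u i x) * u i y

theorem measurable_kernel {E ι : Type*} [Countable ι] [MeasurableSpace E] {μ : Measure E}
    (u : ι → Lp ℂ 2 μ) : Measurable fun z : E × E => kernel u z.1 z.2 := by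
  refine Measurable.tsum fun i => ?_
  have h := (Lp.stronglyMeasurable (u i)).measurable
  exact (Complex.continuous_conj.measurable.comp (h.comp measurable_fst)).mul
    (h.comp measurable_snd)

theorem inner_sumRankOne_eq_integral {E ι : Type*} [Countable ι] [MeasurableSpace E]
    {μ : Measure E} [SFinite μ] {u : ι → Lp ℂ 2 μ} (hu : Summable fun i => ‖u i‖ ^ 2)
    (f g : Lp ℂ 2 μ) :
    ⟪f, sumRankOne u g⟫_ℂ
      = ∫ z : E × E, kernel u z.1 z.2 * (g z.1 * (starRingEnd ℂ) (f z.2)) ∂μ.prod μ := by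
  set F : ι → E × E → ℂ := fun i z =>
    ((starRingEnd ℂ) (u i z.1) * g z.1) * ((starRingEnd ℂ) (f z.2) * u i z.2) with hF
  have hi : ∀ u w : Lp ℂ 2 μ, Integrable (fun x => (starRingEnd ℂ) (u x) * w x) μ := fun u w => by
    have h := L2.integrable_inner (𝕜 := ℂ) u w
    refine h.congr (Eventually.of_forall fun x => ?_)
    simp [mul_comm]
  have hin : ∀ u w : Lp ℂ 2 μ, ∫ x, (starRingEnd ℂ) (u x) * w x ∂μ = ⟪u, w⟫_ℂ := fun u w => by
    rw [L2.inner_def]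
    refine integral_congr_ae (Eventually.of_forall fun x => ?_)
    simp [mul_comm]
  have hFi : ∀ i, Integrable (F i) (μ.prod μ) := fun i => (hi (u i) g).mul_prod (hi f (u i))
  have hs : Summable fun i => ∫ z, ‖F i z‖ ∂μ.prod μ := by
    refine Summable.of_nonneg_of_le (fun i => integral_nonneg fun _ => norm_nonneg _) (fun i => ?_)
      (hu.mul_left (‖f‖ * ‖g‖))
    have e : ∫ z, ‖F i z‖ ∂μ.prod μ
        = (∫ x, ‖u i x‖ * ‖g x‖ ∂μ) * ∫ y, ‖f y‖ * ‖u i y‖ ∂μ := by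
      rw [← integral_prod_mul]
      refine integral_congr_ae (Eventually.of_forall fun z => ?_)
      simp [hF]
    rw [e]
    calc _ ≤ (‖u i‖ * ‖g‖) * (‖f‖ * ‖u i‖) :=
          mul_le_mul (integral_norm_mul_norm_le _ _) (integral_norm_mul_norm_le _ _)
            (integral_nonneg fun _ => by positivity) (by positivity)
      _ = _ := by ring
  have h1 := hasSum_integral_of_summable_integral_norm hFi hs
  have h2 := (hasSum_sumRankOne hu g).mapL (innerSL ℂ f)
  have h3 : ∀ i, ∫ z, F i z ∂μ.prod μ = innerSL ℂ f (⟪u i, g⟫_ℂ • u i) := fun i => by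
    rw [hF, integral_prod_mul (fun x => (starRingEnd ℂ) (u i x) * g x)
      (fun y => (starRingEnd ℂ) (f y) * u i y), hin, hin]
    simp
  simp only [h3] at h1
  refine (h2.unique h1).trans (integral_congr_ae (Eventually.of_forall fun z => ?_))
  simp only [kernel, hF]
  rw [← tsum_mul_right]
  exact tsum_congr fun i => by ring

section Weyl

variable {E : Type*} [NormedAddCommGroup E] [NormedSpace ℝ E]
  [MeasurableSpace E] [BorelSpace E] {μ : Measure E} [μ.IsAddLeftInvariant]

theorem memLp_weyl (q : E) (L : StrongDual ℝ E) (f : Lp ℂ 2 μ) :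
    MemLp (fun x => Complex.exp (L x * Complex.I) * f (x + q)) 2 μ := by
  have h1 : MemLp (fun x => f (x + q)) 2 μ :=
    (Lp.memLp f).comp_measurePreserving (measurePreserving_add_right μ q)
  refine h1.of_le ((Continuous.aestronglyMeasurable (by fun_prop)).mul h1.1)
    (Eventually.of_forall fun x => ?_)
  rw [norm_mul, Complex.norm_exp_ofReal_mul_I, one_mul]

/-- The operator `f ↦ exp (i L(x)) f(x + q)` on `L²(E)`, for a translation `q` and a linear
functional `L`: a displacement operator up to a constant phase. -/
def weyl (q : E) (L : StrongDual ℝ E) : Lp ℂ 2 μ →ₗᵢ[ℂ] Lp ℂ 2 μ where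
  toFun f := (memLp_weyl q L f).toLp _
  map_add' f g := by
    rw [← MemLp.toLp_add]
    refine MemLp.toLp_congr _ _ ?_
    filter_upwards [(measurePreserving_add_right μ q).quasiMeasurePreserving.ae
      (Lp.coeFn_add f g)] with x hx
    rw [hx, Pi.add_apply, Pi.add_apply, mul_add]
  map_smul' c f := by
    rw [RingHom.id_apply, ← MemLp.toLp_const_smul]
    refine MemLp.toLp_congr _ _ ?_
    filter_upwards [(measurePreserving_add_right μ q).quasiMeasurePreserving.ae
      (Lp.coeFn_smul c f)] with x hx
    simp only [hx, Pi.smul_apply, smul_eq_mul]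
    ring
  norm_map' f := by
    change ‖(memLp_weyl q L f).toLp _‖ = _
    rw [Lp.norm_toLp, Lp.norm_def]
    congr 1
    rw [← eLpNorm_comp_measurePreserving (Lp.aestronglyMeasurable f)
      (measurePreserving_add_right μ q)]
    refine eLpNorm_congr_norm_ae (Eventually.of_forall fun x => ?_)
    rw [norm_mul, Complex.norm_exp_ofReal_mul_I, one_mul]
    rfl

theorem coeFn_weyl (q : E) (L : StrongDual ℝ E) (f : Lp ℂ 2 μ) :
    weyl q L f =ᵐ[μ] fun x => Complex.exp (L x * Complex.I) * f (x + q) :=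
  (memLp_weyl q L f).coeFn_toLp

/-- On every translate of the diagonal the kernel is integrable, and its Fourier transform there is
a Weyl transform. -/
theorem integrable_kernel_translate {ι : Type*} [Countable ι] {u : ι → Lp ℂ 2 μ}
    (hu : Summable fun i => ‖u i‖ ^ 2) (q : E) :
    Integrable (fun x => kernel u x (x + q)) μ ∧ ∀ L : StrongDual ℝ E,
      ∫ x, Complex.exp (L x * Complex.I) * kernel u x (x + q) ∂μ
        = ∑' i, ⟪u i, weyl q L (u i)⟫_ℂ := by
  have hT : ∀ i, (fun x => ‖u i x‖ * ‖weyl q 0 (u i) x‖) =ᵐ[μ]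
      fun x => ‖(starRingEnd ℂ) (u i x) * u i (x + q)‖ := fun i => by
    filter_upwards [coeFn_weyl q 0 (u i)] with x hx
    rw [hx]
    simp
  have hm : ∀ i, AEStronglyMeasurable (fun x => (starRingEnd ℂ) (u i x) * u i (x + q)) μ :=
    fun i => (Complex.continuous_conj.comp_aestronglyMeasurable (Lp.aestronglyMeasurable _)).mul
      ((Lp.stronglyMeasurable (u i)).comp_measurable (measurable_add_const q)).aestronglyMeasurable
  have hi : ∀ i, Integrable (fun x => (starRingEnd ℂ) (u i x) * u i (x + q)) μ := fun i => by
    rw [← integrable_norm_iff (hm i)]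
    exact (integrable_norm_mul_norm _ _).congr (hT i)
  have hs : Summable fun i => ∫ x, ‖(starRingEnd ℂ) (u i x) * u i (x + q)‖ ∂μ := by
    refine Summable.of_nonneg_of_le (fun i => integral_nonneg fun _ => norm_nonneg _) (fun i => ?_)
      hu
    rw [← integral_congr_ae (hT i), sq]
    refine (integral_norm_mul_norm_le _ _).trans (le_of_eq ?_)
    rw [LinearIsometry.norm_map]
  refine ⟨integrable_tsum_of_summable_integral_norm hi hs, fun L => ?_⟩
  have hexp : ∀ x, ‖Complex.exp (L x * Complex.I)‖ = 1 := fun x => Complex.norm_exp_ofReal_mul_I _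
  have h1 := hasSum_integral_of_summable_integral_norm (μ := μ)
    (F := fun i x => Complex.exp (L x * Complex.I) * ((starRingEnd ℂ) (u i x) * u i (x + q)))
    (fun i => Integrable.bdd_mul (c := 1) (hi i) (Continuous.aestronglyMeasurable (by fun_prop))
      (Eventually.of_forall fun x => (hexp x).le))
    (by simpa only [norm_mul, hexp, one_mul] using hs)
  simp only [tsum_mul_left] at h1
  change ∫ x, Complex.exp (L x * Complex.I) * ∑' i, (starRingEnd ℂ) (u i x) * u i (x + q) ∂μ = _
  rw [← h1.tsum_eq]
  refine tsum_congr fun i => ?_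
  rw [L2.inner_def]
  refine integral_congr_ae ?_
  filter_upwards [coeFn_weyl q L (u i)] with x hx
  rw [hx, RCLike.inner_apply]
  ring

/-- A sum of rank-one operators on `L²(E)` is determined by its Weyl transform, the function
`(q, L) ↦ Tr[W_{q, L} A]`: for every `q`, its Fourier transform in `L` gives back the kernel along the
translate of the diagonal by `q`. -/
theorem sumRankOne_eq_iff [CompleteSpace E] [SecondCountableTopology E] [SigmaFinite μ]
    {ι κ : Type*} [Countable ι] [Countable κ]
    {u : ι → Lp ℂ 2 μ} {w : κ → Lp ℂ 2 μ} (hu : Summable fun i => ‖u i‖ ^ 2)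
    (hw : Summable fun i => ‖w i‖ ^ 2) :
    sumRankOne u = sumRankOne w ↔ ∀ (q : E) (L : StrongDual ℝ E),
      ∑' i, ⟪u i, weyl q L (u i)⟫_ℂ = ∑' i, ⟪w i, weyl q L (w i)⟫_ℂ := by
  constructor
  · intro h q L
    obtain ⟨_, e, -⟩ := exists_hilbertBasis ℂ (Lp ℂ 2 μ)
    have h1 := hasSum_inner_sumRankOne e hu (weyl q L).toContinuousLinearMap
    have h2 := hasSum_inner_sumRankOne e hw (weyl q L).toContinuousLinearMap
    rw [h] at h1
    exact h1.unique h2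
  · intro h
    have hq : ∀ q, ∀ᵐ x ∂μ, kernel u x (x + q) = kernel w x (x + q) := fun q => by
      obtain ⟨h1, h2⟩ := integrable_kernel_translate hu q
      obtain ⟨h3, h4⟩ := integrable_kernel_translate hw q
      have hz := ae_eq_zero_of_fourier_eq_zero (h1.sub h3) fun L => by
        have hi : ∀ {f : E → ℂ}, Integrable f μ →
            Integrable (fun x => Complex.exp (L x * Complex.I) * f x) μ := fun hf => by
          refine Integrable.bdd_mul (c := 1) hf
            (Continuous.aestronglyMeasurable (by fun_prop)) (Eventually.of_forall fun x => ?_)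
          rw [Complex.norm_exp_ofReal_mul_I]
        simp only [Pi.sub_apply, mul_sub]
        rw [integral_sub (hi h1) (hi h3), h2, h4, h, sub_self]
      filter_upwards [hz] with x hx
      exact sub_eq_zero.1 hx
    have hprod : ∀ᵐ z ∂μ.prod μ, kernel u z.1 z.2 = kernel w z.1 z.2 := by
      have hmeas : MeasurableSet {z : E × E | kernel u z.2 (z.2 + z.1) = kernel w z.2 (z.2 + z.1)} := by
        have hmap : Measurable fun z : E × E => (z.2, z.2 + z.1) := by fun_prop
        exact measurableSet_eq_fun ((measurable_kernel u).comp hmap)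
          ((measurable_kernel w).comp hmap)
      have h1 : ∀ᵐ z ∂μ.prod μ, kernel u z.2 (z.2 + z.1) = kernel w z.2 (z.2 + z.1) :=
        (Measure.ae_prod_iff_ae_ae hmeas).2 (Eventually.of_forall hq)
      have h2 := (Measure.measurePreserving_swap.comp
        (measurePreserving_prod_neg_add μ μ)).quasiMeasurePreserving.ae h1
      filter_upwards [h2] with z hz
      simpa using hz
    refine ContinuousLinearMap.ext fun g => ext_inner_left ℂ fun f => ?_
    rw [inner_sumRankOne_eq_integral hu, inner_sumRankOne_eq_integral hw]
    refine integral_congr_ae ?_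
    filter_upwards [hprod] with z hz
    rw [hz]

end Weyl

/-! ### Rotation invariance in terms of characteristic functions -/

theorem countable_of_orthonormal {ι H : Type*} [NormedAddCommGroup H] [InnerProductSpace ℂ H]
    [TopologicalSpace.SeparableSpace H] {v : ι → H} (hv : Orthonormal ℂ v) : Countable ι := by
  refine Pairwise.countable_of_isOpen_disjoint (s := fun i => Metric.ball (v i) (1 / 2))
    (fun i j hij => ?_) (fun i => Metric.isOpen_ball) fun i => ⟨v i, by simp⟩
  refine Set.disjoint_left.2 fun x hi hj => ?_
  have h1 : dist (v i) (v j) < 1 := by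
    have := dist_triangle_right (v i) (v j) x
    rw [Metric.mem_ball'] at hi hj
    linarith
  have h2 : ‖v i - v j‖ ^ 2 = 2 := by
    rw [@norm_sub_sq ℂ, hv.1, hv.1, hv.2 hij]
    norm_num
  rw [dist_eq_norm] at h1
  nlinarith [norm_nonneg (v i - v j)]

instance countable_basisIndex (n : ℕ) : Countable (basisIndex n) := by
  have : Fact ((2 : ℝ≥0∞) ≠ ∞) := ⟨by norm_num⟩
  exact countable_of_orthonormal (basis n).orthonormal

/-- The linear functional `x ↦ -∑ⱼ pⱼ · xⱼ` on `ℝ^{n × k}`. -/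
def momentumFunctional {n k : ℕ} (p : Fin k → Fin n → ℝ) : StrongDual ℝ (Fin k → Fin n → ℝ) :=
  -∑ j, ∑ a, p j a •
    ((ContinuousLinearMap.proj a : (Fin n → ℝ) →L[ℝ] ℝ) ∘L ContinuousLinearMap.proj j)

theorem momentumFunctional_apply {n k : ℕ} (p x : Fin k → Fin n → ℝ) :
    momentumFunctional p x = -∑ j, p j ⬝ᵥ x j := by
  simp [momentumFunctional, dotProduct]

theorem exists_momentumFunctional_eq {n k : ℕ} (L : StrongDual ℝ (Fin k → Fin n → ℝ)) :
    ∃ p, momentumFunctional p = L := by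
  refine ⟨fun j a => -L (Pi.single j (Pi.single a 1)), ?_⟩
  refine ContinuousLinearMap.coe_injective ?_
  refine LinearMap.pi_ext' fun j => LinearMap.pi_ext' fun a => LinearMap.ext_ring ?_
  simp only [LinearMap.comp_apply, ContinuousLinearMap.coe_coe, momentumFunctional_apply]
  rw [Finset.sum_eq_single j]
  · simp
  · intro b _ hb
    simp [hb]
  · simp

theorem sum_dotProduct_rightMul {n k : ℕ} {o : Matrix (Fin k) (Fin k) ℝ} (ho : o * oᵀ = 1)
    (x y : Fin k → Fin n → ℝ) :
    ∑ b, rightMul n o x b ⬝ᵥ rightMul n o y b = ∑ b, x b ⬝ᵥ y b := by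
  have h1 := rightMul_sum_sq n ho (x + y)
  have h2 := rightMul_sum_sq n ho x
  have h3 := rightMul_sum_sq n ho y
  have e : ∀ x y : Fin k → Fin n → ℝ, ∑ b, ∑ a, ((x + y) b a) ^ 2
      = ∑ b, ∑ a, (x b a) ^ 2 + 2 * ∑ b, x b ⬝ᵥ y b + ∑ b, ∑ a, (y b a) ^ 2 := fun x y => by
    simp only [dotProduct, Finset.mul_sum, ← Finset.sum_add_distrib]
    refine Finset.sum_congr rfl fun b _ => Finset.sum_congr rfl fun a _ => ?_
    simp only [Pi.add_apply]
    ring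
  rw [map_add, e, e] at h1
  linarith

theorem coeFn_rotation {n k : ℕ} (o : Matrix.orthogonalGroup (Fin k) ℝ) (Ψ : Copies n k) :
    rotation n o Ψ =ᵐ[volume] fun x => Ψ (rightMul n (o : Matrix (Fin k) (Fin k) ℝ) x) :=
  Lp.coeFn_compMeasurePreserving Ψ
    (measurePreserving_rightMul n (mul_transpose_of_orthogonal o))

theorem inner_rotation_rotation {n k : ℕ} (o : Matrix.orthogonalGroup (Fin k) ℝ)
    (Ψ Φ : Copies n k) : ⟪rotation n o Ψ, rotation n o Φ⟫_ℂ = ⟪Ψ, Φ⟫_ℂ :=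
  LinearIsometry.inner_map_map _ Ψ Φ

theorem norm_rotation {n k : ℕ} (o : Matrix.orthogonalGroup (Fin k) ℝ) (Ψ : Copies n k) :
    ‖rotation n o Ψ‖ = ‖Ψ‖ :=
  LinearIsometry.norm_map _ Ψ

/-- Rotations permute the Weyl operators. -/
theorem weyl_rotation {n k : ℕ} (o : Matrix.orthogonalGroup (Fin k) ℝ)
    (q p : Fin k → Fin n → ℝ) (Ψ : Copies n k) :
    weyl q (momentumFunctional p) (rotation n o Ψ) =
      rotation n o (weyl (rightMul n o q) (momentumFunctional (rightMul n o p)) Ψ) := by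
  have ho := mul_transpose_of_orthogonal o
  refine Lp.ext ?_
  filter_upwards [coeFn_weyl q (momentumFunctional p) (rotation n o Ψ),
    coeFn_rotation o (weyl (rightMul n o q) (momentumFunctional (rightMul n o p)) Ψ),
    (measurePreserving_add_right volume q).quasiMeasurePreserving.ae (coeFn_rotation o Ψ),
    (measurePreserving_rightMul n ho).quasiMeasurePreserving.ae
      (coeFn_weyl (rightMul n o q) (momentumFunctional (rightMul n o p)) Ψ)] with x h1 h2 h3 h4
  rw [h1, h2, h3, h4, momentumFunctional_apply, momentumFunctional_apply,
    sum_dotProduct_rightMul ho, map_add]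

/-- On product vectors, a Weyl operator is a product of displacement operators, up to a phase. -/
theorem weyl_tensor {n k : ℕ} (R : Fin k → Fin n ⊕ Fin n → ℝ) (φ : Fin k → Modes n) :
    weyl (fun j => R j ∘ Sum.inl) (momentumFunctional fun j => R j ∘ Sum.inr) (tensor φ) =
      Complex.exp (((∑ j, (R j ∘ Sum.inr) ⬝ᵥ (R j ∘ Sum.inl) : ℝ) / 2 : ℂ) * Complex.I) •
        tensor fun j => displacement (R j) (φ j) := by
  refine Lp.ext ?_
  have hD : ∀ j, ∀ᵐ x : Fin k → Fin n → ℝ, displacement (R j) (φ j) (x j) =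
      Complex.exp (Complex.I *
        ((-((R j ∘ Sum.inr) ⬝ᵥ (x j + (1 / 2 : ℝ) • (R j ∘ Sum.inl))) : ℝ) : ℂ))
          * φ j (x j + R j ∘ Sum.inl) := fun j =>
    (Measure.quasiMeasurePreserving_eval (fun _ : Fin k => (volume : Measure (Fin n → ℝ)))
      j).ae (coeFn_displacement (R j) (φ j))
  filter_upwards [coeFn_weyl (fun j => R j ∘ Sum.inl)
      (momentumFunctional fun j => R j ∘ Sum.inr) (tensor φ),
    (measurePreserving_add_right volume (fun j => R j ∘ Sum.inl)).quasiMeasurePreserving.ae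
      (coeFn_tensor φ), Lp.coeFn_smul (Complex.exp
        (((∑ j, (R j ∘ Sum.inr) ⬝ᵥ (R j ∘ Sum.inl) : ℝ) / 2 : ℂ) * Complex.I))
      (tensor fun j => displacement (R j) (φ j)),
    coeFn_tensor fun j => displacement (R j) (φ j), ae_all_iff.2 hD] with x h1 h2 h3 h4 h5
  rw [h1, h2, h3, Pi.smul_apply, h4, smul_eq_mul]
  simp only [h5, Finset.prod_mul_distrib, ← Complex.exp_sum]
  rw [← mul_assoc, ← Complex.exp_add, momentumFunctional_apply]
  congr 2
  simp only [dotProduct_add, dotProduct_smul, smul_eq_mul, ← Finset.mul_sum]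
  push_cast
  simp only [neg_add, Finset.sum_add_distrib, Finset.sum_neg_distrib, ← Finset.mul_sum]
  ring

/-- The function `r ↦ ∑ ⟨vᵢ, D_r vᵢ⟩`, i.e. the characteristic function of `∑ |vᵢ⟩⟨vᵢ|`. -/
def familyCharFn {n : ℕ} {ι : Type*} (v : ι → Modes n) (r : Fin n ⊕ Fin n → ℝ) : ℂ :=
  ∑' i, ⟪v i, displacement r (v i)⟫_ℂ

theorem norm_inner_displacement_le {n : ℕ} (r : Fin n ⊕ Fin n → ℝ) (ψ : Modes n) :
    ‖⟪ψ, displacement r ψ⟫_ℂ‖ ≤ ‖ψ‖ ^ 2 := by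
  refine (norm_inner_le_norm _ _).trans (le_of_eq ?_)
  rw [norm_displacement, sq]

/-- The characteristic function of a product is the product of the characteristic functions. -/
theorem tsum_prod_inner_displacement {n k : ℕ} {ι : Type*} {v : ι → Modes n}
    (hv : Summable fun i => ‖v i‖ ^ 2) (R : Fin k → Fin n ⊕ Fin n → ℝ) :
    ∑' I : Fin k → ι, ∏ j, ⟪v (I j), displacement (R j) (v (I j))⟫_ℂ
      = ∏ j, familyCharFn v (R j) := by
  classical
  have hs : Summable fun I : Fin k → ι =>
      ∏ j, ⟪v (I j), displacement (R j) (v (I j))⟫_ℂ := by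
    refine Summable.of_norm_bounded (summable_prod_pi k hv fun i => sq_nonneg _) fun I => ?_
    rw [norm_prod]
    exact Finset.prod_le_prod (fun _ _ => norm_nonneg _) fun j _ => norm_inner_displacement_le _ _
  have hbox : Tendsto (fun s : Finset ι => Fintype.piFinset fun _ : Fin k => s) atTop atTop := by
    refine tendsto_atTop_finset_of_monotone (fun s t hst => Fintype.piFinset_subset _ _ fun _ => hst)
      fun I => ⟨Finset.univ.image I, ?_⟩
    exact Fintype.mem_piFinset.2 fun j => Finset.mem_image_of_mem _ (Finset.mem_univ j)
  have h1 := hs.hasSum.comp hbox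
  have h2 : Tendsto (fun s : Finset ι => ∏ j, ∑ i ∈ s, ⟪v i, displacement (R j) (v i)⟫_ℂ) atTop
      (𝓝 (∏ j, familyCharFn v (R j))) :=
    tendsto_finsetProd _ fun j _ => (Summable.of_norm_bounded hv fun i =>
      norm_inner_displacement_le (R j) (v i)).hasSum
  refine tendsto_nhds_unique h1 (h2.congr fun s => ?_)
  rw [Finset.prod_univ_sum]
  rfl

theorem summable_norm_tensor {n k : ℕ} {ι : Type*} {v : ι → Modes n}
    (hv : Summable fun i => ‖v i‖ ^ 2) :
    Summable fun I : Fin k → ι => ‖tensor fun j => v (I j)‖ ^ 2 := by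
  refine (summable_prod_pi k hv fun i => sq_nonneg _).congr fun I => ?_
  rw [norm_tensor, Finset.prod_pow]

/-- Invariance of `(∑ |vᵢ⟩⟨vᵢ|)^{⊗k}` under `U_o`, in terms of characteristic functions. -/
theorem sumRankOne_rotation_eq_iff {n k : ℕ} {ι : Type*} [Countable ι] {v : ι → Modes n}
    (hv : Summable fun i => ‖v i‖ ^ 2) (o : Matrix.orthogonalGroup (Fin k) ℝ) :
    sumRankOne (fun I : Fin k → ι => rotation n o (tensor fun j => v (I j)))
        = sumRankOne (fun I : Fin k → ι => tensor fun j => v (I j)) ↔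
      ∀ R : Fin k → Fin n ⊕ Fin n → ℝ,
        ∏ b, familyCharFn v (∑ c, (o : Matrix (Fin k) (Fin k) ℝ) c b • R c)
          = ∏ j, familyCharFn v (R j) := by
  have ho := mul_transpose_of_orthogonal o
  have hs := summable_norm_tensor (k := k) hv
  have hs' : Summable fun I : Fin k → ι => ‖rotation n o (tensor fun j => v (I j))‖ ^ 2 := by
    simpa only [norm_rotation] using hs
  rw [sumRankOne_eq_iff hs' hs]
  have hW : ∀ R : Fin k → Fin n ⊕ Fin n → ℝ,
      ∑' I : Fin k → ι, ⟪tensor fun j => v (I j), weyl (fun j => R j ∘ Sum.inl)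
        (momentumFunctional fun j => R j ∘ Sum.inr) (tensor fun j => v (I j))⟫_ℂ
      = Complex.exp (((∑ j, (R j ∘ Sum.inr) ⬝ᵥ (R j ∘ Sum.inl) : ℝ) / 2 : ℂ) * Complex.I)
        * ∏ j, familyCharFn v (R j) := fun R => by
    rw [← tsum_prod_inner_displacement hv, ← tsum_mul_left]
    refine tsum_congr fun I => ?_
    rw [weyl_tensor, inner_smul_right, inner_tensor]
  have hrot : ∀ R : Fin k → Fin n ⊕ Fin n → ℝ,
      ∑' I : Fin k → ι, ⟪rotation n o (tensor fun j => v (I j)), weyl (fun j => R j ∘ Sum.inl)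
        (momentumFunctional fun j => R j ∘ Sum.inr) (rotation n o (tensor fun j => v (I j)))⟫_ℂ
      = Complex.exp (((∑ j, (R j ∘ Sum.inr) ⬝ᵥ (R j ∘ Sum.inl) : ℝ) / 2 : ℂ) * Complex.I)
        * ∏ b, familyCharFn v (∑ c, (o : Matrix (Fin k) (Fin k) ℝ) c b • R c) := fun R => by
    have e : ∀ (g : Fin n → Fin n ⊕ Fin n), (rightMul n (o : Matrix (Fin k) (Fin k) ℝ)
        fun j => R j ∘ g) = fun b => (∑ c, (o : Matrix (Fin k) (Fin k) ℝ) c b • R c) ∘ g :=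
      fun g => by
        funext b a
        simp [rightMul, Finset.sum_apply]
    simp only [weyl_rotation, inner_rotation_rotation, e]
    rw [hW fun b => ∑ c, (o : Matrix (Fin k) (Fin k) ℝ) c b • R c]
    have h := sum_dotProduct_rightMul ho (fun j => R j ∘ Sum.inr) (fun j => R j ∘ Sum.inl)
    rw [e, e] at h
    rw [h]
  constructor
  · intro h R
    have h1 := h (fun j => R j ∘ Sum.inl) (momentumFunctional fun j => R j ∘ Sum.inr)
    rw [hW, hrot] at h1
    exact mul_left_cancel₀ (Complex.exp_ne_zero _) h1
  · intro h q L
    obtain ⟨p, rfl⟩ := exists_momentumFunctional_eq L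
    have h1 := hrot fun j => Sum.elim (q j) (p j)
    rw [h, ← hW] at h1
    simpa only [Sum.elim_comp_inl, Sum.elim_comp_inr] using h1

/-- The product `∏ χ(r_j)` is invariant under the action of `o`. -/
def IsProductInvariant {n k : ℕ} (χ : (Fin n ⊕ Fin n → ℝ) → ℂ)
    (o : Matrix.orthogonalGroup (Fin k) ℝ) : Prop :=
  ∀ R : Fin k → Fin n ⊕ Fin n → ℝ,
    ∏ b, χ (∑ c, (o : Matrix (Fin k) (Fin k) ℝ) c b • R c) = ∏ j, χ (R j)

theorem sumRankOne_sqrtVec {n : ℕ} {ρ : Modes n →L[ℂ] Modes n} (hρ : IsDensityOperator ρ) :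
    sumRankOne (sqrtVec ρ) = ρ :=
  ContinuousLinearMap.ext fun ψ =>
    (hasSum_sumRankOne (summable_sqrtVec hρ) ψ).unique (hasSum_sqrtVec hρ.isPositive ψ)

theorem charFn_sumRankOne {n : ℕ} {ι : Type*} {v : ι → Modes n}
    (hv : Summable fun i => ‖v i‖ ^ 2) : charFn (sumRankOne v) = familyCharFn v :=
  funext fun r => (hasSum_inner_sumRankOne (basis n) hv (displacement r)).tsum_eq

theorem charFn_eq_familyCharFn {n : ℕ} {ρ : Modes n →L[ℂ] Modes n} (hρ : IsDensityOperator ρ) :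
    charFn ρ = familyCharFn (sqrtVec ρ) := by
  rw [← charFn_sumRankOne (summable_sqrtVec hρ), sumRankOne_sqrtVec hρ]

theorem isRotationInvariant_iff {n k : ℕ} {ρ : Modes n →L[ℂ] Modes n} (hρ : IsDensityOperator ρ)
    (o : Matrix.orthogonalGroup (Fin k) ℝ) :
    IsRotationInvariant ρ o ↔ IsProductInvariant (charFn ρ) o := by
  rw [IsProductInvariant, charFn_eq_familyCharFn hρ,
    ← sumRankOne_rotation_eq_iff (summable_sqrtVec hρ), IsRotationInvariant]
  have h : rotation n o ∘L tensorPow k ρ ∘L ContinuousLinearMap.adjoint (rotation n o)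
      = sumRankOne fun I : Fin k → basisIndex n =>
        rotation n o (tensor fun j => sqrtVec ρ (I j)) := by
    refine ContinuousLinearMap.ext fun Ψ => ?_
    have h1 := (hasSum_sumRankOne (summable_tensor_sqrtVec k hρ)
      (ContinuousLinearMap.adjoint (rotation n o) Ψ)).mapL (rotation n o)
    have h2 := hasSum_sumRankOne (v := fun I : Fin k → basisIndex n =>
      rotation n o (tensor fun j => sqrtVec ρ (I j)))
      (by simpa only [norm_rotation] using summable_tensor_sqrtVec k hρ) Ψ
    refine h1.unique (h2.congr_fun fun I => ?_)
    rw [map_smul, ContinuousLinearMap.adjoint_inner_right]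
  rw [h]
  rfl

/-! ### Pure states -/

theorem sumRankOne_unique {ι H : Type*} [Unique ι] [NormedAddCommGroup H] [InnerProductSpace ℂ H]
    (v : ι → H) : sumRankOne v = rankOne ℂ (v default) (v default) := by
  rw [sumRankOne, tsum_fintype, Fintype.sum_unique]

theorem charFn_pureState {n : ℕ} (ψ : Modes n) :
    charFn (pureState ψ) = familyCharFn fun _ : Unit => ψ := by
  rw [← charFn_sumRankOne (Summable.of_finite), sumRankOne_unique]
  rfl

theorem charFn_pureState_apply {n : ℕ} (ψ : Modes n) (r : Fin n ⊕ Fin n → ℝ) :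
    charFn (pureState ψ) r = ⟪ψ, displacement r ψ⟫_ℂ := by
  rw [charFn_pureState, familyCharFn, tsum_fintype, Fintype.sum_unique]

theorem rankOne_rotation_eq_iff {n k : ℕ} (ψ : Modes n) (o : Matrix.orthogonalGroup (Fin k) ℝ) :
    rankOne ℂ (rotation n o (vecTensorPow k ψ)) (rotation n o (vecTensorPow k ψ))
        = rankOne ℂ (vecTensorPow k ψ) (vecTensorPow k ψ) ↔
      IsProductInvariant (charFn (pureState ψ)) o := by
  have h := sumRankOne_rotation_eq_iff (v := fun _ : Unit => ψ) Summable.of_finite o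
  rw [sumRankOne_unique, sumRankOne_unique] at h
  rw [IsProductInvariant, charFn_pureState]
  exact h

theorem isProductInvariant_of_rotation_eq {n k : ℕ} {ψ : Modes n}
    {o : Matrix.orthogonalGroup (Fin k) ℝ}
    (h : rotation n o (vecTensorPow k ψ) = vecTensorPow k ψ) :
    IsProductInvariant (charFn (pureState ψ)) o := by
  rw [← rankOne_rotation_eq_iff, h]

/-- If the state `|ψ⟩⟨ψ|^{⊗k}` is invariant, then the vector `ψ^{⊗k}` is invariant up to a phase. -/
theorem exists_rotation_eq_smul {n k : ℕ} {ψ : Modes n} (hψ : ‖ψ‖ = 1)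
    {o : Matrix.orthogonalGroup (Fin k) ℝ} (h : IsProductInvariant (charFn (pureState ψ)) o) :
    ∃ c : ℂ, rotation n o (vecTensorPow k ψ) = c • vecTensorPow k ψ := by
  rw [← rankOne_rotation_eq_iff] at h
  have h1 := congrArg (fun A : Copies n k →L[ℂ] Copies n k => A (rotation n o (vecTensorPow k ψ))) h
  simp only [rankOne_apply] at h1
  have h2 : ‖vecTensorPow k ψ‖ = 1 := by simp [vecTensorPow, norm_tensor, hψ]
  refine ⟨⟪vecTensorPow k ψ, rotation n o (vecTensorPow k ψ)⟫_ℂ, ?_⟩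
  rw [← h1, inner_self_eq_norm_sq_to_K, norm_rotation, h2]
  simp

theorem isDensityOperator_pureState {n : ℕ} {ψ : Modes n} (hψ : ‖ψ‖ = 1) :
    IsDensityOperator (pureState ψ) := by
  refine ⟨isPositive_rankOne_self ψ, ?_⟩
  have h := (basis n).hasSum_inner_mul_inner ψ ψ
  rw [inner_self_eq_norm_sq_to_K, hψ] at h
  simp only [RCLike.ofReal_one, one_pow] at h
  refine h.congr_fun fun i => ?_
  rw [pureState, rankOne_apply, inner_smul_right]

/-! ### Moments and the characteristic function -/

/-- Square-summable families of vectors of `L²(ℝⁿ)`. A decomposition `ρ = ∑ |vᵢ⟩⟨vᵢ|` of a density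
operator turns it into the single unit vector `v` of this Hilbert space. -/
abbrev Families (ι : Type*) (n : ℕ) : Type _ :=
  lp (fun _ : ι => Modes n) 2

theorem summable_norm_sq_families {ι : Type*} {n : ℕ} (V : Families ι n) :
    Summable fun i => ‖V i‖ ^ 2 := by
  have h := Complex.hasSum_re (lp.hasSum_inner (𝕜 := ℂ) V V)
  refine h.summable.congr fun i => ?_
  exact (inner_self_eq_norm_sq (𝕜 := ℂ) (V i))

/-- The vector `i rᵀ Ω R v` for a family `v` with `W j = R_j v`. -/
def generator {ι : Type*} {n : ℕ} (W : Fin n ⊕ Fin n → Families ι n) (r : Fin n ⊕ Fin n → ℝ) :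
    Families ι n :=
  -Complex.I • ∑ j, ((Omega n *ᵥ r) j : ℂ) • W j

theorem generator_apply {ι : Type*} {n : ℕ} (W : Fin n ⊕ Fin n → Families ι n)
    (r : Fin n ⊕ Fin n → ℝ) (i : ι) :
    generator W r i = -Complex.I • ∑ j, ((Omega n *ᵥ r) j : ℂ) • W j i := by
  simp only [generator, lp.coeFn_smul, Pi.smul_apply, lp.coeFn_sum, Finset.sum_apply]

theorem norm_inner_displacement_le_add {n : ℕ} (r : Fin n ⊕ Fin n → ℝ) (φ ψ : Modes n) :
    ‖⟪φ, displacement r ψ⟫_ℂ‖ ≤ ‖φ‖ ^ 2 + ‖ψ‖ ^ 2 := by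
  refine (norm_inner_le_norm _ _).trans ?_
  rw [norm_displacement]
  nlinarith [sq_nonneg (‖φ‖ - ‖ψ‖), sq_nonneg ‖φ‖, sq_nonneg ‖ψ‖]

theorem inner_displacement_neg {n : ℕ} (r : Fin n ⊕ Fin n → ℝ) (φ ψ : Modes n) :
    ⟪displacement (-r) φ, ψ⟫_ℂ = ⟪φ, displacement r ψ⟫_ℂ := by
  have h := inner_displacement_smul r (-1) φ ψ
  rwa [neg_smul, one_smul, neg_neg, one_smul] at h

section Moments

variable {ι : Type*} {n : ℕ} {V : Families ι n} {W : Fin n ⊕ Fin n → Families ι n}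

/-- With finite second moments the characteristic function is differentiable along every line. -/
theorem hasDerivAt_familyCharFn (hW : ∀ i, IsQuadratureImage (V i) fun j => W j i)
    (r : Fin n ⊕ Fin n → ℝ) (t : ℝ) :
    HasDerivAt (fun t : ℝ => familyCharFn V (t • r))
      (∑' i, ⟪V i, displacement (t • r) (generator W r i)⟫_ℂ) t := by
  refine hasDerivAt_tsum (u := fun i => ‖V i‖ ^ 2 + ‖generator W r i‖ ^ 2) (y₀ := 0)
    (g' := fun i t => ⟪V i, displacement (t • r) (generator W r i)⟫_ℂ)
    ((summable_norm_sq_families V).add (summable_norm_sq_families _)) (fun i s => ?_)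
    (fun i s => norm_inner_displacement_le_add _ _ _) ?_ t
  · have h := hasDerivAt_displacement (hW i) r s
    rw [← generator_apply] at h
    simpa using (hasDerivAt_const s (V i)).inner ℂ h
  · exact Summable.of_norm_bounded (summable_norm_sq_families V) fun i =>
      norm_inner_displacement_le _ _

/-- With finite second moments the characteristic function is twice differentiable along every
line. -/
theorem hasDerivAt_deriv_familyCharFn (hW : ∀ i, IsQuadratureImage (V i) fun j => W j i)
    (r : Fin n ⊕ Fin n → ℝ) (t : ℝ) :
    HasDerivAt (fun t : ℝ => ∑' i, ⟪V i, displacement (t • r) (generator W r i)⟫_ℂ)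
      (∑' i, -⟪generator W r i, displacement (t • r) (generator W r i)⟫_ℂ) t := by
  refine hasDerivAt_tsum (u := fun i => ‖generator W r i‖ ^ 2) (y₀ := 0)
    (g' := fun i t => -⟪generator W r i, displacement (t • r) (generator W r i)⟫_ℂ)
    (summable_norm_sq_families _) (fun i s => ?_)
    (fun i s => by rw [norm_neg]; exact norm_inner_displacement_le _ _) ?_ t
  · -- moving `D_{s r}` to the other argument makes it act on a vector of the domain
    have h := hasDerivAt_displacement (hW i) r (-s)
    rw [← generator_apply] at h
    have h1 := (HasDerivAt.scomp (h := fun s : ℝ => -s) s h (hasDerivAt_neg s)).inner ℂ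
      (hasDerivAt_const s (generator W r i))
    refine (h1.congr_deriv ?_).congr_of_eventuallyEq (Eventually.of_forall fun x => ?_)
    · simp [inner_displacement_neg]
    · simp [inner_displacement_neg]
  · exact Summable.of_norm_bounded
      ((summable_norm_sq_families V).add (summable_norm_sq_families (generator W r)))
      fun i => norm_inner_displacement_le_add _ _ _

theorem tsum_inner_displacement_zero (U U' : Families ι n) (r : Fin n ⊕ Fin n → ℝ) :
    ∑' i, ⟪U i, displacement ((0 : ℝ) • r) (U' i)⟫_ℂ = ⟪U, U'⟫_ℂ := by
  simp only [zero_smul, displacement_zero]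
  exact (lp.inner_eq_tsum U U').symm

theorem familyCharFn_zero (hV : ‖V‖ = 1) (r : Fin n ⊕ Fin n → ℝ) :
    familyCharFn V ((0 : ℝ) • r) = 1 := by
  rw [familyCharFn, tsum_inner_displacement_zero, inner_self_eq_norm_sq_to_K, hV]
  simp

theorem hasDerivAt_familyCharFn_zero (hW : ∀ i, IsQuadratureImage (V i) fun j => W j i)
    (r : Fin n ⊕ Fin n → ℝ) :
    HasDerivAt (fun t : ℝ => familyCharFn V (t • r)) ⟪V, generator W r⟫_ℂ 0 := by
  have h := hasDerivAt_familyCharFn hW r 0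
  rwa [tsum_inner_displacement_zero] at h

/-- If the characteristic function solves the scaling equation of a nontrivial orthogonal matrix
along a line, then it is Gaussian along that line. -/
theorem familyCharFn_eq_exp (hV : ‖V‖ = 1) (hW : ∀ i, IsQuadratureImage (V i) fun j => W j i)
    {κ : Type*} [Fintype κ] {a : κ → ℝ} (ha : ∑ b, a b ^ 2 = 1) (ha1 : ∀ b, |a b| < 1)
    (h : ∀ r, familyCharFn V r = ∏ b, familyCharFn V (a b • r)) (r : Fin n ⊕ Fin n → ℝ) :
    familyCharFn V r = Complex.exp (⟪V, generator W r⟫_ℂ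
      + (-(‖generator W r‖ : ℂ) ^ 2 - ⟪V, generator W r⟫_ℂ ^ 2) / 2) := by
  have h2 := hasDerivAt_deriv_familyCharFn hW r 0
  rw [tsum_neg, tsum_inner_displacement_zero, inner_self_eq_norm_sq_to_K] at h2
  have h3 := eq_exp_of_scaling ha ha1 (φ := fun t : ℝ => familyCharFn V (t • r))
    (familyCharFn_zero hV r) (fun t => by simpa only [smul_smul] using h (t • r))
    (Eventually.of_forall (hasDerivAt_familyCharFn hW r)) h2 1
  simpa only [tsum_inner_displacement_zero, one_smul, Complex.ofReal_one, mul_one, one_pow,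
    Complex.coe_algebraMap] using h3

theorem Omega_mulVec_Omega_mulVec (r : Fin n ⊕ Fin n → ℝ) : Omega n *ᵥ (Omega n *ᵥ r) = -r := by
  ext j
  rcases j with a | a
  · rw [Omega_mulVec_inl, Omega_mulVec_inr]; rfl
  · rw [Omega_mulVec_inr, Omega_mulVec_inl]; rfl

theorem dotProduct_Omega_mulVec (r m : Fin n ⊕ Fin n → ℝ) :
    r ⬝ᵥ (Omega n *ᵥ m) = -((Omega n *ᵥ r) ⬝ᵥ m) := by
  simp only [dotProduct, Fintype.sum_sum_type, Omega_mulVec_inl, Omega_mulVec_inr]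
  rw [neg_add, add_comm, ← Finset.sum_neg_distrib, ← Finset.sum_neg_distrib]
  congr 1 <;> exact Finset.sum_congr rfl fun a _ => by ring

theorem generator_neg_Omega_single (W : Fin n ⊕ Fin n → Families ι n) (j : Fin n ⊕ Fin n) :
    generator W (-(Omega n *ᵥ Pi.single j 1)) = -Complex.I • W j := by
  rw [generator, Matrix.mulVec_neg, Omega_mulVec_Omega_mulVec, neg_neg]
  congr 1
  rw [Finset.sum_eq_single j] <;> simp +contextual

/-- First moments are real: `⟨D_{t r} v, v⟩` is the complex conjugate of `⟨v, D_{t r} v⟩`. -/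
theorem inner_quadrature_im_eq_zero (hW : ∀ i, IsQuadratureImage (V i) fun j => W j i)
    (j : Fin n ⊕ Fin n) : (⟪V, W j⟫_ℂ).im = 0 := by
  set r : Fin n ⊕ Fin n → ℝ := -(Omega n *ᵥ Pi.single j 1)
  have hgen : generator W r = -Complex.I • W j := generator_neg_Omega_single W j
  have h := hasDerivAt_familyCharFn_zero hW r
  have h1 : HasDerivAt (fun t : ℝ => familyCharFn V ((-t) • r)) (-⟪V, generator W r⟫_ℂ) 0 := by
    have h0 : HasDerivAt (fun t : ℝ => familyCharFn V (t • r)) ⟪V, generator W r⟫_ℂ (-(0 : ℝ)) := by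
      simpa using h
    simpa [Function.comp_def] using
      HasDerivAt.scomp (h := fun s : ℝ => -s) (0 : ℝ) h0 (hasDerivAt_neg (0 : ℝ))
  have h2 : HasDerivAt (fun t : ℝ => familyCharFn V ((-t) • r))
      ((starRingEnd ℂ) ⟪V, generator W r⟫_ℂ) 0 := by
    refine h.star.congr_of_eventuallyEq (Eventually.of_forall fun t => ?_)
    simp only [familyCharFn, ← inner_displacement_smul]
    change _ = (starRingEnd ℂ) _
    rw [Complex.conj_tsum]
    exact tsum_congr fun i => (inner_conj_symm _ _).symm
  have h3 := congrArg Complex.re (h1.unique h2)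
  rw [hgen, inner_smul_right] at h3
  generalize ⟪V, W j⟫_ℂ = z at h3 ⊢
  simp only [neg_mul, neg_neg, map_neg, map_mul, Complex.conj_I, Complex.mul_re, Complex.I_re,
    Complex.I_im, zero_mul, one_mul, zero_sub, Complex.conj_im] at h3
  linarith

theorem inner_generator (r : Fin n ⊕ Fin n → ℝ) :
    ⟪V, generator W r⟫_ℂ = -Complex.I * ∑ j, ((Omega n *ᵥ r) j : ℂ) * ⟪V, W j⟫_ℂ := by
  simp only [generator, inner_smul_right, inner_sum]

/-- The covariance matrix, in the normalization in which the vacuum has `V = 1`. -/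
def covariance (V : Families ι n) (W : Fin n ⊕ Fin n → Families ι n) :
    Matrix (Fin n ⊕ Fin n) (Fin n ⊕ Fin n) ℝ :=
  fun j l => 2 * ((⟪W j, W l⟫_ℂ).re - (⟪V, W j⟫_ℂ).re * (⟪V, W l⟫_ℂ).re)

theorem dotProduct_covariance (s : Fin n ⊕ Fin n → ℝ) :
    s ⬝ᵥ (covariance V W *ᵥ s)
      = 2 * (‖∑ j, (s j : ℂ) • W j‖ ^ 2 - (∑ j, s j * (⟪V, W j⟫_ℂ).re) ^ 2) := by
  have h1 : ‖∑ j, (s j : ℂ) • W j‖ ^ 2 = ∑ j, ∑ l, s j * s l * (⟪W j, W l⟫_ℂ).re := by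
    rw [← inner_self_eq_norm_sq (𝕜 := ℂ)]
    change (⟪∑ j, (s j : ℂ) • W j, ∑ j, (s j : ℂ) • W j⟫_ℂ).re = _
    simp only [sum_inner, inner_sum, inner_smul_left, inner_smul_right, Complex.conj_ofReal,
      Complex.re_sum, Complex.re_ofReal_mul, Finset.mul_sum]
    rw [Finset.sum_comm]
    exact Finset.sum_congr rfl fun j _ => Finset.sum_congr rfl fun l _ => by ring
  rw [h1, sq, Finset.sum_mul_sum]
  simp only [dotProduct, Matrix.mulVec, covariance, Finset.mul_sum, ← Finset.sum_sub_distrib]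
  exact Finset.sum_congr rfl fun j _ => Finset.sum_congr rfl fun l _ => by ring

theorem posSemidef_covariance (hV : ‖V‖ = 1) : (covariance V W).PosSemidef := by
  refine Matrix.PosSemidef.of_dotProduct_mulVec_nonneg ?_ fun s => ?_
  · ext j l
    simp only [Matrix.conjTranspose_apply, covariance, star_trivial]
    rw [← inner_conj_symm (W l) (W j), Complex.conj_re]
    ring
  · rw [star_trivial, dotProduct_covariance]
    have h : (⟪V, ∑ j, (s j : ℂ) • W j⟫_ℂ).re = ∑ j, s j * (⟪V, W j⟫_ℂ).re := by
      simp only [inner_sum, inner_smul_right, Complex.re_sum, Complex.re_ofReal_mul]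
    have h1 : |∑ j, s j * (⟪V, W j⟫_ℂ).re| ≤ ‖∑ j, (s j : ℂ) • W j‖ := by
      rw [← h]
      refine (Complex.abs_re_le_norm _).trans ((norm_inner_le_norm _ _).trans ?_)
      rw [hV, one_mul]
    have h2 := pow_le_pow_left₀ (abs_nonneg _) h1 2
    rw [sq_abs] at h2
    linarith

/-- A characteristic function with finite second moments which solves the scaling equation is the
Gaussian with the same first and second moments. -/
theorem familyCharFn_eq_gaussian (hV : ‖V‖ = 1)
    (hW : ∀ i, IsQuadratureImage (V i) fun j => W j i) {κ : Type*} [Fintype κ] {a : κ → ℝ}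
    (ha : ∑ b, a b ^ 2 = 1) (ha1 : ∀ b, |a b| < 1)
    (h : ∀ r, familyCharFn V r = ∏ b, familyCharFn V (a b • r)) (r : Fin n ⊕ Fin n → ℝ) :
    familyCharFn V r = Complex.exp
      (((-(1 / 4) * ((Omega n *ᵥ r) ⬝ᵥ (covariance V W *ᵥ (Omega n *ᵥ r))) : ℝ) : ℂ)
        + Complex.I * ((r ⬝ᵥ (Omega n *ᵥ fun j => (⟪V, W j⟫_ℂ).re) : ℝ) : ℂ)) := by
  rw [familyCharFn_eq_exp hV hW ha ha1 h r]
  have hre : ∀ j, ⟪V, W j⟫_ℂ = ((⟪V, W j⟫_ℂ).re : ℂ) := fun j =>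
    Complex.ext (by simp) (by simp [inner_quadrature_im_eq_zero hW j])
  have h1 : ⟪V, generator W r⟫_ℂ
      = Complex.I * ((r ⬝ᵥ (Omega n *ᵥ fun j => (⟪V, W j⟫_ℂ).re) : ℝ) : ℂ) := by
    rw [inner_generator, dotProduct_Omega_mulVec, dotProduct,
      Finset.sum_congr rfl fun j _ => by rw [hre j]]
    push_cast
    ring
  have h2 : ‖generator W r‖ = ‖∑ j, ((Omega n *ᵥ r) j : ℂ) • W j‖ := by
    rw [generator, norm_smul]
    simp
  rw [h1, h2, dotProduct_covariance, dotProduct_Omega_mulVec, dotProduct]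
  congr 1
  rw [mul_pow, Complex.I_sq]
  push_cast
  ring

end Moments

/-! ### Finite second moments of pure states -/

/-- A second difference of a `C²` function at `0` is asymptotic to its second derivative. -/
theorem exists_second_difference_le {φ φ' φ'' : ℝ → ℂ} (h1 : ∀ t, HasDerivAt φ (φ' t) t)
    (h2 : ∀ t, HasDerivAt φ' (φ'' t) t) (h3 : Continuous φ'') {ε : ℝ} (hε : 0 < ε) :
    ∃ δ > 0, ∀ s t : ℝ, |s| < δ → |t| < δ →
      ‖φ (s - t) - φ s - φ (-t) + φ 0 + φ'' 0 * (s * t)‖ ≤ ε * (|s| * |t|) := by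
  have h4 : ∀ᶠ x in 𝓝 (0 : ℝ), ‖φ'' x - φ'' 0‖ < ε :=
    ((h3.sub continuous_const).norm).continuousAt.tendsto.eventually_lt_const (by simpa using hε)
  obtain ⟨δ, hδ, hball⟩ := Metric.eventually_nhds_iff_ball.1 h4
  -- `φ'` is almost linear near `0`
  have h5 : ∀ x ∈ Metric.ball (0 : ℝ) δ, ∀ y ∈ Metric.ball (0 : ℝ) δ,
      ‖(φ' y - φ'' 0 * y) - (φ' x - φ'' 0 * x)‖ ≤ ε * ‖y - x‖ := fun x hx y hy => by
    refine (convex_ball (0 : ℝ) δ).norm_image_sub_le_of_norm_hasDerivWithin_le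
      (f := fun y : ℝ => φ' y - φ'' 0 * y) (f' := fun y => φ'' y - φ'' 0) (fun z _ => ?_)
      (fun z hz => (hball z hz).le) hx hy
    have hid : HasDerivAt (fun t : ℝ => (t : ℂ)) 1 z := Complex.ofRealCLM.hasDerivAt
    exact (((h2 z).sub (hid.const_mul (φ'' 0))).congr_deriv (by simp)).hasDerivWithinAt
  refine ⟨δ / 2, by positivity, fun s t hs ht => ?_⟩
  have h6 := (convex_ball (0 : ℝ) (δ / 2)).norm_image_sub_le_of_norm_hasDerivWithin_le
      (f := fun s : ℝ => φ (s - t) - φ s + φ'' 0 * (s * t))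
      (f' := fun s => φ' (s - t) - φ' s + φ'' 0 * t) (C := ε * |t|) (x := 0) (y := s)
      (fun z _ => ?_) (fun z hz => ?_) (by simpa using hδ) (by simpa using hs)
  · simp only [Real.norm_eq_abs, sub_zero, zero_sub, Complex.ofReal_zero, zero_mul, mul_zero,
      add_zero] at h6
    calc _ = ‖φ (s - t) - φ s + φ'' 0 * (s * t) - (φ (-t) - φ 0)‖ := by congr 1; ring
      _ ≤ _ := h6
      _ = _ := by ring
  · have hid : HasDerivAt (fun t : ℝ => (t : ℂ)) 1 z := Complex.ofRealCLM.hasDerivAt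
    have h7 : HasDerivAt (fun s : ℝ => φ (s - t)) (φ' (z - t)) z := (h1 (z - t)).comp_sub_const z t
    exact (((h7.sub (h1 z)).add ((hid.mul_const (t : ℂ)).const_mul (φ'' 0))).congr_deriv
      (by simp)).hasDerivWithinAt
  · rw [mem_ball_zero_iff, Real.norm_eq_abs] at hz
    have h8 := h5 z (by rw [mem_ball_zero_iff, Real.norm_eq_abs]; linarith) (z - t) (by
      rw [mem_ball_zero_iff, Real.norm_eq_abs]
      exact (abs_sub _ _).trans_lt (by linarith))
    simp only [Real.norm_eq_abs, sub_sub_cancel_left, abs_neg] at h8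
    calc _ = ‖(φ' (z - t) - φ'' 0 * ((z - t : ℝ) : ℂ)) - (φ' z - φ'' 0 * z)‖ := by
          congr 1; push_cast; ring
      _ ≤ _ := h8

/-- If `t ↦ ⟨ψ, D_{t r} ψ⟩` is Gaussian, then the orbit `t ↦ D_{t r} ψ` is differentiable: the inner
products of its difference quotients are second differences of the characteristic function, so the
difference quotients form a Cauchy family. -/
theorem differentiableAt_displacement_of_gaussian {n : ℕ} {ψ : Modes n} {r : Fin n ⊕ Fin n → ℝ}
    {μ ν : ℂ} (h : ∀ t : ℝ, ⟪ψ, displacement (t • r) ψ⟫_ℂ = Complex.exp (μ * t + ν * t ^ 2)) :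
    DifferentiableAt ℝ (fun t : ℝ => displacement (t • r) ψ) 0 := by
  set φ : ℝ → ℂ := fun t => Complex.exp (μ * t + ν * t ^ 2) with hφ
  have hd1 : ∀ t, HasDerivAt φ ((μ + 2 * ν * t) * φ t) t := fun t => by
    have hid : HasDerivAt (fun t : ℝ => (t : ℂ)) 1 t := Complex.ofRealCLM.hasDerivAt
    refine ((hid.const_mul μ).add ((hid.pow 2).const_mul ν)).cexp.congr_deriv ?_
    simp only [hφ, Pi.add_apply, Pi.pow_apply]
    push_cast
    ring
  have hd2 : ∀ t, HasDerivAt (fun t => (μ + 2 * ν * t) * φ t)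
      ((2 * ν) * φ t + (μ + 2 * ν * t) * ((μ + 2 * ν * t) * φ t)) t := fun t => by
    have hid : HasDerivAt (fun t : ℝ => (t : ℂ)) 1 t := Complex.ofRealCLM.hasDerivAt
    refine (((hid.const_mul (2 * ν)).const_add μ).mul (hd1 t)).congr_deriv ?_
    ring
  set κ : ℂ := (2 * ν) * φ 0 + (μ + 2 * ν * (0 : ℝ)) * ((μ + 2 * ν * (0 : ℝ)) * φ 0)
  set x : ℝ → Modes n := fun t => t⁻¹ • (displacement (t • r) ψ - ψ) with hx
  have hinner : ∀ s t : ℝ, ⟪x t, x s⟫_ℂ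
      = ((t⁻¹ * s⁻¹ : ℝ) : ℂ) * (φ (s - t) - φ s - φ (-t) + φ 0) := fun s t => by
    have e1 : ⟪displacement (t • r) ψ, displacement (s • r) ψ⟫_ℂ = φ (s - t) := by
      rw [inner_displacement_smul, ← displacement_add_smul, h]
      simp only [hφ]
      congr 2 <;> push_cast <;> ring
    have e2 : ⟪displacement (t • r) ψ, ψ⟫_ℂ = φ (-t) := by rw [inner_displacement_smul, h]
    have e3 : ⟪ψ, ψ⟫_ℂ = φ 0 := by
      have := h 0
      rwa [zero_smul, displacement_zero] at this
    have e4 : ⟪ψ, displacement (s • r) ψ⟫_ℂ = φ s := h s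
    have hxe : ∀ t, x t = ((t⁻¹ : ℝ) : ℂ) • (displacement (t • r) ψ - ψ) := fun t =>
      (Complex.coe_smul _ _).symm
    rw [hxe, hxe]
    simp only [inner_smul_left, inner_smul_right, inner_sub_left,
      inner_sub_right, e1, e2, e3, e4, Complex.conj_ofReal]
    push_cast
    ring
  have hcauchy : Cauchy (map x (𝓝[≠] 0)) := by
    refine Metric.cauchy_iff.2 ⟨inferInstance, fun ε hε => ?_⟩
    obtain ⟨δ, hδ, hb⟩ := exists_second_difference_le hd1 hd2 (by fun_prop)
      (ε := ε ^ 2 / 8) (by positivity)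
    have hb' : ∀ s t : ℝ, s ≠ 0 → t ≠ 0 → |s| < δ → |t| < δ →
        ‖⟪x t, x s⟫_ℂ + κ‖ ≤ ε ^ 2 / 8 := fun s t hs0 ht0 hs ht => by
      have h1 := hb s t hs ht
      have hst : (0 : ℝ) < |s| * |t| := by positivity
      have e : ⟪x t, x s⟫_ℂ + κ = ((t⁻¹ * s⁻¹ : ℝ) : ℂ) *
          (φ (s - t) - φ s - φ (-t) + φ 0 + κ * (s * t)) := by
        rw [hinner, mul_add]
        have hs0' : (s : ℂ) ≠ 0 := by exact_mod_cast hs0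
        have ht0' : (t : ℂ) ≠ 0 := by exact_mod_cast ht0
        push_cast
        field_simp
      rw [e, norm_mul, Complex.norm_real, Real.norm_eq_abs, abs_mul, abs_inv, abs_inv]
      calc _ ≤ (|t|⁻¹ * |s|⁻¹) * (ε ^ 2 / 8 * (|s| * |t|)) := by gcongr
        _ = _ := by field_simp
    refine ⟨x '' ({0}ᶜ ∩ Metric.ball 0 δ), image_mem_map (inter_mem self_mem_nhdsWithin
      (nhdsWithin_le_nhds (Metric.ball_mem_nhds 0 hδ))), ?_⟩
    rintro _ ⟨t, ⟨ht0, ht⟩, rfl⟩ _ ⟨s, ⟨hs0, hs⟩, rfl⟩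
    rw [mem_ball_zero_iff, Real.norm_eq_abs] at ht hs
    have hsq : ‖x t - x s‖ ^ 2 ≤ ε ^ 2 / 2 := by
      rw [← inner_self_eq_norm_sq (𝕜 := ℂ)]
      have e : ⟪x t - x s, x t - x s⟫_ℂ = (⟪x t, x t⟫_ℂ + κ) - (⟪x t, x s⟫_ℂ + κ)
          - (⟪x s, x t⟫_ℂ + κ) + (⟪x s, x s⟫_ℂ + κ) := by
        simp only [inner_sub_left, inner_sub_right]
        ring
      refine (RCLike.re_le_norm _).trans ?_
      rw [e]
      have b1 := hb' t t ht0 ht0 ht ht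
      have b2 := hb' s t hs0 ht0 hs ht
      have b3 := hb' t s ht0 hs0 ht hs
      have b4 := hb' s s hs0 hs0 hs hs
      refine (norm_add_le _ _).trans ?_
      have n1 := norm_sub_le ((⟪x t, x t⟫_ℂ + κ) - (⟪x t, x s⟫_ℂ + κ)) (⟪x s, x t⟫_ℂ + κ)
      have n2 := norm_sub_le (⟪x t, x t⟫_ℂ + κ) (⟪x t, x s⟫_ℂ + κ)
      linarith
    rw [dist_eq_norm]
    exact lt_of_pow_lt_pow_left₀ 2 hε.le (by nlinarith [pow_pos hε 2])
  obtain ⟨d, hd⟩ := cauchy_iff_exists_le_nhds.1 hcauchy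
  refine HasDerivAt.differentiableAt (f' := d) ?_
  rw [hasDerivAt_iff_tendsto_slope_zero]
  have hd' : Tendsto x (𝓝[≠] 0) (𝓝 d) := hd
  simpa [hx, displacement_zero] using hd'

/-- The displacements along the direction of `p_a` are the phases `exp (-i t x_a)`, so if the orbit of
`ψ` is differentiable then `x_a ψ` is in `L²`. -/
theorem mem_position_domain_of_differentiableAt {n : ℕ} {ψ : Modes n} {a : Fin n}
    (h : DifferentiableAt ℝ
      (fun t : ℝ => displacement (t • (Pi.single (Sum.inr a) 1 : Fin n ⊕ Fin n → ℝ)) ψ) 0) :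
    ψ ∈ (position a).domain := by
  set r : Fin n ⊕ Fin n → ℝ := Pi.single (Sum.inr a) 1 with hr
  obtain ⟨d, hd⟩ : ∃ d, HasDerivAt (fun t : ℝ => displacement (t • r) ψ) d 0 := ⟨_, h.hasDerivAt⟩
  rw [hasDerivAt_iff_tendsto_slope_zero] at hd
  simp only [zero_add, zero_smul, displacement_zero] at hd
  have hu : Tendsto (fun N : ℕ => (1 / ((N : ℝ) + 1))) atTop (𝓝[≠] 0) :=
    tendsto_nhdsWithin_iff.2 ⟨tendsto_one_div_add_atTop_nhds_zero_nat,
      Eventually.of_forall fun N => by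
        have : (0 : ℝ) < 1 / ((N : ℝ) + 1) := by positivity
        exact this.ne'⟩
  -- along a subsequence the difference quotients converge almost everywhere
  obtain ⟨ns, hns, hae⟩ := (tendstoInMeasure_of_tendsto_Lp (hd.comp hu)).exists_seq_tendsto_ae
  -- the limit of the difference quotients is `-i xₐ ψ` almost everywhere
  have hlim : d =ᵐ[volume] fun x => -Complex.I * (x a : ℂ) * ψ x := by
    have hD : ∀ N : ℕ, ∀ᵐ x : Fin n → ℝ, ((1 / ((N : ℝ) + 1))⁻¹ •
        (displacement ((1 / ((N : ℝ) + 1)) • r) ψ - ψ) : Modes n) x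
        = (1 / ((N : ℝ) + 1))⁻¹ • (Complex.exp (Complex.I * ((-((1 / ((N : ℝ) + 1)) * x a) : ℝ) : ℂ))
          - 1) * ψ x := fun N => by
      set t : ℝ := 1 / ((N : ℝ) + 1)
      filter_upwards [Lp.coeFn_smul t⁻¹ (displacement (t • r) ψ - ψ),
        Lp.coeFn_sub (displacement (t • r) ψ) ψ, coeFn_displacement (t • r) ψ] with x h1 h2 h3
      have e1 : (t • r) ∘ Sum.inl = 0 := by ext b; simp [hr]
      have e2 : (t • r) ∘ Sum.inr = t • Pi.single a 1 := by ext b; simp [hr, Pi.single_apply]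
      rw [h1, Pi.smul_apply, h2, Pi.sub_apply, h3, e1, e2]
      simp only [smul_zero, add_zero, smul_dotProduct, single_dotProduct, one_mul, smul_eq_mul,
        smul_mul_assoc]
      congr 1
      ring
    filter_upwards [hae, ae_all_iff.2 hD] with x h1 h2
    have h3 : HasDerivAt (fun t : ℝ => Complex.exp (Complex.I * ((-(t * x a) : ℝ) : ℂ)))
        (-Complex.I * (x a : ℂ)) 0 := by
      have hin : HasDerivAt (fun t : ℝ => -(t * x a)) (-(x a)) 0 := by
        exact ((hasDerivAt_id (0 : ℝ)).mul_const (x a)).neg.congr_deriv (by simp)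
      simpa using (hin.ofReal_comp.const_mul Complex.I).cexp
    rw [hasDerivAt_iff_tendsto_slope_zero] at h3
    have h4 := ((h3.comp (hu.comp hns.tendsto_atTop)).mul_const (ψ x))
    refine tendsto_nhds_unique h1 (h4.congr fun N => ?_)
    simp only [Function.comp_apply] at h2 ⊢
    rw [h2]
    simp
  have hmem : MemLp (fun x => Complex.I * d x) 2 volume := (Lp.memLp d).const_mul Complex.I
  refine hmem.ae_eq ?_
  filter_upwards [hlim] with x hx
  rw [hx, ← mul_assoc, ← mul_assoc]
  simp

theorem mem_momentum_domain_of_differentiableAt {n : ℕ} {ψ : Modes n} {a : Fin n}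
    (h : DifferentiableAt ℝ
      (fun t : ℝ => displacement (t • (Pi.single (Sum.inl a) 1 : Fin n ⊕ Fin n → ℝ)) ψ) 0) :
    ψ ∈ (momentum a).domain := by
  have e : ∀ t : ℝ, displacement (t • (Pi.single (Sum.inl a) 1 : Fin n ⊕ Fin n → ℝ)) ψ
      = translate (Pi.single a t) ψ := fun t => by
    have e1 : (t • (Pi.single (Sum.inl a) 1 : Fin n ⊕ Fin n → ℝ)) ∘ Sum.inl = Pi.single a t := by
      ext b; simp [Pi.single_apply]
    have e2 : (t • (Pi.single (Sum.inl a) 1 : Fin n ⊕ Fin n → ℝ)) ∘ Sum.inr = 0 := by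
      ext b; simp
    refine Lp.ext ?_
    filter_upwards [coeFn_displacement (t • (Pi.single (Sum.inl a) 1 : Fin n ⊕ Fin n → ℝ)) ψ,
      coeFn_translate (Pi.single a t) ψ] with x h1 h2
    rw [h1, h2, e1, e2]
    simp
  simp only [e] at h
  exact h

theorem opSqrt_pureState {n : ℕ} {ψ : Modes n} (hψ : ‖ψ‖ = 1) :
    opSqrt (pureState ψ) = pureState ψ := by
  refine CFC.sqrt_unique ?_
    ((ContinuousLinearMap.nonneg_iff_isPositive _).2 (isDensityOperator_pureState hψ).isPositive)
  refine ContinuousLinearMap.ext fun φ => ?_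
  rw [mul_apply_eq_comp]
  simp [pureState, rankOne_apply, inner_self_eq_norm_sq_to_K, hψ]

theorem sqrtVec_pureState {n : ℕ} {ψ : Modes n} (hψ : ‖ψ‖ = 1) (i : basisIndex n) :
    sqrtVec (pureState ψ) i = ⟪ψ, basis n i⟫_ℂ • ψ := by
  rw [sqrtVec, opSqrt_pureState hψ, pureState, rankOne_apply]

theorem hasFiniteSecondMoments_pureState {n : ℕ} {ψ : Modes n} (hψ : ‖ψ‖ = 1)
    (h : ∀ j, ψ ∈ (quadrature j).domain) : HasFiniteSecondMoments (pureState ψ) := by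
  intro j
  refine ⟨fun i => ?_, ?_⟩
  · rw [sqrtVec_pureState hψ]
    exact Submodule.smul_mem _ _ (h j)
  · have hs := (summable_sqrtVec (isDensityOperator_pureState hψ)).mul_right
      (‖quadrature j ⟨ψ, h j⟩‖ ^ 2)
    refine hs.congr fun i => ?_
    have e : ∀ h', quadrature j ⟨sqrtVec (pureState ψ) i, h'⟩
        = ⟪ψ, basis n i⟫_ℂ • quadrature j ⟨ψ, h j⟩ := fun h' => by
      rw [← LinearPMap.map_smul]
      congr 1
      exact Subtype.ext (sqrtVec_pureState hψ i)
    rw [e, sqrtVec_pureState hψ, norm_smul, norm_smul, hψ, mul_one, mul_pow]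

/-- A pure state with finite first moments has finite second moments. -/
theorem hasFiniteSecondMoments_of_hasMean {n : ℕ} {ψ : Modes n} (hψ : ‖ψ‖ = 1)
    {m : Fin n ⊕ Fin n → ℝ} (h : HasMean (pureState ψ) m) :
    HasFiniteSecondMoments (pureState ψ) := by
  refine hasFiniteSecondMoments_pureState hψ fun j => ?_
  obtain ⟨i, hi⟩ : ∃ i, ⟪ψ, basis n i⟫_ℂ ≠ 0 := by
    by_contra! h0
    have h1 := (basis n).hasSum_inner_mul_inner ψ ψ
    simp only [h0, zero_mul] at h1
    have h2 := h1.unique hasSum_zero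
    rw [inner_self_eq_zero] at h2
    simp [h2] at hψ
  obtain ⟨hdom, -⟩ := h j
  have h1 := hdom i
  rw [sqrtVec_pureState hψ] at h1
  exact (Submodule.smul_mem_iff _ hi).1 h1

/-! ### Reflections generate orthogonal groups -/

theorem transpose_mul_of_orthogonal {k : ℕ} (o : Matrix.orthogonalGroup (Fin k) ℝ) :
    (o : Matrix (Fin k) (Fin k) ℝ)ᵀ * (o : Matrix (Fin k) (Fin k) ℝ) = 1 :=
  (Matrix.mem_orthogonalGroup_iff' (Fin k) ℝ).1 o.2

theorem dotProduct_mulVec_mulVec_of_orthogonal {k : ℕ} (o : Matrix.orthogonalGroup (Fin k) ℝ)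
    (x y : Fin k → ℝ) :
    ((o : Matrix (Fin k) (Fin k) ℝ) *ᵥ x) ⬝ᵥ ((o : Matrix (Fin k) (Fin k) ℝ) *ᵥ y) = x ⬝ᵥ y := by
  rw [Matrix.dotProduct_mulVec, ← Matrix.mulVec_transpose, Matrix.mulVec_mulVec,
    transpose_mul_of_orthogonal, Matrix.one_mulVec]

/-- The matrix of the reflection in the hyperplane orthogonal to `v`; it is `1` if `v = 0`. -/
def reflectionMatrix {k : ℕ} (v : Fin k → ℝ) : Matrix (Fin k) (Fin k) ℝ :=
  1 - (2 / (v ⬝ᵥ v)) • Matrix.vecMulVec v v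

theorem reflectionMatrix_mulVec {k : ℕ} (v x : Fin k → ℝ) :
    reflectionMatrix v *ᵥ x = x - (2 / (v ⬝ᵥ v) * (v ⬝ᵥ x)) • v := by
  rw [reflectionMatrix, Matrix.sub_mulVec, Matrix.one_mulVec, Matrix.smul_mulVec,
    Matrix.vecMulVec_mulVec, op_smul_eq_smul, smul_smul]

theorem reflectionMatrix_mem {k : ℕ} (v : Fin k → ℝ) :
    reflectionMatrix v ∈ Matrix.orthogonalGroup (Fin k) ℝ := by
  rw [Matrix.mem_orthogonalGroup_iff]
  have ht : (reflectionMatrix v)ᵀ = reflectionMatrix v := by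
    simp [reflectionMatrix, Matrix.transpose_vecMulVec]
  change reflectionMatrix v * (reflectionMatrix v)ᵀ = 1
  rw [ht]
  refine Matrix.ext_of_mulVec_single fun i => ?_
  rw [← Matrix.mulVec_mulVec, Matrix.one_mulVec, reflectionMatrix_mulVec, reflectionMatrix_mulVec]
  rcases eq_or_ne v 0 with rfl | hv
  · simp
  · have h : v ⬝ᵥ v ≠ 0 := fun h => hv (dotProduct_self_eq_zero.1 h)
    rw [dotProduct_sub, dotProduct_smul, smul_eq_mul, sub_sub, ← add_smul]
    rw [show 2 / (v ⬝ᵥ v) * (v ⬝ᵥ Pi.single i 1) + 2 / (v ⬝ᵥ v) *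
      (v ⬝ᵥ Pi.single i 1 - 2 / (v ⬝ᵥ v) * (v ⬝ᵥ Pi.single i 1) * (v ⬝ᵥ v)) = 0 by
        field_simp; ring]
    simp

/-- The reflection in the hyperplane orthogonal to `v`, as an orthogonal matrix. -/
def householder {k : ℕ} (v : Fin k → ℝ) : Matrix.orthogonalGroup (Fin k) ℝ :=
  ⟨reflectionMatrix v, reflectionMatrix_mem v⟩

theorem householder_mulVec {k : ℕ} (v x : Fin k → ℝ) :
    (householder v : Matrix (Fin k) (Fin k) ℝ) *ᵥ x = x - (2 / (v ⬝ᵥ v) * (v ⬝ᵥ x)) • v :=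
  reflectionMatrix_mulVec v x

theorem householder_mulVec_of_orthogonal {k : ℕ} {v x : Fin k → ℝ} (h : v ⬝ᵥ x = 0) :
    (householder v : Matrix (Fin k) (Fin k) ℝ) *ᵥ x = x := by
  rw [householder_mulVec, h, mul_zero, zero_smul, sub_zero]

theorem orthogonal_ext {k : ℕ} {o o' : Matrix.orthogonalGroup (Fin k) ℝ}
    (h : ∀ x, (o : Matrix (Fin k) (Fin k) ℝ) *ᵥ x = (o' : Matrix (Fin k) (Fin k) ℝ) *ᵥ x) :
    o = o' :=
  Subtype.ext (Matrix.ext_of_mulVec_single fun _ => h _)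

theorem householder_zero {k : ℕ} : householder (0 : Fin k → ℝ) = 1 :=
  orthogonal_ext fun x => by rw [householder_mulVec]; simp

theorem householder_smul {k : ℕ} {c : ℝ} (hc : c ≠ 0) (v : Fin k → ℝ) :
    householder (c • v) = householder v := by
  refine orthogonal_ext fun x => ?_
  rw [householder_mulVec, householder_mulVec, smul_smul, smul_dotProduct, smul_dotProduct,
    dotProduct_smul]
  congr 2
  simp only [smul_eq_mul]
  rcases eq_or_ne (v ⬝ᵥ v) 0 with h | h
  · simp [h]
  · field_simp

/-- Conjugating a reflection by `o` gives the reflection in the image of its hyperplane. -/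
theorem householder_mulVec_eq_conj {k : ℕ} (o : Matrix.orthogonalGroup (Fin k) ℝ)
    (v : Fin k → ℝ) : householder ((o : Matrix (Fin k) (Fin k) ℝ) *ᵥ v) * o = o * householder v := by
  refine orthogonal_ext fun x => ?_
  change ((householder ((o : Matrix (Fin k) (Fin k) ℝ) *ᵥ v) : Matrix (Fin k) (Fin k) ℝ)
    * (o : Matrix (Fin k) (Fin k) ℝ)) *ᵥ x
    = ((o : Matrix (Fin k) (Fin k) ℝ) * (householder v : Matrix (Fin k) (Fin k) ℝ)) *ᵥ x
  rw [← Matrix.mulVec_mulVec, ← Matrix.mulVec_mulVec, householder_mulVec, householder_mulVec,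
    dotProduct_mulVec_mulVec_of_orthogonal, dotProduct_mulVec_mulVec_of_orthogonal,
    Matrix.mulVec_sub, Matrix.mulVec_smul]

/-- Vectors of the same length are exchanged by the reflection in their difference. -/
theorem householder_sub_mulVec {k : ℕ} {u v : Fin k → ℝ} (h : u ⬝ᵥ u = v ⬝ᵥ v) :
    (householder (v - u) : Matrix (Fin k) (Fin k) ℝ) *ᵥ u = v := by
  rw [householder_mulVec]
  have h1 : (v - u) ⬝ᵥ (v - u) = -2 * ((v - u) ⬝ᵥ u) := by
    simp only [sub_dotProduct, dotProduct_sub, dotProduct_comm u v]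
    linarith
  rcases eq_or_ne ((v - u) ⬝ᵥ u) 0 with h0 | h0
  · rw [h0, mul_zero, dotProduct_self_eq_zero] at h1
    rw [h1, sub_eq_zero.1 h1]
    simp
  · rw [h1, show 2 / (-2 * ((v - u) ⬝ᵥ u)) * ((v - u) ⬝ᵥ u) = -1 by field_simp]
    simp

/-- The theorem of Cartan and Dieudonné for the stabilizer of a vector `e` in the orthogonal group:
it is generated by the reflections it contains. The proof multiplies `o` by reflections which
enlarge its space of fixed vectors. -/
theorem mem_of_householder_mem {k : ℕ} {H : Subgroup (Matrix.orthogonalGroup (Fin k) ℝ)}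
    {e : Fin k → ℝ} (h : ∀ v, v ⬝ᵥ e = 0 → householder v ∈ H)
    {o : Matrix.orthogonalGroup (Fin k) ℝ} (ho : (o : Matrix (Fin k) (Fin k) ℝ) *ᵥ e = e) :
    o ∈ H := by
  obtain ⟨m, hm⟩ : ∃ m, k ≤ Module.finrank ℝ (LinearMap.ker
      ((o : Matrix (Fin k) (Fin k) ℝ) - 1).mulVecLin) + m := ⟨k, Nat.le_add_left _ _⟩
  induction m generalizing o with
  | zero =>
    have h1 : LinearMap.ker ((o : Matrix (Fin k) (Fin k) ℝ) - 1).mulVecLin = ⊤ :=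
      Submodule.eq_top_of_finrank_eq (le_antisymm (Submodule.finrank_le _) (by simpa using hm))
    have h2 : o = 1 := orthogonal_ext fun x => by
      have h3 : x ∈ LinearMap.ker ((o : Matrix (Fin k) (Fin k) ℝ) - 1).mulVecLin := h1 ▸ Submodule.mem_top
      rw [LinearMap.mem_ker, Matrix.mulVecLin_apply, Matrix.sub_mulVec, sub_eq_zero] at h3
      exact h3
    exact h2 ▸ H.one_mem
  | succ m ih =>
    by_cases h1 : o = 1
    · exact h1 ▸ H.one_mem
    obtain ⟨x, hx⟩ : ∃ x, (o : Matrix (Fin k) (Fin k) ℝ) *ᵥ x ≠ x := by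
      by_contra! h2
      exact h1 (orthogonal_ext fun x => (h2 x).trans (Matrix.one_mulVec x).symm)
    set v : Fin k → ℝ := (o : Matrix (Fin k) (Fin k) ℝ) *ᵥ x - x with hv
    have hperp : ∀ y, (o : Matrix (Fin k) (Fin k) ℝ) *ᵥ y = y → v ⬝ᵥ y = 0 := fun y hy => by
      rw [hv, sub_dotProduct, sub_eq_zero]
      conv_lhs => rw [← hy]
      exact dotProduct_mulVec_mulVec_of_orthogonal o x y
    have hmul : ∀ y, ((householder v * o : Matrix.orthogonalGroup (Fin k) ℝ) :
        Matrix (Fin k) (Fin k) ℝ) *ᵥ y = (householder v : Matrix (Fin k) (Fin k) ℝ) *ᵥ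
          ((o : Matrix (Fin k) (Fin k) ℝ) *ᵥ y) := fun y => (Matrix.mulVec_mulVec _ _ _).symm
    have hfix : ∀ y, (o : Matrix (Fin k) (Fin k) ℝ) *ᵥ y = y →
        ((householder v * o : Matrix.orthogonalGroup (Fin k) ℝ) : Matrix (Fin k) (Fin k) ℝ) *ᵥ y
          = y := fun y hy => by
      rw [hmul, hy, householder_mulVec_of_orthogonal (hperp y hy)]
    have hfixx : ((householder v * o : Matrix.orthogonalGroup (Fin k) ℝ) :
        Matrix (Fin k) (Fin k) ℝ) *ᵥ x = x := by
      rw [hmul]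
      have h3 := householder_sub_mulVec (u := (o : Matrix (Fin k) (Fin k) ℝ) *ᵥ x) (v := x)
        (dotProduct_mulVec_mulVec_of_orthogonal o x x)
      rwa [← neg_sub, ← hv, ← neg_one_smul ℝ, householder_smul (by norm_num)] at h3
    have hlt : LinearMap.ker ((o : Matrix (Fin k) (Fin k) ℝ) - 1).mulVecLin
        < LinearMap.ker (((householder v * o : Matrix.orthogonalGroup (Fin k) ℝ) :
          Matrix (Fin k) (Fin k) ℝ) - 1).mulVecLin := by
      refine lt_of_le_of_ne (fun y hy => ?_) fun heq => hx ?_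
      · rw [LinearMap.mem_ker, Matrix.mulVecLin_apply, Matrix.sub_mulVec, Matrix.one_mulVec,
          sub_eq_zero] at hy ⊢
        exact hfix y hy
      · have h3 : x ∈ LinearMap.ker ((o : Matrix (Fin k) (Fin k) ℝ) - 1).mulVecLin := by
          rw [heq, LinearMap.mem_ker, Matrix.mulVecLin_apply, Matrix.sub_mulVec, Matrix.one_mulVec,
            hfixx, sub_self]
        rwa [LinearMap.mem_ker, Matrix.mulVecLin_apply, Matrix.sub_mulVec, Matrix.one_mulVec,
          sub_eq_zero] at h3
    have h4 := ih (o := householder v * o) (hfix e ho) (by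
      have := Submodule.finrank_lt_finrank_of_lt hlt
      omega)
    exact (H.mul_mem_cancel_left (h v (hperp e ho))).1 h4

/-! ### Removing the phase for pure states -/

theorem rotation_one (n k : ℕ) (Ψ : Copies n k) : rotation n 1 Ψ = Ψ := by
  refine Lp.ext ?_
  filter_upwards [coeFn_rotation 1 Ψ] with x hx
  rw [hx]
  congr 1
  funext b
  simp [rightMul, Matrix.one_apply]

theorem rotation_mul {n k : ℕ} (o o' : Matrix.orthogonalGroup (Fin k) ℝ) (Ψ : Copies n k) :
    rotation n (o * o') Ψ = rotation n o (rotation n o' Ψ) := by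
  refine Lp.ext ?_
  filter_upwards [coeFn_rotation (o * o') Ψ, coeFn_rotation o (rotation n o' Ψ),
    (measurePreserving_rightMul n (mul_transpose_of_orthogonal o)).quasiMeasurePreserving.ae
      (coeFn_rotation o' Ψ)] with x h1 h2 h3
  rw [h1, h2, h3]
  congr 1
  funext b
  simp only [rightMul, LinearMap.coe_mk, AddHom.coe_mk, Finset.smul_sum, smul_smul]
  rw [Finset.sum_comm]
  refine Finset.sum_congr rfl fun c _ => ?_
  rw [← Finset.sum_smul]
  congr 1
  change ((o : Matrix (Fin k) (Fin k) ℝ) * (o' : Matrix (Fin k) (Fin k) ℝ)) c b = _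
  rw [Matrix.mul_apply]
  exact Finset.sum_congr rfl fun d _ => mul_comm _ _

/-- The stabilizer of a vector of `L²(ℝ^{n × k})` in the orthogonal group. -/
def rotationStabilizer {n k : ℕ} (Ψ : Copies n k) : Subgroup (Matrix.orthogonalGroup (Fin k) ℝ) where
  carrier := {o | rotation n o Ψ = Ψ}
  mul_mem' {o o'} h h' := by
    change rotation n (o * o') Ψ = Ψ
    rw [rotation_mul, h', h]
  one_mem' := rotation_one n k Ψ
  inv_mem' {o} h := by
    change rotation n o⁻¹ Ψ = Ψ
    conv_lhs => rw [← show rotation n o Ψ = Ψ from h]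
    rw [← rotation_mul, inv_mul_cancel, rotation_one]

theorem mem_rotationStabilizer {n k : ℕ} {Ψ : Copies n k} {o : Matrix.orthogonalGroup (Fin k) ℝ} :
    o ∈ rotationStabilizer Ψ ↔ rotation n o Ψ = Ψ :=
  Iff.rfl

/-- The reflection in `e_i - e_j` exchanges two copies, so it fixes tensor powers. -/
theorem rotation_swap {n k : ℕ} {i j : Fin k} (hij : i ≠ j) (ψ : Modes n) :
    rotation n (householder (Pi.single i 1 - Pi.single j 1)) (vecTensorPow k ψ)
      = vecTensorPow k ψ := by
  have hentry : ∀ c b, (householder (Pi.single i 1 - Pi.single j 1 : Fin k → ℝ) :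
      Matrix (Fin k) (Fin k) ℝ) c b = if c = Equiv.swap i j b then 1 else 0 := fun c b => by
    have h := congrFun (householder_mulVec (Pi.single i 1 - Pi.single j 1 : Fin k → ℝ)
      (Pi.single b 1)) c
    rw [Matrix.mulVec_single_one, Matrix.col_apply] at h
    rw [h]
    have h2 : (Pi.single i 1 - Pi.single j 1 : Fin k → ℝ) ⬝ᵥ (Pi.single i 1 - Pi.single j 1) = 2 := by
      simp [hij, hij.symm]
      norm_num
    rw [h2]
    by_cases hbi : b = i
    · subst hbi
      simp [Pi.single_apply, hij]
    · by_cases hbj : b = j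
      · subst hbj
        simp [Pi.single_apply, hij.symm]
      · rw [Equiv.swap_apply_of_ne_of_ne hbi hbj]
        simp [Pi.single_apply, hbi, hbj]
  refine Lp.ext ?_
  filter_upwards [coeFn_rotation (householder (Pi.single i 1 - Pi.single j 1)) (vecTensorPow k ψ),
    (measurePreserving_rightMul n (mul_transpose_of_orthogonal
      (householder (Pi.single i 1 - Pi.single j 1)))).quasiMeasurePreserving.ae
      (coeFn_tensor fun _ => ψ), coeFn_tensor fun _ : Fin k => ψ] with x h1 h2 h3
  rw [h1]
  change tensor _ _ = tensor _ _
  rw [h2, h3, ← Equiv.prod_comp (Equiv.swap i j)]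
  refine Finset.prod_congr rfl fun b _ => ?_
  congr 1
  simp only [rightMul, LinearMap.coe_mk, AddHom.coe_mk, hentry, ite_smul, one_smul, zero_smul]
  simp

/-- If all `U_o` in the stabilizer of `e` fix `ψ^{⊗k}` up to a phase, and `e` has two equal
coordinates, then they fix `ψ^{⊗k}`: the reflections in this stabilizer are conjugate to an exchange
of two copies. -/
theorem rotation_eq_of_forall_smul {n k : ℕ} {ψ : Modes n} {e : Fin k → ℝ} {i j : Fin k}
    (hij : i ≠ j) (he : e i = e j)
    (h : ∀ o : Matrix.orthogonalGroup (Fin k) ℝ, (o : Matrix (Fin k) (Fin k) ℝ) *ᵥ e = e →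
      ∃ c : ℂ, rotation n o (vecTensorPow k ψ) = c • vecTensorPow k ψ)
    {o : Matrix.orthogonalGroup (Fin k) ℝ} (ho : (o : Matrix (Fin k) (Fin k) ℝ) *ᵥ e = e) :
    rotation n o (vecTensorPow k ψ) = vecTensorPow k ψ := by
  set Ψ := vecTensorPow k ψ with hΨ
  refine mem_of_householder_mem (H := rotationStabilizer Ψ) (fun v hv => ?_) ho
  rcases eq_or_ne v 0 with rfl | hv0
  · rw [householder_zero]
    exact Subgroup.one_mem _
  rcases eq_or_ne Ψ 0 with h0 | h0
  · rw [mem_rotationStabilizer, h0, map_zero]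
  set u : Fin k → ℝ := Pi.single i 1 - Pi.single j 1 with hu
  have hvv : 0 < v ⬝ᵥ v :=
    lt_of_le_of_ne (Finset.sum_nonneg fun _ _ => mul_self_nonneg _) fun h => hv0 (dotProduct_self_eq_zero.1 h.symm)
  set t : ℝ := Real.sqrt (2 / (v ⬝ᵥ v)) with ht
  have ht0 : 0 < t := Real.sqrt_pos.2 (by positivity)
  have huu : u ⬝ᵥ u = (t • v) ⬝ᵥ (t • v) := by
    have h1 : u ⬝ᵥ u = 2 := by
      simp [hu, hij, hij.symm]
      norm_num
    rw [h1, smul_dotProduct, dotProduct_smul, smul_eq_mul, smul_eq_mul, ← mul_assoc, ht,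
      Real.mul_self_sqrt (by positivity), div_mul_cancel₀ _ hvv.ne']
  have hue : u ⬝ᵥ e = 0 := by simp [hu, sub_dotProduct, he]
  set w := t • v - u with hw
  have hwe : w ⬝ᵥ e = 0 := by
    rw [hw, sub_dotProduct, smul_dotProduct, hv, hue]
    simp
  obtain ⟨c, hc⟩ := h (householder w) (householder_mulVec_of_orthogonal hwe)
  have hc0 : c ≠ 0 := by
    rintro rfl
    have h2 := congrArg norm hc
    rw [norm_rotation, zero_smul, norm_zero, norm_eq_zero] at h2
    exact h0 h2
  have h2 := congrArg (fun o => rotation n o Ψ) (householder_mulVec_eq_conj (householder w) u)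
  simp only [rotation_mul] at h2
  rw [householder_sub_mulVec huu, rotation_swap hij, hc, map_smul] at h2
  rw [mem_rotationStabilizer, ← householder_smul ht0.ne']
  exact smul_right_injective _ hc0 h2

/-! ### Rows of nontrivial orthogonal matrices -/

theorem sum_mul_row {k : ℕ} (o : Matrix.orthogonalGroup (Fin k) ℝ) (c d : Fin k) :
    ∑ b, (o : Matrix (Fin k) (Fin k) ℝ) c b * (o : Matrix (Fin k) (Fin k) ℝ) d b
      = if c = d then 1 else 0 := by
  have h := congrFun (congrFun (mul_transpose_of_orthogonal o) c) d
  rwa [Matrix.mul_apply, Matrix.one_apply] at h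

theorem sum_sq_row {k : ℕ} (o : Matrix.orthogonalGroup (Fin k) ℝ) (c : Fin k) :
    ∑ b, (o : Matrix (Fin k) (Fin k) ℝ) c b ^ 2 = 1 := by
  simpa only [sq, if_true] using sum_mul_row o c c

/-- A row with one entry outside `{0, 1, -1}` has all its entries in `(-1, 1)`. -/
theorem IsNontrivial.exists_row {k : ℕ} {o : Matrix.orthogonalGroup (Fin k) ℝ}
    (h : IsNontrivial o) : ∃ c, ∀ b, |(o : Matrix (Fin k) (Fin k) ℝ) c b| < 1 := by
  obtain ⟨c, j, hj⟩ := h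
  refine ⟨c, fun b => ?_⟩
  simp only [Set.mem_insert_iff, Set.mem_singleton_iff, not_or] at hj
  obtain ⟨h0, h1, h2⟩ := hj
  have hs := sum_sq_row o c
  by_contra! hb
  have hb2 := (one_le_sq_iff_one_le_abs _).2 hb
  by_cases hbj : b = j
  · subst hbj
    have h3 : (o : Matrix (Fin k) (Fin k) ℝ) c b ^ 2 ≤ 1 := hs ▸ Finset.single_le_sum
      (f := fun b => (o : Matrix (Fin k) (Fin k) ℝ) c b ^ 2) (fun _ _ => sq_nonneg _)
      (Finset.mem_univ b)
    exact (sq_eq_one_iff.1 (le_antisymm h3 hb2)).elim h1 h2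
  · have h3 := Finset.sum_le_sum_of_subset_of_nonneg (Finset.subset_univ {b, j})
      (f := fun b => (o : Matrix (Fin k) (Fin k) ℝ) c b ^ 2) fun _ _ _ => sq_nonneg _
    rw [hs, Finset.sum_pair hbj] at h3
    have := pow_pos (abs_pos.2 h0) 2
    rw [sq_abs] at this
    linarith

theorem exists_row_sum_ne_one {k : ℕ} {o : Matrix.orthogonalGroup (Fin k) ℝ}
    (h : ¬ IsStochastic o) : ∃ c, ∑ b, (o : Matrix (Fin k) (Fin k) ℝ) c b ≠ 1 := by
  by_contra! h1
  exact h (funext fun c => by simpa [Matrix.mulVec, dotProduct] using h1 c)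

theorem IsStochastic.row_sum {k : ℕ} {o : Matrix.orthogonalGroup (Fin k) ℝ}
    (h : IsStochastic o) (c : Fin k) : ∑ b, (o : Matrix (Fin k) (Fin k) ℝ) c b = 1 := by
  simpa [Matrix.mulVec, dotProduct] using congrFun h c

theorem householder_apply {k : ℕ} (v : Fin k → ℝ) (i j : Fin k) :
    (householder v : Matrix (Fin k) (Fin k) ℝ) i j
      = (if i = j then 1 else 0) - 2 / (v ⬝ᵥ v) * (v i * v j) := by
  change reflectionMatrix v i j = _
  rw [reflectionMatrix, Matrix.sub_apply, Matrix.one_apply, Matrix.smul_apply,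
    Matrix.vecMulVec_apply, smul_eq_mul]

/-- The reflection along `e₀ + 2 e₁` has the entry `3/5`, in a row with sum `-1/5`. -/
theorem exists_isNontrivial_not_isStochastic {k : ℕ} (hk : 2 ≤ k) :
    ∃ o : Matrix.orthogonalGroup (Fin k) ℝ, IsNontrivial o ∧ ¬ IsStochastic o := by
  set i : Fin k := ⟨0, by omega⟩
  set j : Fin k := ⟨1, by omega⟩
  have hij : i ≠ j := by simp [i, j]
  set v : Fin k → ℝ := Pi.single i 1 + (2 : ℝ) • Pi.single j 1 with hv
  have hvi : v i = 1 := by simp [hv, hij]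
  have hvj : v j = 2 := by simp [hv, hij.symm]
  have hvv : v ⬝ᵥ v = 5 := by
    conv_lhs => lhs; rw [hv]
    rw [add_dotProduct, smul_dotProduct, single_one_dotProduct, single_one_dotProduct, hvi, hvj]
    norm_num
  refine ⟨householder v, ⟨i, i, ?_⟩, fun h => ?_⟩
  · rw [householder_apply, hvv, hvi]
    norm_num
  · have h1 := congrFun h i
    have h2 : v ⬝ᵥ 1 = 3 := by
      rw [hv, add_dotProduct, smul_dotProduct, single_one_dotProduct, single_one_dotProduct]
      norm_num
    rw [householder_mulVec, hvv, h2, Pi.sub_apply, Pi.smul_apply, hvi] at h1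
    norm_num at h1

/-- The reflection along `e₀ + e₁ - 2 e₂` fixes `(1, …, 1)` and has the entry `2/3`. -/
theorem exists_isNontrivial_isStochastic {k : ℕ} (hk : 3 ≤ k) :
    ∃ o : Matrix.orthogonalGroup (Fin k) ℝ, IsNontrivial o ∧ IsStochastic o := by
  set i : Fin k := ⟨0, by omega⟩
  set j : Fin k := ⟨1, by omega⟩
  set l : Fin k := ⟨2, by omega⟩
  have hij : i ≠ j := by simp [i, j]
  have hil : i ≠ l := by simp [i, l]
  have hjl : j ≠ l := by simp [j, l]
  set v : Fin k → ℝ := Pi.single i 1 + Pi.single j 1 + (-2 : ℝ) • Pi.single l 1 with hv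
  have hvi : v i = 1 := by simp [hv, hij, hil]
  have hvj : v j = 1 := by simp [hv, hij.symm, hjl]
  have hvl : v l = -2 := by simp [hv, hil.symm, hjl.symm]
  have hvv : v ⬝ᵥ v = 6 := by
    conv_lhs => lhs; rw [hv]
    rw [add_dotProduct, add_dotProduct, smul_dotProduct, single_one_dotProduct,
      single_one_dotProduct, single_one_dotProduct, hvi, hvj, hvl]
    norm_num
  refine ⟨householder v, ⟨i, i, ?_⟩, householder_mulVec_of_orthogonal ?_⟩
  · rw [householder_apply, hvv, hvi]
    norm_num
  · rw [hv, add_dotProduct, add_dotProduct, smul_dotProduct, single_one_dotProduct,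
      single_one_dotProduct, single_one_dotProduct]
    norm_num

/-! ### Gaussian states and product invariance -/

/-- A density operator with finite second moments, as a unit vector `v` in the space of families,
together with the families `R_j v`. -/
theorem exists_families {n : ℕ} {ρ : Modes n →L[ℂ] Modes n} (hρ : IsDensityOperator ρ)
    (h2 : HasFiniteSecondMoments ρ) :
    ∃ (V : Families (basisIndex n) n) (W : Fin n ⊕ Fin n → Families (basisIndex n) n),
      (V : basisIndex n → Modes n) = sqrtVec ρ ∧ ‖V‖ = 1 ∧
        ∀ i, IsQuadratureImage (V i) fun j => W j i := by
  have hmem : ∀ f : basisIndex n → Modes n, (Summable fun i => ‖f i‖ ^ 2) → Memℓp f 2 :=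
    fun f hf => memℓp_gen (by simpa using hf)
  choose hd hs using h2
  set V : Families (basisIndex n) n := ⟨sqrtVec ρ, hmem _ (summable_sqrtVec hρ)⟩
  refine ⟨V, fun j => ⟨fun i => quadrature j ⟨sqrtVec ρ i, hd j i⟩, hmem _ (hs j)⟩, rfl, ?_,
    fun i j => ⟨hd j i, rfl⟩⟩
  have h1 : ⟪V, V⟫_ℂ = 1 := by
    refine (lp.hasSum_inner (𝕜 := ℂ) V V).unique (hρ.trace_eq_one.congr_fun fun i => ?_)
    rw [← opSqrt_opSqrt hρ.isPositive, ← inner_opSqrt]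
    rfl
  rw [inner_self_eq_norm_sq_to_K] at h1
  have h3 : ‖V‖ ^ 2 = 1 := Complex.ofReal_injective (by push_cast; exact h1)
  exact (pow_eq_one_iff_of_nonneg (norm_nonneg _) two_ne_zero).1 h3

theorem hasMean_iff {n : ℕ} {ρ : Modes n →L[ℂ] Modes n} {V : Families (basisIndex n) n}
    {W : Fin n ⊕ Fin n → Families (basisIndex n) n}
    (hV : (V : basisIndex n → Modes n) = sqrtVec ρ)
    (hW : ∀ i, IsQuadratureImage (V i) fun j => W j i) {m : Fin n ⊕ Fin n → ℝ} :
    HasMean ρ m ↔ ∀ j, ⟪V, W j⟫_ℂ = m j := by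
  simp only [HasMean, ← hV]
  refine forall_congr' fun j => ⟨fun ⟨hd, hs⟩ => ?_, fun h => ⟨fun i => (hW i j).1, ?_⟩⟩
  · refine (lp.hasSum_inner (𝕜 := ℂ) V (W j)).unique (hs.congr_fun fun i => ?_)
    exact congrArg (fun w => ⟪V i, w⟫_ℂ) (hW i j).2.symm
  · rw [← h]
    refine (lp.hasSum_inner (𝕜 := ℂ) V (W j)).congr_fun fun i => ?_
    exact congrArg (fun w => ⟪V i, w⟫_ℂ) (hW i j).2

/-- The scaling equation of the row `c` of `o`. -/
theorem IsProductInvariant.eq_prod_row {n k : ℕ} {χ : (Fin n ⊕ Fin n → ℝ) → ℂ}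
    {o : Matrix.orthogonalGroup (Fin k) ℝ} (h : IsProductInvariant χ o) (h0 : χ 0 = 1) (c : Fin k)
    (r : Fin n ⊕ Fin n → ℝ) : χ r = ∏ b, χ ((o : Matrix (Fin k) (Fin k) ℝ) c b • r) := by
  have h1 : ∏ j, χ ((Pi.single c r : Fin k → Fin n ⊕ Fin n → ℝ) j) = χ r := by
    rw [Finset.prod_eq_single c (fun j _ hj => by rw [Pi.single_eq_of_ne hj, h0]) (by simp),
      Pi.single_eq_same]
  rw [← h1, ← h]
  refine Finset.prod_congr rfl fun b _ => congrArg χ ?_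
  rw [Finset.sum_eq_single c (fun j _ hj => by rw [Pi.single_eq_of_ne hj, smul_zero]) (by simp),
    Pi.single_eq_same]

/-- The nontrivial matrix `o` has a row whose scaling equation forces `χ` to be Gaussian. -/
theorem IsProductInvariant.isGaussian {n k : ℕ} {ρ : Modes n →L[ℂ] Modes n}
    (hρ : IsDensityOperator ρ) (h2 : HasFiniteSecondMoments ρ)
    {o : Matrix.orthogonalGroup (Fin k) ℝ} (ho : IsNontrivial o)
    (h : IsProductInvariant (charFn ρ) o) : IsGaussian ρ := by
  obtain ⟨V, W, hVρ, hV, hW⟩ := exists_families hρ h2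
  rw [charFn_eq_familyCharFn hρ, ← hVρ] at h
  obtain ⟨c, hc⟩ := ho.exists_row
  refine ⟨fun j => (⟪V, W j⟫_ℂ).re, covariance V W, posSemidef_covariance hV, fun r => ?_⟩
  rw [charFn_eq_familyCharFn hρ, ← hVρ]
  exact familyCharFn_eq_gaussian hV hW (sum_sq_row o c) hc
    (h.eq_prod_row (by simpa using familyCharFn_zero hV 0) c) r

/-- To first order, the scaling equation of a row of `o` multiplies the mean by the sum of the row. -/
theorem IsProductInvariant.hasMean_zero {n k : ℕ} {ρ : Modes n →L[ℂ] Modes n}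
    (hρ : IsDensityOperator ρ) (h2 : HasFiniteSecondMoments ρ)
    {o : Matrix.orthogonalGroup (Fin k) ℝ} (ho : ¬ IsStochastic o)
    (h : IsProductInvariant (charFn ρ) o) : HasMean ρ 0 := by
  obtain ⟨V, W, hVρ, hV, hW⟩ := exists_families hρ h2
  rw [charFn_eq_familyCharFn hρ, ← hVρ] at h
  obtain ⟨c, hc⟩ := exists_row_sum_ne_one ho
  rw [hasMean_iff hVρ hW]
  intro j
  -- the derivative at `0` in the direction `-Ω e_j` is `-i` times the `j`-th first moment
  have h3 := deriv_eq_of_scaling (familyCharFn_zero hV (-(Omega n *ᵥ Pi.single j 1)))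
    (a := fun b => (o : Matrix (Fin k) (Fin k) ℝ) c b) (fun t => by
      simpa only [smul_smul] using h.eq_prod_row (by simpa using familyCharFn_zero hV 0) c
        (t • -(Omega n *ᵥ Pi.single j 1)))
    (hasDerivAt_familyCharFn_zero hW _)
  rw [← Finset.mul_sum, generator_neg_Omega_single, inner_smul_right] at h3
  by_contra h4
  have h5 : -Complex.I * ⟪V, W j⟫_ℂ ≠ 0 :=
    mul_ne_zero (neg_ne_zero.2 Complex.I_ne_zero) (by simpa using h4)
  refine hc ?_
  have h6 := mul_left_cancel₀ h5 ((mul_one _).trans h3)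
  exact_mod_cast h6.symm

/-- Gaussians are product invariant as soon as their linear part is preserved. -/
theorem isProductInvariant_of_gaussian {n k : ℕ} {χ : (Fin n ⊕ Fin n → ℝ) → ℂ}
    {m : Fin n ⊕ Fin n → ℝ} {M : Matrix (Fin n ⊕ Fin n) (Fin n ⊕ Fin n) ℝ}
    (hχ : ∀ r, χ r = Complex.exp
      (((-(1 / 4) * ((Omega n *ᵥ r) ⬝ᵥ (M *ᵥ (Omega n *ᵥ r))) : ℝ) : ℂ)
        + Complex.I * ((r ⬝ᵥ (Omega n *ᵥ m) : ℝ) : ℂ)))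
    {o : Matrix.orthogonalGroup (Fin k) ℝ}
    (hm : ∀ r c, (∑ b, (o : Matrix (Fin k) (Fin k) ℝ) c b) * (r ⬝ᵥ (Omega n *ᵥ m))
      = r ⬝ᵥ (Omega n *ᵥ m)) : IsProductInvariant χ o := by
  intro R
  have hquad : ∑ b, (Omega n *ᵥ ∑ c, (o : Matrix (Fin k) (Fin k) ℝ) c b • R c) ⬝ᵥ
      (M *ᵥ (Omega n *ᵥ ∑ c, (o : Matrix (Fin k) (Fin k) ℝ) c b • R c))
      = ∑ c, (Omega n *ᵥ R c) ⬝ᵥ (M *ᵥ (Omega n *ᵥ R c)) := by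
    simp only [Matrix.mulVec_sum, Matrix.mulVec_smul, sum_dotProduct, dotProduct_sum,
      smul_dotProduct, dotProduct_smul, smul_eq_mul]
    rw [Finset.sum_comm]
    refine Finset.sum_congr rfl fun c _ => ?_
    simp only [Finset.mul_sum]
    rw [Finset.sum_comm]
    simp only [← mul_assoc, ← Finset.sum_mul, sum_mul_row]
    simp
  have hlin : ∑ b, (∑ c, (o : Matrix (Fin k) (Fin k) ℝ) c b • R c) ⬝ᵥ (Omega n *ᵥ m)
      = ∑ c, R c ⬝ᵥ (Omega n *ᵥ m) := by
    simp only [sum_dotProduct, smul_dotProduct, smul_eq_mul]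
    rw [Finset.sum_comm]
    refine Finset.sum_congr rfl fun c _ => ?_
    rw [← Finset.sum_mul, hm]
  simp only [hχ, ← Complex.exp_sum, Finset.sum_add_distrib, ← Finset.mul_sum, ← Complex.ofReal_sum,
    hquad, hlin]

theorem IsGaussian.isProductInvariant_of_isStochastic {n k : ℕ} {ρ : Modes n →L[ℂ] Modes n}
    (h : IsGaussian ρ) {o : Matrix.orthogonalGroup (Fin k) ℝ} (ho : IsStochastic o) :
    IsProductInvariant (charFn ρ) o := by
  obtain ⟨m, M, -, hχ⟩ := h
  exact isProductInvariant_of_gaussian hχ fun r c => by rw [ho.row_sum, one_mul]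

theorem IsGaussian.isProductInvariant_of_hasMean_zero {n k : ℕ} {ρ : Modes n →L[ℂ] Modes n}
    (hρ : IsDensityOperator ρ) (h2 : HasFiniteSecondMoments ρ) (h : IsGaussian ρ)
    (h0 : HasMean ρ 0) (o : Matrix.orthogonalGroup (Fin k) ℝ) :
    IsProductInvariant (charFn ρ) o := by
  obtain ⟨V, W, hVρ, hV, hW⟩ := exists_families hρ h2
  obtain ⟨m, M, -, hχ⟩ := h
  rw [hasMean_iff hVρ hW] at h0
  refine isProductInvariant_of_gaussian hχ fun r c => ?_
  -- both sides of the equation below are derivatives at `0` of the characteristic function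
  suffices h3 : Complex.I * ((r ⬝ᵥ (Omega n *ᵥ m) : ℝ) : ℂ) = ⟪V, generator W r⟫_ℂ by
    rw [inner_generator] at h3
    simp only [h0, Pi.zero_apply, Complex.ofReal_zero, mul_zero, Finset.sum_const_zero,
      mul_eq_zero, Complex.I_ne_zero, false_or, Complex.ofReal_eq_zero] at h3
    rw [h3, mul_zero]
  have hd := hasDerivAt_familyCharFn_zero hW r
  rw [hVρ, ← charFn_eq_familyCharFn hρ] at hd
  refine HasDerivAt.unique ?_ hd
  simp only [hχ, Matrix.mulVec_smul, smul_dotProduct, dotProduct_smul, smul_eq_mul]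
  have hid : HasDerivAt (fun t : ℝ => (t : ℂ)) 1 0 := Complex.ofRealCLM.hasDerivAt
  set q : ℝ := (Omega n *ᵥ r) ⬝ᵥ (M *ᵥ (Omega n *ᵥ r))
  set l : ℝ := r ⬝ᵥ (Omega n *ᵥ m)
  have h3 := (((hid.mul (hid.mul_const (q : ℂ))).const_mul (-(1 / 4) : ℂ)).add
    ((hid.mul_const (l : ℂ)).const_mul Complex.I)).cexp
  refine (h3.congr_deriv (by simp)).congr_of_eventuallyEq (Eventually.of_forall fun t => ?_)
  simp

/-! ### Moments of rotation invariant pure states -/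

theorem mem_quadrature_domain_of_differentiableAt {n : ℕ} {ψ : Modes n}
    (h : ∀ r : Fin n ⊕ Fin n → ℝ, DifferentiableAt ℝ (fun t : ℝ => displacement (t • r) ψ) 0)
    (j : Fin n ⊕ Fin n) : ψ ∈ (quadrature j).domain := by
  rcases j with a | a
  · exact mem_position_domain_of_differentiableAt (h _)
  · exact mem_momentum_domain_of_differentiableAt (h _)

/-- A pure state whose characteristic function is product invariant has finite second moments. -/
theorem IsProductInvariant.hasFiniteSecondMoments {n k : ℕ} {ψ : Modes n} (hψ : ‖ψ‖ = 1)
    {o : Matrix.orthogonalGroup (Fin k) ℝ} (ho : IsNontrivial o)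
    (h : IsProductInvariant (charFn (pureState ψ)) o) :
    HasFiniteSecondMoments (pureState ψ) := by
  refine hasFiniteSecondMoments_pureState hψ (mem_quadrature_domain_of_differentiableAt fun r => ?_)
  obtain ⟨c, hc⟩ := ho.exists_row
  set φ : ℝ → ℂ := fun t => charFn (pureState ψ) (t • r) with hφ
  have hφ' : ∀ t, φ t = ⟪ψ, displacement (t • r) ψ⟫_ℂ := fun t => charFn_pureState_apply ψ _
  have hcont : Continuous φ := by
    rw [funext hφ']
    exact continuous_const.inner (continuous_displacement_smul r ψ)
  have hχ0 : charFn (pureState ψ) 0 = 1 := by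
    rw [charFn_pureState_apply, displacement_zero, inner_self_eq_norm_sq_to_K, hψ]
    simp
  have h0 : φ 0 = 1 := by simp only [hφ, zero_smul, hχ0]
  obtain ⟨φ', κ, h1, h2⟩ := exists_hasDerivAt_of_rotation_invariant
    (mul_transpose_of_orthogonal o) hc hcont h0 fun t => by
      have h3 := h fun j => t j • r
      simpa only [smul_smul, ← Finset.sum_smul] using h3.symm
  refine differentiableAt_displacement_of_gaussian (μ := φ' 0) (ν := (κ - φ' 0 ^ 2) / 2)
    fun t => ?_
  rw [← hφ']
  refine eq_exp_of_scaling (sum_sq_row o c) hc h0 (fun t => ?_) h1 h2 t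
  simpa only [smul_smul] using h.eq_prod_row hχ0 c (t • r)

end Bosonic

end

theorem mainTheorem1 (n : ℕ) :
    (∀ ρ : Modes n →L[ℂ] Modes n, IsDensityOperator ρ → HasFiniteSecondMoments ρ →
      (∀ k : ℕ, 2 ≤ k → List.TFAE
        [∀ o : Matrix.orthogonalGroup (Fin k) ℝ, IsRotationInvariant ρ o,
         ∃ o : Matrix.orthogonalGroup (Fin k) ℝ,
           IsNontrivial o ∧ ¬ IsStochastic o ∧ IsRotationInvariant ρ o,
         IsGaussian ρ ∧ HasMean ρ 0]) ∧
      (∀ k : ℕ, 3 ≤ k → List.TFAE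
        [∀ o : Matrix.orthogonalGroup (Fin k) ℝ, IsStochastic o → IsRotationInvariant ρ o,
         ∃ o : Matrix.orthogonalGroup (Fin k) ℝ,
           IsNontrivial o ∧ IsStochastic o ∧ IsRotationInvariant ρ o,
         IsGaussian ρ])) ∧
    (∀ ψ : Modes n, ‖ψ‖ = 1 →
      (∀ k : ℕ, 2 ≤ k → List.TFAE
        [∀ o : Matrix.orthogonalGroup (Fin k) ℝ,
           rotation n o (vecTensorPow k ψ) = vecTensorPow k ψ,
         ∃ o : Matrix.orthogonalGroup (Fin k) ℝ,
           IsNontrivial o ∧ ¬ IsStochastic o ∧ rotation n o (vecTensorPow k ψ) = vecTensorPow k ψ,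
         IsGaussian (pureState ψ) ∧ HasMean (pureState ψ) 0]) ∧
      (∀ k : ℕ, 3 ≤ k → List.TFAE
        [∀ o : Matrix.orthogonalGroup (Fin k) ℝ,
           IsStochastic o → rotation n o (vecTensorPow k ψ) = vecTensorPow k ψ,
         ∃ o : Matrix.orthogonalGroup (Fin k) ℝ,
           IsNontrivial o ∧ IsStochastic o ∧ rotation n o (vecTensorPow k ψ) = vecTensorPow k ψ,
         IsGaussian (pureState ψ)])) := by
  refine ⟨fun ρ hρ h2 => ⟨fun k hk => ?_, fun k hk => ?_⟩,
    fun ψ hψ => ⟨fun k hk => ?_, fun k hk => ?_⟩⟩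
  · simp only [isRotationInvariant_iff hρ]
    tfae_have 1 → 2 := fun h => by
      obtain ⟨o, ho, ho'⟩ := exists_isNontrivial_not_isStochastic hk
      exact ⟨o, ho, ho', h o⟩
    tfae_have 2 → 3 := fun ⟨o, ho, ho', h⟩ => ⟨h.isGaussian hρ h2 ho, h.hasMean_zero hρ h2 ho'⟩
    tfae_have 3 → 1 := fun h o => h.1.isProductInvariant_of_hasMean_zero hρ h2 h.2 o
    tfae_finish
  · simp only [isRotationInvariant_iff hρ]
    tfae_have 1 → 2 := fun h => by
      obtain ⟨o, ho, ho'⟩ := exists_isNontrivial_isStochastic hk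
      exact ⟨o, ho, ho', h o ho'⟩
    tfae_have 2 → 3 := fun ⟨o, ho, _, h⟩ => h.isGaussian hρ h2 ho
    tfae_have 3 → 1 := fun h o ho => h.isProductInvariant_of_isStochastic ho
    tfae_finish
  · have hρ := isDensityOperator_pureState hψ
    have hij : (⟨0, by omega⟩ : Fin k) ≠ ⟨1, by omega⟩ := by simp
    tfae_have 1 → 2 := fun h => by
      obtain ⟨o, ho, ho'⟩ := exists_isNontrivial_not_isStochastic hk
      exact ⟨o, ho, ho', h o⟩
    tfae_have 2 → 3 := fun ⟨o, ho, ho', h⟩ => by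
      have h1 := isProductInvariant_of_rotation_eq h
      have h2 := h1.hasFiniteSecondMoments hψ ho
      exact ⟨h1.isGaussian hρ h2 ho, h1.hasMean_zero hρ h2 ho'⟩
    tfae_have 3 → 1 := fun h o =>
      rotation_eq_of_forall_smul hij (e := 0) rfl
        (fun o _ => exists_rotation_eq_smul hψ (h.1.isProductInvariant_of_hasMean_zero hρ
          (hasFiniteSecondMoments_of_hasMean hψ h.2) h.2 o)) (Matrix.mulVec_zero _)
    tfae_finish
  · have hρ := isDensityOperator_pureState hψ
    have hij : (⟨0, by omega⟩ : Fin k) ≠ ⟨1, by omega⟩ := by simp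
    tfae_have 1 → 2 := fun h => by
      obtain ⟨o, ho, ho'⟩ := exists_isNontrivial_isStochastic hk
      exact ⟨o, ho, ho', h o ho'⟩
    tfae_have 2 → 3 := fun ⟨o, ho, _, h⟩ => by
      have h1 := isProductInvariant_of_rotation_eq h
      exact h1.isGaussian hρ (h1.hasFiniteSecondMoments hψ ho) ho
    tfae_have 3 → 1 := fun h o ho =>
      rotation_eq_of_forall_smul hij (e := 1) rfl
        (fun o ho => exists_rotation_eq_smul hψ (h.isProductInvariant_of_isStochastic ho)) ho
    tfae_finish
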